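/- **Setting.** Let $(\mathscr F,d)$ be a semimetric (i.e. pseudometric) space with its Borel $\sigma$-field, $(X_i,Y_i)_{i\ge1}$ random pairs on a probability space with values in $\mathscr F\times\mathbb R$, possibly dependent and not identically distributed, $\varphi:\mathbb R\to\mathbb R$ Borel, and suppose $\varphi(Y_i)=m_\varphi(X_i)+\epsilon_i$, where $m_\varphi(u)=E(\varphi(Y_i)\mid X_i=u)$ for all $i$ (so $E(\epsilon_i\mid X_i)=0$) and $\epsilon_i$ is independent of $X_j$ for $j\ne i$. Let $h=h_n>0$ with $h\to0$, $nh\to\infty$; $\beta:\mathscr F^2\to\mathbb R$ with $\beta(u,u)=0$; $K:\mathbb R\to[0,\infty)$. Fix $x\in\mathscr F$ and put $\beta_i=\beta(X_i,x)$, $K_i=K(d(X_i,x)/h)$, $w_{i,j}=\beta_i(\beta_i-\beta_j)K_iK_j$, $$\hat m_\varphi(x)=\frac{\sum_{i,j=1}^n w_{i,j}\,\varphi(Y_j)}{\sum_{i,j=1}^n w_{i,j}} .$$ Write $[n]=\{1,\dots,n\}$, $B(x,r)=\{u:d(x,u)\le r\}$, $\phi_i(r_1,r_2)=P(r_1\le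 d(x,X_i)\le r_2)$, $\phi_i(r)=\phi_i(0,r)$, $\phi_x(r)=\max_{s\in[n]}\phi_s(r)$, $\Psi_{i,j}(r_1,r_2,r_3,r_4)=P(r_1\le d(x,X_i)\le r_2,\ r_3\le d(x,X_j)\le r_4)$, $\Psi_{i,j}(r)=\Psi_{i,j}(0,r,0,r)$, $P_{i,j}$ for the law of $(X_i,X_j)$, and $\gamma_{k,i}(u)=E(|\varphi(Y_i)|^k\mid X_i=u)$, $k\ge1$. Derivatives of functions on $[0,1]$ are one-sided at the end points. Constants do not depend on $n,i,j$. **Assumptions.** - **A1.** $\phi_i(r)>0$ for all $r>0$, $i\ge1$. - **A2.** For some $b>0$ and $C_2>0$, $|m_\varphi(x_1)-m_\varphi(x_2)|\le C_2\,d(x_1,x_2)^b$ for all $x_1,x_2\in B(x,h)$, $n$ large. - **A3.** There are $0<c_3\le C_3$ with $c_3 d(u,x)\le|\beta(u,x)|\le C_3 d(u,x)$ for all $u\in\mathscr F$. - **A4.** For every $k\ge1$, $\gamma_{k,i}$ is continuous at $x$ uniformly in $i$, in the sense that $\max_{i\in[n]}\sup_{u\in B(x,h)}|\gamma_{k,i}(u)-\gamma_{k,i}(x)|\to0$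 as $n\to\infty$. There are $c_4,C_4>0$ with $c_4<\gamma_{1,i}(x)$ and $\gamma_{k,i}(x)<C_4$ for all $i\ge1$, $k\ge2$, and $E(|\varphi(Y_i)\varphi(Y_j)|\mid(X_i,X_j))\le C_4$ a.s. for all $i\ne j$. - **A5.** $\int_0^1K=1$, $K$ is differentiable on $[0,1]$, and either (I) $c_5 1_{[0,1]}\le K\le C_5 1_{[0,1]}$ for some $0<c_5\le C_5$, or (II) $K(1)=0$, $\{K\ne0\}=[0,1)$ and $-C_5'\le K'\le -c_5'$ on $[0,1]$ for some $0<c_5'\le C_5'$. In case (II), moreover, there are $c_0>0$ and $\epsilon_0\in(0,1)$ with $\int_0^{\epsilon_0}\phi_i(uh)\,du>c_0\phi_i(h)$ for all $i\in[n]$, $n$ large. - **A6.** (i) There are $c_6>0$, $\epsilon^*\in(0,1)$ with $\phi_i(h)^{-1}\int_0^{\epsilon^*}\phi_i(zh,\epsilon^*h)\frac{d}{dz}(z^lK(z))\,dz>c_6$ for all $i\in[n]$, $l\in\{2,4\}$, $n$ large. (ii) As $r\to0$, $r^2\iint_{B(x,r)^2}\beta(u,x)\beta(v,x)\,dP_{i,j}(u,v)=o\big(\iint_{B(x,r)^2}\beta(u,x)^2\beta(v,x)^2\,dP_{i,j}(u,v)\big)$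 uniformly, in the sense that for every $\varepsilon>0$ and all large $n$ the absolute value of the left side is at most $\varepsilon$ times the integral on the right, for all $0<r\le h_n$ and all $i\ne j$ in $[n]$. - **A7.** $\max_{s\in[n]}\phi_s(h)=O(\min_{s\in[n]}\phi_s(h))$. - **A8.** With $\alpha(\cdot)$ the strong mixing coefficients of $(Y_i,X_i)_{i\ge1}$, there are $\delta>0$, $a=3+\delta$ and $C_8$ with $\alpha(n)\le C_8n^{-a}$ for all $n\ge1$, and there is $0<\Delta<\min(a+1,\delta)$ with $\phi_x(h)^{2(a+1)}\ge(\ln n)^{3(a+1)}n^{-\Delta}$ for $n$ large. - **A9.** There are $c_9,C_9>0$ such that for $n$ large and all $i\ne j$ in $[n]$ there are exponents $1/4<p_{1,i,j}\le1/2\le p_{2,i,j}<3/4$ (possibly depending on $n$) with $c_9[\phi_i(h)\phi_j(h)]^{1/2+p_{2,i,j}}\le\Psi_{i,j}(h)\le C_9[\phi_i(h)\phi_j(h)]^{1/2+p_{1,i,j}}$. - **A10.** There is $c_{10}>0$ such that for $n$ large and all $i\ne j$ in $[n]$: if $K$ is of type (I), $\frac1{\Psi_{i,j}(h)}\int_0^1\Psi_{i,j}(zh,h,0,h)\frac{d}{dz}(z^2K(z))\,dz>c_{10}$;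 if $K$ is of type (II), $-\frac1{\Psi_{i,j}(h)}\int_0^1\!\int_0^1\Psi_{i,j}(zh,h,0,wh)\frac{d}{dz}(z^2K(z))K'(w)\,dz\,dw>c_{10}$. **Theorem.** Under A1–A10, with $p_{\max}=\max_{i\ne j\in[n]}p_{2,i,j}$, $$\hat m_\varphi(x)-m_\varphi(x)=O(h^b)+O_{a.co.}\left(\sqrt{\frac{\ln n}{n\,\phi_x(h)^{4p_{\max}-1}}}\right),$$ where the term $O(h^b)$ is deterministic and $Z_n=O_{a.co.}(a_n)$ means that $\sum_nP(|Z_n/a_n|>\varepsilon)<\infty$ for some $\varepsilon>0$. -/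

import Mathlib

open MeasureTheory ProbabilityTheory Filter Topology Asymptotics

namespace LocalLinear

noncomputable section

/-- The strong mixing coefficient `α(j)` of the sequence `Z 1, Z 2, …`: the supremum of
`|P(A ∩ B) - P(A) P(B)|` over `k ≥ 1`, `A ∈ σ(Z i : 1 ≤ i ≤ k)` and `B ∈ σ(Z i : i ≥ k + j)`.
All numbers in the set lie in `[0, 1]`. -/
def mixingCoeff {Ω E : Type*} [MeasurableSpace Ω] [MeasurableSpace E] (P : Measure Ω)
    (Z : ℕ → Ω → E) (j : ℕ) : ℝ :=
  sSup {r : ℝ | ∃ k : ℕ, 1 ≤ k ∧ ∃ A B : Set Ω,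
    MeasurableSet[⨆ i ∈ Set.Icc 1 k, MeasurableSpace.comap (Z i) inferInstance] A ∧
    MeasurableSet[⨆ i ∈ Set.Ici (k + j), MeasurableSpace.comap (Z i) inferInstance] B ∧
    r = |P.real (A ∩ B) - P.real A * P.real B|}

/-- `Z n = O_{a.co.}(a n)`: for some `ε > 0`, `∑ P(|Z n / a n| > ε) < ∞`. -/
def IsBigOAco {Ω : Type*} [MeasurableSpace Ω] (P : Measure Ω) (Z : ℕ → Ω → ℝ) (a : ℕ → ℝ) :
    Prop :=
  ∃ ε : ℝ, 0 < ε ∧ ∑' n : ℕ, P {ω | ε < |Z n ω / a n|} < ⊤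

section SmallBalls

variable {Ω F : Type*} [MeasurableSpace Ω] [PseudoMetricSpace F]

/-- `P(r₁ ≤ d(x, X i) ≤ r₂)`. -/
def ballProb (P : Measure Ω) (X : ℕ → Ω → F) (x : F) (i : ℕ) (r₁ r₂ : ℝ) : ℝ :=
  P.real {ω | r₁ ≤ dist x (X i ω) ∧ dist x (X i ω) ≤ r₂}

/-- `P(r₁ ≤ d(x, X i) ≤ r₂, r₃ ≤ d(x, X j) ≤ r₄)`. -/
def jointBallProb (P : Measure Ω) (X : ℕ → Ω → F) (x : F) (i j : ℕ) (r₁ r₂ r₃ r₄ : ℝ) : ℝ :=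
  P.real {ω | (r₁ ≤ dist x (X i ω) ∧ dist x (X i ω) ≤ r₂) ∧
    (r₃ ≤ dist x (X j ω) ∧ dist x (X j ω) ≤ r₄)}

/-- The largest small-ball probability `max_{1 ≤ s ≤ n} P(d(x, X s) ≤ r)`. -/
def maxBallProb (P : Measure Ω) (X : ℕ → Ω → F) (x : F) (n : ℕ) (r : ℝ) : ℝ :=
  sSup ((fun s => ballProb P X x s 0 r) '' Set.Icc 1 n)

end SmallBalls

/-- The maximum of `p i j` over `1 ≤ i, j ≤ n` with `i ≠ j`. -/
def maxExponent (p : ℕ → ℕ → ℝ) (n : ℕ) : ℝ :=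
  sSup {q : ℝ | ∃ i ∈ Finset.Icc 1 n, ∃ j ∈ Finset.Icc 1 n, i ≠ j ∧ q = p i j}

section Estimator

variable {Ω F : Type*} [PseudoMetricSpace F]

/-- The local linear weight `w_{i,j}(x) = β_i (β_i - β_j) K_i K_j`, where `β_i = β(X i, x)` and
`K_i = K(d(X i, x) / h)`. -/
def weight (X : ℕ → Ω → F) (β : F → F → ℝ) (K : ℝ → ℝ) (x : F) (h : ℝ) (i j : ℕ) (ω : Ω) : ℝ :=
  β (X i ω) x * (β (X i ω) x - β (X j ω) x) * K (dist (X i ω) x / h) * K (dist (X j ω) x / h)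

/-- The local linear estimator `∑ w_{i,j}(x) φ(Y j) / ∑ w_{i,j}(x)` (sums over `1 ≤ i, j ≤ n`). -/
def estimator (X : ℕ → Ω → F) (Y : ℕ → Ω → ℝ) (φ : ℝ → ℝ) (β : F → F → ℝ) (K : ℝ → ℝ) (x : F)
    (h : ℝ) (n : ℕ) (ω : Ω) : ℝ :=
  (∑ i ∈ Finset.Icc 1 n, ∑ j ∈ Finset.Icc 1 n, weight X β K x h i j ω * φ (Y j ω)) /
    (∑ i ∈ Finset.Icc 1 n, ∑ j ∈ Finset.Icc 1 n, weight X β K x h i j ω)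

end Estimator

section Assumptions

variable {Ω F : Type*} [MeasurableSpace Ω] [PseudoMetricSpace F] [MeasurableSpace F]

/-- The generalized regression model `φ(Y i) = m(X i) + ε i`, `i ≥ 1`, where
`m(u) = E(φ(Y i) | X i = u)` for every `i`, that is `E(ε i | X i) = 0` (hence `E(ε i) = 0`), and
`ε i` is independent of `X j` for `j ≠ i`. -/
structure RegressionModel (P : Measure Ω) (X : ℕ → Ω → F) (Y : ℕ → Ω → ℝ) (φ : ℝ → ℝ)
    (m : F → ℝ) : Prop where
  measurable_X : ∀ i, 1 ≤ i → Measurable (X i)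
  measurable_Y : ∀ i, 1 ≤ i → Measurable (Y i)
  measurable_φ : Measurable φ
  measurable_m : Measurable m
  integrable_error : ∀ i, 1 ≤ i → Integrable (fun ω => φ (Y i ω) - m (X i ω)) P
  condExp_error : ∀ i, 1 ≤ i →
    P[fun ω => φ (Y i ω) - m (X i ω) | MeasurableSpace.comap (X i) inferInstance] =ᵐ[P] 0
  indep_error : ∀ i j, 1 ≤ i → 1 ≤ j → i ≠ j →
    IndepFun (fun ω => φ (Y i ω) - m (X i ω)) (X j) P

/-- The bandwidth: `h n > 0`, `h n → 0` and `n * h n → ∞`. -/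
structure Bandwidth (h : ℕ → ℝ) : Prop where
  pos : ∀ n, 0 < h n
  tendsto_zero : Tendsto h atTop (𝓝 0)
  tendsto_mul : Tendsto (fun n : ℕ => (n : ℝ) * h n) atTop atTop

/-- Every small-ball probability around `x` is positive. -/
def PositiveBalls (P : Measure Ω) (X : ℕ → Ω → F) (x : F) : Prop :=
  ∀ r : ℝ, 0 < r → ∀ i, 1 ≤ i → 0 < ballProb P X x i 0 r

/-- `m` is Hölder continuous of order `b > 0` on the closed balls `B(x, h n)`, `n` large. -/
def HolderNear (m : F → ℝ) (x : F) (h : ℕ → ℝ) (b : ℝ) : Prop :=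
  0 < b ∧ ∃ C : ℝ, 0 < C ∧ ∀ᶠ n in atTop, ∀ x₁ ∈ Metric.closedBall x (h n),
    ∀ x₂ ∈ Metric.closedBall x (h n), |m x₁ - m x₂| ≤ C * dist x₁ x₂ ^ b

/-- The locating function `β`: it vanishes on the diagonal and `|β(·, x)|` is comparable to
`d(·, x)`. -/
structure LocatingFunction (β : F → F → ℝ) (x : F) : Prop where
  measurable : Measurable fun u => β u x
  diag : ∀ u, β u u = 0
  comparable : ∃ c C : ℝ, 0 < c ∧ c ≤ C ∧
    ∀ u, c * dist u x ≤ |β u x| ∧ |β u x| ≤ C * dist u x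

/-- `g` is a version of `u ↦ E(Z | X = u)`, for a nonnegative random variable `Z`. -/
def IsCondMean (P : Measure Ω) (X : Ω → F) (Z : Ω → ℝ) (g : F → ℝ) : Prop :=
  Measurable g ∧ (∀ u, 0 ≤ g u) ∧ ∀ B : Set F, MeasurableSet B →
    ∫⁻ ω in X ⁻¹' B, ENNReal.ofReal (Z ω) ∂P = ∫⁻ ω in X ⁻¹' B, ENNReal.ofReal (g (X ω)) ∂P

/-- Conditional moments. `γ k i (u) = E(|φ(Y i)| ^ k | X i = u)` is continuous at `x`, uniformly
over the indices `i ≤ n` in the balls `B(x, h n)`; the values at `x` are bounded as stated, and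
`E(|φ(Y i) φ(Y j)| | (X i, X j))` is bounded for `i ≠ j`. -/
structure ConditionalMoments (P : Measure Ω) (X : ℕ → Ω → F) (Y : ℕ → Ω → ℝ) (φ : ℝ → ℝ) (x : F)
    (h : ℕ → ℝ) (γ : ℕ → ℕ → F → ℝ) : Prop where
  version : ∀ k i, 1 ≤ k → 1 ≤ i → IsCondMean P (X i) (fun ω => |φ (Y i ω)| ^ k) (γ k i)
  continuity : ∀ k, 1 ≤ k → ∀ ε : ℝ, 0 < ε → ∀ᶠ n in atTop, ∀ i ∈ Finset.Icc 1 n,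
    ∀ u ∈ Metric.closedBall x (h n), |γ k i u - γ k i x| ≤ ε
  bounds : ∃ c C : ℝ, 0 < c ∧ 0 < C ∧ (∀ i, 1 ≤ i → c < γ 1 i x) ∧
    (∀ k i, 2 ≤ k → 1 ≤ i → γ k i x < C) ∧
    ∀ i j, 1 ≤ i → 1 ≤ j → i ≠ j → Integrable (fun ω => φ (Y i ω) * φ (Y j ω)) P ∧
      P[fun ω => |φ (Y i ω) * φ (Y j ω)| |
        MeasurableSpace.comap (fun ω => (X i ω, X j ω)) inferInstance] ≤ᵐ[P] fun _ => C

/-- Derivative of a function on `[0, 1]` (one-sided at the end points). -/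
def unitDeriv (f : ℝ → ℝ) (z : ℝ) : ℝ := derivWithin f (Set.Icc 0 1) z

/-- Kernels of type (I): bounded above and below on the support `[0, 1]`. -/
def KernelTypeI (K : ℝ → ℝ) : Prop :=
  ∃ c C : ℝ, 0 < c ∧ c ≤ C ∧
    ∀ u, (Set.Icc (0 : ℝ) 1).indicator (fun _ => c) u ≤ K u ∧
      K u ≤ (Set.Icc (0 : ℝ) 1).indicator (fun _ => C) u

/-- Kernels of type (II): supported on `[0, 1)`, zero at `1`, derivative bounded and bounded away
from zero. -/
def KernelTypeII (K : ℝ → ℝ) : Prop :=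
  K 1 = 0 ∧ Function.support K = Set.Ico 0 1 ∧
    ∃ c C : ℝ, 0 < c ∧ c ≤ C ∧ ∀ u ∈ Set.Icc (0 : ℝ) 1, -C ≤ unitDeriv K u ∧ unitDeriv K u ≤ -c

/-- The kernel assumption; for kernels of type (II) it includes a condition on the small-ball
probabilities. -/
structure KernelAssumption (P : Measure Ω) (X : ℕ → Ω → F) (x : F) (h : ℕ → ℝ) (K : ℝ → ℝ) :
    Prop where
  nonneg : ∀ u, 0 ≤ K u
  integral_eq_one : ∫ u in (0 : ℝ)..1, K u = 1
  differentiable : DifferentiableOn ℝ K (Set.Icc 0 1)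
  type : KernelTypeI K ∨ KernelTypeII K
  typeII : KernelTypeII K → ∃ c₀ ε₀ : ℝ, 0 < c₀ ∧ 0 < ε₀ ∧ ε₀ < 1 ∧ ∀ᶠ n in atTop,
    ∀ i ∈ Finset.Icc 1 n,
      c₀ * ballProb P X x i 0 (h n) < ∫ u in (0 : ℝ)..ε₀, ballProb P X x i 0 (u * h n)

/-- Local behaviour of the small-ball probabilities relative to the kernel. -/
def LocalKernelCondition (P : Measure Ω) (X : ℕ → Ω → F) (x : F) (h : ℕ → ℝ) (K : ℝ → ℝ) : Prop :=
  ∃ c ε : ℝ, 0 < c ∧ 0 < ε ∧ ε < 1 ∧ ∀ᶠ n in atTop, ∀ i ∈ Finset.Icc 1 n, ∀ l ∈ ({2, 4} : Set ℕ),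
    c < (ballProb P X x i 0 (h n))⁻¹ *
      ∫ z in (0 : ℝ)..ε, ballProb P X x i (z * h n) (ε * h n) * unitDeriv (fun t => t ^ l * K t) z

/-- Local behaviour of `β`: as the radius `r` tends to zero,
`r² ∬_{B(x,r)²} β(u,x) β(v,x) dP_{i,j}(u,v) = o(∬_{B(x,r)²} β(u,x)² β(v,x)² dP_{i,j}(u,v))`
uniformly over radii `r ≤ h n` and distinct indices `i, j ≤ n`; `P_{i,j}` is the law of
`(X i, X j)`. -/
def LocalBetaCondition (P : Measure Ω) (X : ℕ → Ω → F) (x : F) (h : ℕ → ℝ) (β : F → F → ℝ) :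
    Prop :=
  ∀ ε : ℝ, 0 < ε → ∀ᶠ n in atTop, ∀ r : ℝ, 0 < r → r ≤ h n →
    ∀ i ∈ Finset.Icc 1 n, ∀ j ∈ Finset.Icc 1 n, i ≠ j →
      |r ^ 2 * ∫ q in Metric.closedBall x r ×ˢ Metric.closedBall x r, β q.1 x * β q.2 x
          ∂(P.map fun ω => (X i ω, X j ω))| ≤
        ε * ∫ q in Metric.closedBall x r ×ˢ Metric.closedBall x r, β q.1 x ^ 2 * β q.2 x ^ 2
          ∂(P.map fun ω => (X i ω, X j ω))

/-- `max_{s ≤ n} P(d(x, X s) ≤ h n) = O(min_{s ≤ n} P(d(x, X s) ≤ h n))`. -/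
def ComparableBalls (P : Measure Ω) (X : ℕ → Ω → F) (x : F) (h : ℕ → ℝ) : Prop :=
  ∃ C : ℝ, ∀ᶠ n in atTop, ∀ s ∈ Finset.Icc 1 n, ∀ t ∈ Finset.Icc 1 n,
    ballProb P X x s 0 (h n) ≤ C * ballProb P X x t 0 (h n)

/-- Arithmetic strong mixing of `(Y i, X i)` with rate `a = 3 + δ > 3`, and a lower bound on the
largest small-ball probability. -/
def ArithmeticMixing (P : Measure Ω) (X : ℕ → Ω → F) (Y : ℕ → Ω → ℝ) (x : F) (h : ℕ → ℝ) : Prop :=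
  ∃ a δ C Δ : ℝ, 0 < δ ∧ a = 3 + δ ∧
    (∀ n : ℕ, 1 ≤ n → mixingCoeff P (fun i ω => (Y i ω, X i ω)) n ≤ C * (n : ℝ) ^ (-a)) ∧
    0 < Δ ∧ Δ < min (a + 1) δ ∧
    ∀ᶠ n : ℕ in atTop, Real.log n ^ (3 * (a + 1)) * (n : ℝ) ^ (-Δ) ≤
      maxBallProb P X x n (h n) ^ (2 * (a + 1))

/-- Two-sided bounds on the joint small-ball probabilities, with exponents `p₁ n i j`,
`p₂ n i j` and constants that depend neither on `n` nor on `i, j`. -/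
def JointBallBounds (P : Measure Ω) (X : ℕ → Ω → F) (x : F) (h : ℕ → ℝ) (p₁ p₂ : ℕ → ℕ → ℕ → ℝ) :
    Prop :=
  ∃ c C : ℝ, 0 < c ∧ 0 < C ∧ ∀ᶠ n in atTop, ∀ i ∈ Finset.Icc 1 n, ∀ j ∈ Finset.Icc 1 n, i ≠ j →
    1 / 4 < p₁ n i j ∧ p₁ n i j ≤ 1 / 2 ∧ 1 / 2 ≤ p₂ n i j ∧ p₂ n i j < 3 / 4 ∧
    c * (ballProb P X x i 0 (h n) * ballProb P X x j 0 (h n)) ^ (1 / 2 + p₂ n i j) ≤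
      jointBallProb P X x i j 0 (h n) 0 (h n) ∧
    jointBallProb P X x i j 0 (h n) 0 (h n) ≤
      C * (ballProb P X x i 0 (h n) * ballProb P X x j 0 (h n)) ^ (1 / 2 + p₁ n i j)

/-- Local behaviour of the joint small-ball probabilities relative to the kernel. -/
def JointKernelCondition (P : Measure Ω) (X : ℕ → Ω → F) (x : F) (h : ℕ → ℝ) (K : ℝ → ℝ) : Prop :=
  ∃ c : ℝ, 0 < c ∧ ∀ᶠ n in atTop, ∀ i ∈ Finset.Icc 1 n, ∀ j ∈ Finset.Icc 1 n, i ≠ j →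
    (KernelTypeI K →
      c < 1 / jointBallProb P X x i j 0 (h n) 0 (h n) *
        ∫ z in (0 : ℝ)..1, jointBallProb P X x i j (z * h n) (h n) 0 (h n) *
          unitDeriv (fun t => t ^ 2 * K t) z) ∧
    (KernelTypeII K →
      c < -(1 / jointBallProb P X x i j 0 (h n) 0 (h n)) *
        ∫ z in (0 : ℝ)..1, ∫ w in (0 : ℝ)..1,
          jointBallProb P X x i j (z * h n) (h n) 0 (w * h n) *
            unitDeriv (fun t => t ^ 2 * K t) z * unitDeriv K w)

end Assumptions

end

end LocalLinear

open LocalLinear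

/-! Write `f` for the largest small-ball probability at radius `h n`, and let `S l` and `Q l` be the
sums over `j ≤ n` of `(β_j / h) ^ l * K_j` and of the same terms times `φ (Y j)`. The weights are
differences of products, so the double sums factor and the estimator equals `(S 2 * Q 0 - S 1 * Q 1)
/ (S 2 * S 0 - S 1 ^ 2)` (`estimator_eq`). This is a scale-invariant function of five sums whose
means are of order at most `n f`. The deterministic term is the same ratio formed with the means,
minus `m x`. What remains is that the sums concentrate and that the mean denominator does not
degenerate.

Concentration (`exists_summable_tail_bound`): outside events of summable probability each sum is
within a multiple of `√(n f log n)` of its mean. The variables are truncated at a small power of `n`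
and cut into blocks. Every second block is compared with independent blocks through mixing. The tail
indicator is replaced by a Lipschitz cutoff before decoupling, so that the dependence costs only
(slope) × (block size) × (mixing coefficient) per block, with no exponential factor
(`integral_lipschitz_chain_le`). The variance of a sum of `q` terms is `O(q f)`: a covariance at lag
`s` is at most a multiple of `f ^ (3/2)`, by the joint small-ball bounds with `p₁ > 1/4`, and also
of `s ^ (-3)`, because the mixing rate exceeds 3. The two bounds meet at `s ≈ f ^ (-1/2)`, hence the
lags sum to `O(f)` (`integral_sq_sum_le`). The lower bound on `f` in the mixing assumption makes the
remaining mixing error summable.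

Nondegeneracy: the means of `S 0` and `S 2` are at least `c n f`, by the layer-cake formula and the
comparability of the balls (`exists_mean_lower_bound`). The mean of `S 1` is `o(n f)`
(`eventually_abs_sum_mean_le`). For that, `K` is approximated by steps, which reduces the claim to
the local means of `β` over balls. The condition on `β` speaks of pairs; for distant indices mixing
turns it into smallness of products of local means, and a sequence whose distant products are small
has few large terms (`sum_le_of_distant_mul_le`).

The errors are centered given the covariates and `m` is Hölder, so the mean of `Q l` differs from `m
x` times that of `S l` by `O(h ^ b n f)`, which yields `O(h ^ b)` for the deterministic term.
Stability of the ratio then gives a stochastic error of order `√(log n / (n f))`. This is at most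
the stated rate, since `f ≤ 1` and `4 * p_max - 1 ≥ 1`. -/

namespace LocalLinear

/-! ### Covariance inequalities under strong mixing. -/

section Covariance

variable {Ω : Type*} {m₀ : MeasurableSpace Ω} {P : Measure Ω}

/-- The dependence between two σ-algebras, measured by `|P(A ∩ B) - P(A) P(B)|`, is at most `α`. -/
def MixingLE (P : Measure Ω) (m₁ m₂ : MeasurableSpace Ω) (α : ℝ) : Prop :=
  ∀ A B : Set Ω, MeasurableSet[m₁] A → MeasurableSet[m₂] B →
    |P.real (A ∩ B) - P.real A * P.real B| ≤ α

theorem MixingLE.nonneg {m₁ m₂ : MeasurableSpace Ω} {α : ℝ} (h : MixingLE P m₁ m₂ α) : 0 ≤ α :=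
  (abs_nonneg _).trans (h ∅ ∅ (@MeasurableSet.empty _ m₁) (@MeasurableSet.empty _ m₂))

theorem MixingLE.symm {m₁ m₂ : MeasurableSpace Ω} {α : ℝ} (h : MixingLE P m₁ m₂ α) :
    MixingLE P m₂ m₁ α := by
  intro A B hA hB
  rw [Set.inter_comm, mul_comm]
  exact h B A hB hA

theorem MixingLE.mono {m₁ m₂ m₁' m₂' : MeasurableSpace Ω} {α : ℝ} (h : MixingLE P m₁ m₂ α)
    (h₁ : m₁' ≤ m₁) (h₂ : m₂' ≤ m₂) : MixingLE P m₁' m₂' α :=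
  fun A B hA hB => h A B (h₁ A hA) (h₂ B hB)

variable [IsProbabilityMeasure P]

theorem integrable_of_sq {f : Ω → ℝ} (hf : AEStronglyMeasurable f P)
    (h2 : Integrable (fun ω => f ω ^ 2) P) : Integrable f P := by
  refine (h2.add (integrable_const 1)).mono' hf (ae_of_all _ fun ω => ?_)
  simp only [Real.norm_eq_abs, Pi.add_apply]
  nlinarith [sq_abs (f ω), sq_nonneg (|f ω| - 1), abs_nonneg (f ω)]

/-- Bounded functions have small covariance with `χ` as soon as indicators do. -/
theorem abs_cov_le_of_forall_set {m₁ : MeasurableSpace Ω} (hm : m₁ ≤ m₀) {χ ψ : Ω → ℝ} {a c : ℝ}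
    (hχ : Integrable χ P) (hψ : StronglyMeasurable[m₁] ψ) (hc : ∀ ω, |ψ ω| ≤ c)
    (h : ∀ B, MeasurableSet[m₁] B → |∫ ω in B, χ ω ∂P - P.real B * ∫ ω, χ ω ∂P| ≤ a) :
    |∫ ω, ψ ω * χ ω ∂P - (∫ ω, ψ ω ∂P) * ∫ ω, χ ω ∂P| ≤ 2 * c * a := by
  set e := ∫ ω, χ ω ∂P with he
  have hc0 : 0 ≤ c := by
    have : Nonempty Ω := nonempty_of_isProbabilityMeasure P
    exact (abs_nonneg _).trans (hc (Classical.arbitrary Ω))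
  -- Conditioning `χ` on `m₁` leaves its integrals against `ψ` unchanged, so the covariance is `∫ ψ
  -- (g - e)`, at most `c` times the L¹ norm of `g - e`.
  set g : Ω → ℝ := P[χ|m₁] with hg
  have hgi : Integrable g P := integrable_condExp
  have hgm : StronglyMeasurable[m₁] g := stronglyMeasurable_condExp
  have hψi : Integrable ψ P :=
    Integrable.of_bound (hψ.mono hm).aestronglyMeasurable c (ae_of_all _ hc)
  have hψχ : Integrable (fun ω => ψ ω * χ ω) P :=
    hχ.bdd_mul (hψ.mono hm).aestronglyMeasurable (ae_of_all _ hc)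
  have hψg : Integrable (fun ω => ψ ω * g ω) P :=
    hgi.bdd_mul (hψ.mono hm).aestronglyMeasurable (ae_of_all _ hc)
  have h1 : ∫ ω, ψ ω * χ ω ∂P = ∫ ω, ψ ω * g ω ∂P := by
    rw [← integral_condExp hm (f := fun ω => ψ ω * χ ω)]
    exact integral_congr_ae (condExp_mul_of_stronglyMeasurable_left hψ hψχ hχ)
  have h2 : ∫ ω, ψ ω * χ ω ∂P - (∫ ω, ψ ω ∂P) * e = ∫ ω, ψ ω * (g ω - e) ∂P := by
    rw [h1, ← integral_mul_const, ← integral_sub hψg (hψi.mul_const _)]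
    simp only [mul_sub]
  have hgei : Integrable (fun ω => g ω - e) P := hgi.sub (integrable_const _)
  have hset : ∀ B, MeasurableSet[m₁] B → |∫ ω in B, (g ω - e) ∂P| ≤ a := by
    intro B hB
    have := h B hB
    rwa [integral_sub hgi.integrableOn (integrable_const _).integrableOn, hg,
      setIntegral_condExp hm hχ hB, setIntegral_const, smul_eq_mul]
  -- The set where `g - e` is nonnegative lies in `m₁`, so the hypothesis applies to it and to its
  -- complement; this is the factor 2.
  set B : Set Ω := {ω | 0 ≤ g ω - e} with hBdef
  have hB : MeasurableSet[m₁] B :=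
    (hgm.measurable.sub_const e) measurableSet_Ici
  have h3 : ∫ ω, |g ω - e| ∂P ≤ 2 * a := by
    rw [← integral_add_compl (hm _ hB) hgei.abs]
    have e1 : ∫ ω in B, |g ω - e| ∂P = ∫ ω in B, (g ω - e) ∂P :=
      setIntegral_congr_fun (hm _ hB) fun ω hω => abs_of_nonneg hω
    have e2 : ∫ ω in Bᶜ, |g ω - e| ∂P = - ∫ ω in Bᶜ, (g ω - e) ∂P := by
      rw [← integral_neg]
      exact setIntegral_congr_fun (hm _ hB.compl) fun ω hω =>
        abs_of_neg (not_le.mp hω)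
    rw [e1, e2]
    have i1 := (abs_le.mp (hset B hB)).2
    have i2 := (abs_le.mp (hset Bᶜ hB.compl)).1
    linarith
  rw [h2]
  calc |∫ ω, ψ ω * (g ω - e) ∂P| ≤ ∫ ω, |ψ ω * (g ω - e)| ∂P := abs_integral_le_integral_abs
    _ ≤ ∫ ω, c * |g ω - e| ∂P := by
        refine integral_mono_of_nonneg (ae_of_all _ fun _ => abs_nonneg _)
          (hgei.abs.const_mul c) (ae_of_all _ fun ω => ?_)
        simp only [abs_mul]
        exact mul_le_mul_of_nonneg_right (hc ω) (abs_nonneg _)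
    _ = c * ∫ ω, |g ω - e| ∂P := integral_const_mul _ _
    _ ≤ c * (2 * a) := mul_le_mul_of_nonneg_left h3 hc0
    _ = 2 * c * a := by ring

/-- Covariance of a bounded function and an indicator. -/
theorem MixingLE.abs_cov_indicator_le {m₁ m₂ : MeasurableSpace Ω} {α : ℝ}
    (h : MixingLE P m₁ m₂ α) (h₁ : m₁ ≤ m₀) (h₂ : m₂ ≤ m₀) {ψ : Ω → ℝ} {c : ℝ}
    (hψ : StronglyMeasurable[m₁] ψ) (hc : ∀ ω, |ψ ω| ≤ c) {A : Set Ω} (hA : MeasurableSet[m₂] A) :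
    |∫ ω in A, ψ ω ∂P - P.real A * ∫ ω, ψ ω ∂P| ≤ 2 * c * α := by
  have key := abs_cov_le_of_forall_set (P := P) (χ := A.indicator fun _ => (1 : ℝ)) (a := α) h₁
    ((integrable_const _).indicator (h₂ _ hA)) hψ hc ?_
  · have e1 : ∫ ω, ψ ω * A.indicator (fun _ => (1 : ℝ)) ω ∂P = ∫ ω in A, ψ ω ∂P := by
      rw [← integral_indicator (h₂ _ hA)]
      congr 1
      ext ω
      by_cases hω : ω ∈ A <;> simp [hω]
    have e2 : ∫ ω, A.indicator (fun _ => (1 : ℝ)) ω ∂P = P.real A := by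
      rw [integral_indicator_const _ (h₂ _ hA)]
      simp
    rw [e1, e2, mul_comm (∫ ω, ψ ω ∂P)] at key
    exact key
  · intro B hB
    have e2 : ∫ ω, A.indicator (fun _ => (1 : ℝ)) ω ∂P = P.real A := by
      rw [integral_indicator_const _ (h₂ _ hA)]
      simp
    have e3 : ∫ ω in B, A.indicator (fun _ => (1 : ℝ)) ω ∂P = P.real (B ∩ A) := by
      rw [setIntegral_indicator (h₂ _ hA), setIntegral_const]
      simp
    rw [e2, e3]
    exact h B A hB hA

/-- Covariance of two bounded functions. -/
theorem MixingLE.abs_cov_le {m₁ m₂ : MeasurableSpace Ω} {α : ℝ}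
    (h : MixingLE P m₁ m₂ α) (h₁ : m₁ ≤ m₀) (h₂ : m₂ ≤ m₀) {ψ χ : Ω → ℝ} {c c' : ℝ}
    (hψ : StronglyMeasurable[m₁] ψ) (hc : ∀ ω, |ψ ω| ≤ c)
    (hχ : StronglyMeasurable[m₂] χ) (hc' : ∀ ω, |χ ω| ≤ c') :
    |∫ ω, ψ ω * χ ω ∂P - (∫ ω, ψ ω ∂P) * ∫ ω, χ ω ∂P| ≤ 4 * c * c' * α := by
  have hχi : Integrable χ P :=
    Integrable.of_bound (hχ.mono h₂).aestronglyMeasurable c' (ae_of_all _ hc')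
  have := abs_cov_le_of_forall_set (P := P) h₁ hχi hψ hc
    (fun B hB => h.symm.abs_cov_indicator_le h₂ h₁ hχ hc' hB)
  linarith

/-- Covariance of two functions with bounded moments of order `2 k + 2`. -/
theorem MixingLE.abs_cov_le_of_moments {m₁ m₂ : MeasurableSpace Ω} {α : ℝ}
    (h : MixingLE P m₁ m₂ α) (h₁ : m₁ ≤ m₀) (h₂ : m₂ ≤ m₀) {ψ χ : Ω → ℝ} {C M : ℝ} {k : ℕ}
    (hM : 0 < M) (hC : 1 ≤ C)
    (hψ : StronglyMeasurable[m₁] ψ) (hχ : StronglyMeasurable[m₂] χ)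
    (hψ2 : Integrable (fun ω => ψ ω ^ 2) P) (hχ2 : Integrable (fun ω => χ ω ^ 2) P)
    (hψk : Integrable (fun ω => ψ ω ^ (2 * k + 2)) P)
    (hχk : Integrable (fun ω => χ ω ^ (2 * k + 2)) P)
    (bψ2 : ∫ ω, ψ ω ^ 2 ∂P ≤ C) (bχ2 : ∫ ω, χ ω ^ 2 ∂P ≤ C)
    (bψk : ∫ ω, ψ ω ^ (2 * k + 2) ∂P ≤ C) (bχk : ∫ ω, χ ω ^ (2 * k + 2) ∂P ≤ C) :
    |∫ ω, ψ ω * χ ω ∂P - (∫ ω, ψ ω ∂P) * ∫ ω, χ ω ∂P| ≤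
      4 * M ^ 2 * α + 4 * C ^ 2 * (M ^ k)⁻¹ := by
  have hMk : 0 < M ^ k := pow_pos hM k
  -- Truncation at `M`: the bounded parts have covariance at most `4 M² α`, and the removed part is
  -- at most `M ^ (-k) |z| ^ (k + 1)`, whose square is controlled by the moment of order `2 k + 2`.
  set T : ℝ → ℝ := fun z => if |z| ≤ M then z else 0 with hT
  have hTm : Measurable T :=
    Measurable.ite (measurableSet_le continuous_abs.measurable measurable_const) measurable_id
      measurable_const
  have hTM : ∀ z, |T z| ≤ M := by
    intro z
    simp only [hT]
    split_ifs with hz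
    · exact hz
    · simpa using hM.le
  have hTz : ∀ z, |T z| ≤ |z| := by
    intro z
    simp only [hT]
    split_ifs with hz
    · exact le_rfl
    · simp
  have hTd : ∀ z, |z - T z| ≤ (M ^ k)⁻¹ * |z| ^ (k + 1) := by
    intro z
    simp only [hT]
    split_ifs with hz
    · simp; positivity
    · rw [sub_zero, inv_mul_eq_div, le_div_iff₀ hMk, pow_succ, mul_comm]
      exact mul_le_mul_of_nonneg_right (pow_le_pow_left₀ hM.le (not_le.mp hz).le k) (abs_nonneg _)
  have pow_abs : ∀ z : ℝ, (|z| ^ (k + 1)) ^ 2 = z ^ (2 * k + 2) := by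
    intro z
    rw [← pow_mul, show (k + 1) * 2 = 2 * (k + 1) by ring, pow_mul, sq_abs, ← pow_mul]
    ring_nf
  have hψ' : StronglyMeasurable[m₁] fun ω => T (ψ ω) := (hTm.comp hψ.measurable).stronglyMeasurable
  have hχ' : StronglyMeasurable[m₂] fun ω => T (χ ω) := (hTm.comp hχ.measurable).stronglyMeasurable
  have hψm := (hψ.mono h₁).aestronglyMeasurable (μ := P)
  have hχm := (hχ.mono h₂).aestronglyMeasurable (μ := P)
  have hψm' := (hψ'.mono h₁).aestronglyMeasurable (μ := P)
  have hχm' := (hχ'.mono h₂).aestronglyMeasurable (μ := P)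
  have cov' := h.abs_cov_le h₁ h₂ hψ' (fun ω => hTM _) hχ' (fun ω => hTM _)
  have hψi := integrable_of_sq hψm hψ2
  have hχi := integrable_of_sq hχm hχ2
  have hψi' : Integrable (fun ω => T (ψ ω)) P :=
    Integrable.of_bound hψm' M (ae_of_all _ fun ω => hTM _)
  have hχi' : Integrable (fun ω => T (χ ω)) P :=
    Integrable.of_bound hχm' M (ae_of_all _ fun ω => hTM _)
  have hψχ : Integrable (fun ω => ψ ω * χ ω) P := by
    refine (hψ2.add hχ2).mono' (hψm.mul hχm) (ae_of_all _ fun ω => ?_)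
    simp only [Real.norm_eq_abs, Pi.add_apply, abs_mul]
    nlinarith [sq_abs (ψ ω), sq_abs (χ ω), sq_nonneg (|ψ ω| - |χ ω|), sq_nonneg (|ψ ω| + |χ ω|)]
  have hψχ' : Integrable (fun ω => T (ψ ω) * T (χ ω)) P :=
    hχi'.bdd_mul hψm' (ae_of_all _ fun ω => hTM _)
  -- the product
  have d1 : |∫ ω, ψ ω * χ ω ∂P - ∫ ω, T (ψ ω) * T (χ ω) ∂P| ≤ 2 * C * (M ^ k)⁻¹ := by
    rw [← integral_sub hψχ hψχ']
    have hb : Integrable (fun ω => (M ^ k)⁻¹ * ((ψ ω ^ (2 * k + 2) + χ ω ^ (2 * k + 2) +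
        (ψ ω ^ 2 + χ ω ^ 2)) / 2)) P :=
      (((hψk.add hχk).add (hψ2.add hχ2)).div_const 2).const_mul _
    calc |∫ ω, (ψ ω * χ ω - T (ψ ω) * T (χ ω)) ∂P|
        ≤ ∫ ω, |ψ ω * χ ω - T (ψ ω) * T (χ ω)| ∂P := abs_integral_le_integral_abs
      _ ≤ ∫ ω, (M ^ k)⁻¹ * ((ψ ω ^ (2 * k + 2) + χ ω ^ (2 * k + 2) +
          (ψ ω ^ 2 + χ ω ^ 2)) / 2) ∂P := by
          refine integral_mono (hψχ.sub hψχ').abs hb fun ω => ?_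
          have e : ψ ω * χ ω - T (ψ ω) * T (χ ω) =
            (ψ ω - T (ψ ω)) * χ ω + T (ψ ω) * (χ ω - T (χ ω)) := by ring
          have i1 : |ψ ω - T (ψ ω)| * |χ ω| ≤ (M ^ k)⁻¹ * |ψ ω| ^ (k + 1) * |χ ω| :=
            mul_le_mul_of_nonneg_right (hTd _) (abs_nonneg _)
          have i2 : |T (ψ ω)| * |χ ω - T (χ ω)| ≤ |ψ ω| * ((M ^ k)⁻¹ * |χ ω| ^ (k + 1)) :=
            mul_le_mul (hTz _) (hTd _) (abs_nonneg _) (abs_nonneg _)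
          have i3 : |ψ ω| ^ (k + 1) * |χ ω| + |ψ ω| * |χ ω| ^ (k + 1) ≤
              (ψ ω ^ (2 * k + 2) + χ ω ^ (2 * k + 2) + (ψ ω ^ 2 + χ ω ^ 2)) / 2 := by
            nlinarith [sq_nonneg (|ψ ω| ^ (k + 1) - |χ ω|), sq_nonneg (|χ ω| ^ (k + 1) - |ψ ω|),
              pow_abs (ψ ω), pow_abs (χ ω), sq_abs (ψ ω), sq_abs (χ ω)]
          calc |ψ ω * χ ω - T (ψ ω) * T (χ ω)|
              ≤ |ψ ω - T (ψ ω)| * |χ ω| + |T (ψ ω)| * |χ ω - T (χ ω)| := by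
                rw [e, ← abs_mul, ← abs_mul]; exact abs_add_le _ _
            _ ≤ (M ^ k)⁻¹ * (|ψ ω| ^ (k + 1) * |χ ω| + |ψ ω| * |χ ω| ^ (k + 1)) := by
                linarith
            _ ≤ _ := mul_le_mul_of_nonneg_left i3 (inv_nonneg.mpr hMk.le)
      _ = (M ^ k)⁻¹ * ((∫ ω, ψ ω ^ (2 * k + 2) ∂P + ∫ ω, χ ω ^ (2 * k + 2) ∂P +
          (∫ ω, ψ ω ^ 2 ∂P + ∫ ω, χ ω ^ 2 ∂P)) / 2) := by
          rw [integral_const_mul, integral_div, integral_add (by exact hψk.add hχk) (by exact hψ2.add hχ2),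
            integral_add hψk hχk, integral_add hψ2 hχ2]
      _ ≤ (M ^ k)⁻¹ * (2 * C) :=
          mul_le_mul_of_nonneg_left (by linarith) (inv_nonneg.mpr hMk.le)
      _ = 2 * C * (M ^ k)⁻¹ := by ring
  -- the means
  have m1 : ∀ {f : Ω → ℝ}, Integrable f P → Integrable (fun ω => f ω ^ 2) P →
      ∫ ω, f ω ^ 2 ∂P ≤ C → ∫ ω, |f ω| ∂P ≤ C := by
    intro f hf hf2 hb
    calc ∫ ω, |f ω| ∂P ≤ ∫ ω, (f ω ^ 2 + 1) / 2 ∂P := by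
          refine integral_mono hf.abs ((hf2.add (integrable_const 1)).div_const 2) fun ω => ?_
          simp only
          nlinarith [sq_abs (f ω), sq_nonneg (|f ω| - 1)]
      _ = (∫ ω, f ω ^ 2 ∂P + 1) / 2 := by
          rw [integral_div, integral_add hf2 (integrable_const 1)]; simp
      _ ≤ C := by linarith
  have m2 : ∀ {f : Ω → ℝ}, Integrable f P → Integrable (fun ω => T (f ω)) P →
      Integrable (fun ω => f ω ^ (2 * k + 2)) P →
      ∫ ω, f ω ^ (2 * k + 2) ∂P ≤ C → |∫ ω, f ω ∂P - ∫ ω, T (f ω) ∂P| ≤ (M ^ k)⁻¹ * C := by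
    intro f hf hf' hfk hb
    rw [← integral_sub hf hf']
    calc |∫ ω, (f ω - T (f ω)) ∂P| ≤ ∫ ω, |f ω - T (f ω)| ∂P := abs_integral_le_integral_abs
      _ ≤ ∫ ω, (M ^ k)⁻¹ * ((f ω ^ (2 * k + 2) + 1) / 2) ∂P := by
          refine integral_mono (hf.sub hf').abs
            (((hfk.add (integrable_const 1)).div_const 2).const_mul _) fun ω => ?_
          refine (hTd _).trans (mul_le_mul_of_nonneg_left ?_ (inv_nonneg.mpr hMk.le))
          nlinarith [pow_abs (f ω), sq_nonneg (|f ω| ^ (k + 1) - 1)]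
      _ = (M ^ k)⁻¹ * ((∫ ω, f ω ^ (2 * k + 2) ∂P + 1) / 2) := by
          rw [integral_const_mul, integral_div, integral_add hfk (integrable_const 1)]; simp
      _ ≤ (M ^ k)⁻¹ * C := mul_le_mul_of_nonneg_left (by linarith) (inv_nonneg.mpr hMk.le)
  have aψ : |∫ ω, T (ψ ω) ∂P| ≤ C := by
    refine (abs_integral_le_integral_abs).trans ((integral_mono hψi'.abs hψi.abs ?_).trans
      (m1 hψi hψ2 bψ2))
    exact fun ω => hTz _
  have aχ : |∫ ω, χ ω ∂P| ≤ C := (abs_integral_le_integral_abs).trans (m1 hχi hχ2 bχ2)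
  have d2 : |(∫ ω, ψ ω ∂P) * ∫ ω, χ ω ∂P - (∫ ω, T (ψ ω) ∂P) * ∫ ω, T (χ ω) ∂P| ≤
      2 * C ^ 2 * (M ^ k)⁻¹ := by
    have e : (∫ ω, ψ ω ∂P) * ∫ ω, χ ω ∂P - (∫ ω, T (ψ ω) ∂P) * ∫ ω, T (χ ω) ∂P =
      (∫ ω, ψ ω ∂P - ∫ ω, T (ψ ω) ∂P) * ∫ ω, χ ω ∂P +
        (∫ ω, T (ψ ω) ∂P) * (∫ ω, χ ω ∂P - ∫ ω, T (χ ω) ∂P) := by ring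
    rw [e]
    refine (abs_add_le _ _).trans ?_
    rw [abs_mul, abs_mul]
    have hC0 : 0 ≤ C := by linarith
    have j1 := mul_le_mul (m2 hψi hψi' hψk bψk) aχ (abs_nonneg _)
      (mul_nonneg (inv_nonneg.mpr hMk.le) hC0)
    have j2 := mul_le_mul aψ (m2 hχi hχi' hχk bχk) (abs_nonneg _) hC0
    nlinarith
  have hfin : 2 * C * (M ^ k)⁻¹ ≤ 2 * C ^ 2 * (M ^ k)⁻¹ :=
    mul_le_mul_of_nonneg_right (by nlinarith) (inv_nonneg.mpr hMk.le)
  rw [abs_le] at *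
  constructor <;> nlinarith [cov'.1, cov'.2, d1.1, d1.2, d2.1, d2.2]

end Covariance

/-! ### Decoupling of weakly dependent sums and a Bernstein inequality. -/

section Decoupling

variable {Ω : Type*} {m₁ m₂ m₀ : MeasurableSpace Ω} {P : Measure Ω}

/-- Approximation of `u ↦ g (s + u)` on `[-B, B]` by a step function of `u`. -/
theorem abs_step_sub_le {g : ℝ → ℝ} {L B : ℝ} (hL : ∀ s t, |g s - g t| ≤ L * |s - t|)
    (hL0 : 0 ≤ L) (hB : 0 < B) (N : ℕ) (hN : 0 < N) (s u : ℝ) (hu : |u| ≤ B) :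
    |g (s + u) - (g (s - B) + ∑ k ∈ Finset.range N,
      (g (s - B + (k + 1 : ℕ) * (2 * B / N)) - g (s - B + (k : ℕ) * (2 * B / N))) *
        if -B + (k + 1 : ℕ) * (2 * B / N) ≤ u then 1 else 0)| ≤ L * (2 * B / N) := by
  set d := 2 * B / N with hd
  have hNr : (0 : ℝ) < N := by exact_mod_cast hN
  have hd0 : 0 < d := by positivity
  have hNd : N * d = 2 * B := by rw [hd]; field_simp
  obtain ⟨hu1, hu2⟩ := abs_le.mp hu
  -- `κ` counts the grid levels passed by `u`, so the step sum telescopes to `g (s - B + κ d)`, at a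
  -- point within `d` of `s + u`.
  set κ := ⌊(u + B) / d⌋₊ with hκ
  have hq0 : 0 ≤ (u + B) / d := div_nonneg (by linarith) hd0.le
  have hκ1 : (κ : ℝ) * d ≤ u + B := by
    rw [← le_div_iff₀ hd0]; exact Nat.floor_le hq0
  have hκ2 : u + B < (κ + 1 : ℝ) * d := by
    rw [← div_lt_iff₀ hd0]; exact Nat.lt_floor_add_one _
  have hκN : κ ≤ N := by
    have : (κ : ℝ) * d ≤ N * d := by linarith
    exact_mod_cast le_of_mul_le_mul_right this hd0
  have hiff : ∀ k : ℕ, (-B + (k + 1 : ℕ) * d ≤ u) ↔ k < κ := by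
    intro k
    rw [Nat.lt_iff_add_one_le, hκ, Nat.le_floor_iff hq0, le_div_iff₀ hd0]
    constructor <;> intro h <;> linarith
  have hsum : ∑ k ∈ Finset.range N, (g (s - B + (k + 1 : ℕ) * d) - g (s - B + (k : ℕ) * d)) *
      (if -B + (k + 1 : ℕ) * d ≤ u then (1 : ℝ) else 0) = g (s - B + κ * d) - g (s - B) := by
    have h1 : ∀ k ∈ Finset.range N, (g (s - B + (k + 1 : ℕ) * d) - g (s - B + (k : ℕ) * d)) *
        (if -B + (k + 1 : ℕ) * d ≤ u then (1 : ℝ) else 0) =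
        if k < κ then g (s - B + (k + 1 : ℕ) * d) - g (s - B + (k : ℕ) * d) else 0 := by
      intro k _
      rw [if_congr (hiff k) rfl rfl]
      split_ifs <;> simp
    rw [Finset.sum_congr rfl h1, ← Finset.sum_filter]
    have h2 : (Finset.range N).filter (fun k => k < κ) = Finset.range κ := by
      ext k
      simp only [Finset.mem_filter, Finset.mem_range]
      omega
    rw [h2, Finset.sum_range_sub (fun k : ℕ => g (s - B + (k : ℕ) * d))]
    simp
  rw [hsum]
  have : g (s + u) - (g (s - B) + (g (s - B + κ * d) - g (s - B))) =
      g (s + u) - g (s - B + κ * d) := by ring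
  rw [this]
  refine (hL _ _).trans (mul_le_mul_of_nonneg_left ?_ hL0)
  rw [abs_le]
  constructor <;> linarith

variable [IsProbabilityMeasure P]

theorem abs_integral_le_of_abs_le {f : Ω → ℝ} {c : ℝ} (h : ∀ ω, |f ω| ≤ c) :
    |∫ ω, f ω ∂P| ≤ c := by
  have := norm_integral_le_of_norm_le_const (μ := P) (f := f) (C := c) (ae_of_all _ h)
  simpa using this

/-- Replacing `U` by an independent copy changes the mean of a Lipschitz function of `S + U` by
little if `U` is bounded and weakly dependent on `S`. -/
theorem MixingLE.abs_integral_sub_le {α : ℝ}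
    (h : MixingLE P m₁ m₂ α) (h₁ : m₁ ≤ m₀) (h₂ : m₂ ≤ m₀) {g : ℝ → ℝ} {L B c : ℝ}
    (hL : ∀ s t, |g s - g t| ≤ L * |s - t|) (hL0 : 0 ≤ L) (hB : 0 < B) (hg : ∀ s, |g s| ≤ c)
    {S U : Ω → ℝ} (hS : Measurable[m₁] S) (hU : Measurable[m₂] U) (hUB : ∀ ω, |U ω| ≤ B) :
    |∫ ω, g (S ω + U ω) ∂P - ∫ ω, ∫ ω', g (S ω + U ω') ∂P ∂P| ≤ 4 * L * B * α := by
  have hgc : Continuous g := by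
    refine (LipschitzWith.of_dist_le_mul (K := ⟨L, hL0⟩) fun s t => ?_).continuous
    exact hL s t
  have hα := h.nonneg
  have hSm : Measurable S := hS.mono h₁ le_rfl
  have hUm : Measurable U := hU.mono h₂ le_rfl
  have bdd : ∀ {f : Ω → ℝ}, Measurable f → (∃ c', ∀ ω, |f ω| ≤ c') → Integrable f P := by
    intro f hf ⟨c', hc'⟩
    exact Integrable.of_bound hf.aestronglyMeasurable c' (ae_of_all _ hc')
  -- For the step approximation the difference is a sum of `N` covariances of `D k (S)` with
  -- indicators of `{U ≥ level}`, each at most `2 L d α`. As `N d = 2 B`, the total `4 L B α` does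
  -- not depend on `N`; only the discretization error does, and it tends to zero.
  have key : ∀ N : ℕ, 0 < N → |∫ ω, g (S ω + U ω) ∂P - ∫ ω, ∫ ω', g (S ω + U ω') ∂P ∂P| ≤
      4 * L * B * α + 2 * (L * (2 * B / N)) := by
    intro N hN
    have hNr : (0 : ℝ) < N := by exact_mod_cast hN
    set d := 2 * B / N with hd
    have hd0 : 0 < d := by positivity
    set D : ℕ → ℝ → ℝ := fun k s => g (s - B + (k + 1 : ℕ) * d) - g (s - B + (k : ℕ) * d) with hD
    set A : ℕ → Set Ω := fun k => {ω | -B + (k + 1 : ℕ) * d ≤ U ω} with hA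
    have hAm : ∀ k, MeasurableSet[m₂] (A k) := fun k => hU measurableSet_Ici
    have hAm' : ∀ k, MeasurableSet (A k) := fun k => h₂ _ (hAm k)
    set I : ℕ → ℝ → ℝ := fun k u => if -B + (k + 1 : ℕ) * d ≤ u then 1 else 0 with hI
    have hDc : ∀ k, Continuous (D k) := by
      intro k; simp only [hD]; fun_prop
    have hDb : ∀ k s, |D k s| ≤ L * d := by
      intro k s
      refine (hL _ _).trans (le_of_eq ?_)
      congr 1
      push_cast
      rw [show s - B + ((k : ℝ) + 1) * d - (s - B + k * d) = d by ring, abs_of_pos hd0]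
    have hIA : ∀ k ω, I k (U ω) = (A k).indicator (fun _ => (1 : ℝ)) ω := by
      intro k ω
      simp only [hI, hA, Set.indicator_apply, Set.mem_ofPred_eq]
    have hDS : ∀ k, StronglyMeasurable[m₁] fun ω => D k (S ω) := fun k =>
      ((hDc k).measurable.comp hS).stronglyMeasurable
    have hDSi : ∀ k, Integrable (fun ω => D k (S ω)) P := fun k =>
      bdd ((hDc k).measurable.comp hSm) ⟨_, fun ω => hDb k _⟩
    set G : ℝ → ℝ → ℝ := fun s u => g (s - B) + ∑ k ∈ Finset.range N, D k s * I k u with hG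
    have hGg : ∀ s ω, |g (s + U ω) - G s (U ω)| ≤ L * d := fun s ω =>
      abs_step_sub_le hL hL0 hB N hN s (U ω) (hUB ω)
    have hg0 : Integrable (fun ω => g (S ω - B)) P :=
      bdd (hgc.measurable.comp (hSm.sub_const B)) ⟨c, fun ω => hg _⟩
    have hDI : ∀ k, Integrable (fun ω => D k (S ω) * I k (U ω)) P := by
      intro k
      simp only [hIA]
      exact ((integrable_const (1 : ℝ)).indicator (hAm' k)).bdd_mul (c := L * d)
        (hDSi k).aestronglyMeasurable (ae_of_all _ fun ω => hDb k _)
    have hIi : ∀ k, Integrable (fun ω => I k (U ω)) P := by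
      intro k
      simp only [hIA]
      exact (integrable_const 1).indicator (hAm' k)
    have hIint : ∀ k, ∫ ω, I k (U ω) ∂P = P.real (A k) := by
      intro k
      simp only [hIA]
      rw [integral_indicator_const _ (hAm' k)]; simp
    have eG1 : ∫ ω, G (S ω) (U ω) ∂P = ∫ ω, g (S ω - B) ∂P +
        ∑ k ∈ Finset.range N, ∫ ω in A k, D k (S ω) ∂P := by
      simp only [hG]
      rw [integral_add hg0 (integrable_finsetSum _ fun k _ => hDI k),
        integral_finsetSum _ fun k _ => hDI k]
      congr 1
      refine Finset.sum_congr rfl fun k _ => ?_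
      rw [← integral_indicator (hAm' k)]
      congr 1
      ext ω
      rw [hIA]
      by_cases hω : ω ∈ A k <;> simp [hω]
    have eG2 : ∀ s, ∫ ω', G s (U ω') ∂P = g (s - B) + ∑ k ∈ Finset.range N, D k s * P.real (A k) := by
      intro s
      simp only [hG]
      rw [integral_add (integrable_const _) (integrable_finsetSum _ fun k _ => (hIi k).const_mul _),
        integral_finsetSum _ fun k _ => (hIi k).const_mul _]
      simp [integral_const_mul, hIint]
    have eG3 : ∫ ω, ∫ ω', G (S ω) (U ω') ∂P ∂P = ∫ ω, g (S ω - B) ∂P +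
        ∑ k ∈ Finset.range N, P.real (A k) * ∫ ω, D k (S ω) ∂P := by
      simp only [eG2]
      rw [integral_add hg0 (integrable_finsetSum _ fun k _ => (hDSi k).mul_const _),
        integral_finsetSum _ fun k _ => (hDSi k).mul_const _]
      simp [integral_mul_const, mul_comm]
    have b1 : |∫ ω, G (S ω) (U ω) ∂P - ∫ ω, ∫ ω', G (S ω) (U ω') ∂P ∂P| ≤ 4 * L * B * α := by
      rw [eG1, eG3, add_sub_add_left_eq_sub, ← Finset.sum_sub_distrib]
      refine (Finset.abs_sum_le_sum_abs _ _).trans ?_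
      calc ∑ k ∈ Finset.range N, |∫ ω in A k, D k (S ω) ∂P - P.real (A k) * ∫ ω, D k (S ω) ∂P|
          ≤ ∑ k ∈ Finset.range N, 2 * (L * d) * α :=
            Finset.sum_le_sum fun k _ =>
              h.abs_cov_indicator_le h₁ h₂ (hDS k) (fun ω => hDb k _) (hAm k)
        _ = 4 * L * B * α := by
            rw [Finset.sum_const, Finset.card_range, nsmul_eq_mul, hd]
            field_simp
            ring
    have hgi : Integrable (fun ω => g (S ω + U ω)) P :=
      bdd (hgc.measurable.comp (hSm.add hUm)) ⟨c, fun ω => hg _⟩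
    have hGi : Integrable (fun ω => G (S ω) (U ω)) P :=
      hg0.add (integrable_finsetSum _ fun k _ => hDI k)
    have b2 : |∫ ω, g (S ω + U ω) ∂P - ∫ ω, G (S ω) (U ω) ∂P| ≤ L * d := by
      rw [← integral_sub hgi hGi]
      exact abs_integral_le_of_abs_le fun ω => hGg (S ω) ω
    have hgsi : ∀ s, Integrable (fun ω => g (s + U ω)) P := fun s =>
      bdd (hgc.measurable.comp (hUm.const_add s)) ⟨c, fun ω => hg _⟩
    have hGsi : ∀ s, Integrable (fun ω => G s (U ω)) P := fun s =>
      (integrable_const _).add (integrable_finsetSum _ fun k _ => (hIi k).const_mul _)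
    have b3 : ∀ s, |∫ ω', g (s + U ω') ∂P - ∫ ω', G s (U ω') ∂P| ≤ L * d := by
      intro s
      rw [← integral_sub (hgsi s) (hGsi s)]
      exact abs_integral_le_of_abs_le fun ω => hGg s ω
    have hgg : Integrable (fun ω => ∫ ω', g (S ω + U ω') ∂P) P := by
      refine Integrable.of_bound (C := c) ?_ (ae_of_all _ fun ω => ?_)
      · have : StronglyMeasurable (fun p : Ω × Ω => g (S p.1 + U p.2)) :=
          (hgc.measurable.comp ((hSm.comp measurable_fst).add
            (hUm.comp measurable_snd))).stronglyMeasurable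
        exact this.integral_prod_right.aestronglyMeasurable
      · exact abs_integral_le_of_abs_le fun ω' => hg _
    have hGG : Integrable (fun ω => ∫ ω', G (S ω) (U ω') ∂P) P := by
      simp only [eG2]
      exact hg0.add (integrable_finsetSum _ fun k _ => (hDSi k).mul_const _)
    have b4 : |∫ ω, ∫ ω', g (S ω + U ω') ∂P ∂P - ∫ ω, ∫ ω', G (S ω) (U ω') ∂P ∂P| ≤ L * d := by
      rw [← integral_sub hgg hGG]
      exact abs_integral_le_of_abs_le fun ω => b3 (S ω)
    rw [abs_le] at *
    constructor <;> linarith [b1.1, b1.2, b2.1, b2.2, b4.1, b4.2]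
  have lim : Tendsto (fun N : ℕ => 4 * L * B * α + 2 * (L * (2 * B / N))) atTop
      (𝓝 (4 * L * B * α + 2 * (L * 0))) :=
    ((((tendsto_const_div_atTop_nhds_zero_nat (2 * B)).const_mul L).const_mul 2).const_add _)
  have := ge_of_tendsto lim (eventually_atTop.mpr ⟨1, fun N hN => key N hN⟩)
  simpa using this

/-- Comparison with independent variables, along a chain of weakly dependent variables, for the
mean of a Lipschitz function with exponential growth. -/
theorem integral_lipschitz_chain_le {α L B t : ℝ} (hL0 : 0 ≤ L) (hB : 0 < B) (U : ℕ → Ω → ℝ)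
    (𝓕 𝓖 : ℕ → MeasurableSpace Ω) (hF : ∀ i, 𝓕 i ≤ m₀) (hG : ∀ i, 𝓖 i ≤ m₀)
    (hU : ∀ i, Measurable[𝓖 i] (U i)) (hGF : ∀ i j, j < i → 𝓖 j ≤ 𝓕 i)
    (hmix : ∀ i, MixingLE P (𝓕 i) (𝓖 i) α) (hUB : ∀ i ω, |U i ω| ≤ B) (k : ℕ) :
    ∀ (f : ℝ → ℝ) (A c : ℝ), (∀ s t, |f s - f t| ≤ L * |s - t|) → (∀ s, |f s| ≤ c) →
      (∀ s, f s ≤ A * Real.exp (t * s)) →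
      ∫ ω, f (∑ i ∈ Finset.range k, U i ω) ∂P ≤
        A * ∏ i ∈ Finset.range k, ∫ ω, Real.exp (t * U i ω) ∂P + k * (4 * L * B * α) := by
  have hUm : ∀ i, Measurable (U i) := fun i => (hU i).mono (hG i) le_rfl
  induction k with
  | zero =>
    intro f A c _ _ hfA
    simpa using hfA 0
  | succ k ih =>
    intro f A c hfL hfc hfA
    have hfcont : Continuous f := by
      refine (LipschitzWith.of_dist_le_mul (K := ⟨L, hL0⟩) fun s t => ?_).continuous
      exact hfL s t
    have hfi : ∀ s, Integrable (fun ω => f (s + U k ω)) P := fun s =>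
      Integrable.of_bound (hfcont.measurable.comp ((hUm k).const_add s)).aestronglyMeasurable c
        (ae_of_all _ fun ω => hfc _)
    have hei : Integrable (fun ω => Real.exp (t * U k ω)) P := by
      refine Integrable.of_bound (C := Real.exp (|t| * B))
        (Real.measurable_exp.comp ((hUm k).const_mul t)).aestronglyMeasurable
        (ae_of_all _ fun ω => ?_)
      rw [Real.norm_eq_abs, Real.abs_exp]
      refine Real.exp_le_exp.mpr ((le_abs_self _).trans ?_)
      rw [abs_mul]
      exact mul_le_mul_of_nonneg_left (hUB k ω) (abs_nonneg _)
    -- The last variable is averaged out as if independent. The average keeps the Lipschitz constant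
    -- and the bound `c`; its growth bound gains the exponential moment of `U k`. The growth bound
    -- is evaluated only when no variable is left, so the mixing errors add up without exponential
    -- weights.
    set f' : ℝ → ℝ := fun s => ∫ ω, f (s + U k ω) ∂P with hf'
    have h1 : ∀ s s', |f' s - f' s'| ≤ L * |s - s'| := by
      intro s s'
      rw [hf']
      simp only
      rw [← integral_sub (hfi s) (hfi s')]
      refine abs_integral_le_of_abs_le fun ω => ?_
      refine (hfL _ _).trans (le_of_eq ?_)
      congr 2
      ring
    have h2 : ∀ s, |f' s| ≤ c := fun s =>
      abs_integral_le_of_abs_le fun ω => hfc _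
    have h3 : ∀ s, f' s ≤ (A * ∫ ω, Real.exp (t * U k ω) ∂P) * Real.exp (t * s) := by
      intro s
      calc f' s ≤ ∫ ω, A * Real.exp (t * s) * Real.exp (t * U k ω) ∂P := by
            refine integral_mono (hfi s) (hei.const_mul _) fun ω => ?_
            refine (hfA _).trans (le_of_eq ?_)
            rw [mul_add, Real.exp_add, mul_assoc]
        _ = _ := by rw [integral_const_mul]; ring
    have h4 := ih f' _ c h1 h2 h3
    have hS : Measurable[𝓕 k] fun ω => ∑ i ∈ Finset.range k, U i ω :=
      Finset.measurable_sum _ fun i hi =>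
        (hU i).mono (hGF k i (Finset.mem_range.mp hi)) le_rfl
    have h5 := (hmix k).abs_integral_sub_le (hF k) (hG k) hfL hL0 hB hfc hS (hU k) (hUB k)
    simp only [Finset.sum_range_succ, Finset.prod_range_succ]
    push_cast
    have h6 := (abs_le.mp h5).2
    simp only [hf'] at h4
    calc _ ≤ ∫ ω, ∫ ω', f (∑ i ∈ Finset.range k, U i ω + U k ω') ∂P ∂P + 4 * L * B * α := by
          linarith
      _ ≤ _ := by linarith

/-- Integrates `exp y ≤ 1 + y + y²`, valid for `|y| ≤ 1`; the linear term has mean zero. -/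
theorem integral_exp_le {U : Ω → ℝ} {t B : ℝ} (hU : Measurable U) (hUB : ∀ ω, |U ω| ≤ B)
    (ht : 0 ≤ t) (htB : t * B ≤ 1) (hmean : ∫ ω, U ω ∂P = 0) :
    ∫ ω, Real.exp (t * U ω) ∂P ≤ Real.exp (t ^ 2 * ∫ ω, U ω ^ 2 ∂P) := by
  have hUi : Integrable U P := Integrable.of_bound hU.aestronglyMeasurable B (ae_of_all _ hUB)
  have hU2 : Integrable (fun ω => U ω ^ 2) P := by
    refine Integrable.of_bound (hU.pow_const 2).aestronglyMeasurable (B ^ 2) (ae_of_all _ fun ω => ?_)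
    rw [norm_pow]
    exact pow_le_pow_left₀ (norm_nonneg _) (hUB ω) 2
  have hb : ∀ ω, |t * U ω| ≤ 1 := fun ω => by
    rw [abs_mul, abs_of_nonneg ht]
    exact (mul_le_mul_of_nonneg_left (hUB ω) ht).trans htB
  have hei : Integrable (fun ω => Real.exp (t * U ω)) P := by
    refine Integrable.of_bound (C := Real.exp 1)
      (Real.measurable_exp.comp (hU.const_mul t)).aestronglyMeasurable (ae_of_all _ fun ω => ?_)
    rw [Real.norm_eq_abs, Real.abs_exp]
    exact Real.exp_le_exp.mpr ((le_abs_self _).trans (hb ω))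
  calc ∫ ω, Real.exp (t * U ω) ∂P ≤ ∫ ω, (1 + t * U ω + t ^ 2 * U ω ^ 2) ∂P := by
        refine integral_mono hei (((integrable_const _).add (hUi.const_mul t)).add
          (hU2.const_mul _)) fun ω => ?_
        have := (abs_le.mp (Real.abs_exp_sub_one_sub_id_le (hb ω))).2
        simp only
        nlinarith
    _ = 1 + t ^ 2 * ∫ ω, U ω ^ 2 ∂P := by
        rw [integral_add (by exact (integrable_const _).add (hUi.const_mul t))
          (hU2.const_mul _), integral_add (integrable_const _) (hUi.const_mul t),
          integral_const_mul, integral_const_mul, hmean]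
        simp
    _ ≤ _ := by
        have := Real.add_one_le_exp (t ^ 2 * ∫ ω, U ω ^ 2 ∂P)
        linarith

/-- A Bernstein inequality for chains of weakly dependent bounded variables. -/
theorem measure_sum_ge_le_of_chain {α B t lam V : ℝ} (hB : 0 < B) (hlam : 0 < lam) (ht : 0 ≤ t)
    (htB : t * B ≤ 1) (U : ℕ → Ω → ℝ)
    (𝓕 𝓖 : ℕ → MeasurableSpace Ω) (hF : ∀ i, 𝓕 i ≤ m₀) (hG : ∀ i, 𝓖 i ≤ m₀)
    (hU : ∀ i, Measurable[𝓖 i] (U i)) (hGF : ∀ i j, j < i → 𝓖 j ≤ 𝓕 i)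
    (hmix : ∀ i, MixingLE P (𝓕 i) (𝓖 i) α) (hUB : ∀ i ω, |U i ω| ≤ B)
    (hmean : ∀ i, ∫ ω, U i ω ∂P = 0) (k : ℕ)
    (hV : ∑ i ∈ Finset.range k, ∫ ω, U i ω ^ 2 ∂P ≤ V) :
    P.real {ω | lam ≤ ∑ i ∈ Finset.range k, U i ω} ≤
      Real.exp (-(t * lam / 2) + t ^ 2 * V) + k * (8 * B * α / lam) := by
  have hUm : ∀ i, Measurable (U i) := fun i => (hU i).mono (hG i) le_rfl
  -- A piecewise linear cutoff that vanishes below `lam / 2` and equals 1 above `lam`. It dominates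
  -- the tail indicator, is dominated by `exp (t (s - lam / 2))`, and has slope `2 / lam`.
  set f : ℝ → ℝ := fun s => max 0 (min 1 (2 / lam * s - 1)) with hf
  have hfL : ∀ s t, |f s - f t| ≤ 2 / lam * |s - t| := by
    intro s t
    have e : 2 / lam * |s - t| = |(2 / lam * s - 1) - (2 / lam * t - 1)| := by
      rw [show (2 / lam * s - 1) - (2 / lam * t - 1) = 2 / lam * (s - t) by ring, abs_mul,
        abs_of_pos (by positivity : 0 < 2 / lam)]
    rw [e]
    simp only [hf]
    refine (abs_max_sub_max_le_max _ _ _ _).trans ?_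
    rw [sub_self, abs_zero]
    refine max_le (abs_nonneg _) ((abs_min_sub_min_le_max _ _ _ _).trans ?_)
    rw [sub_self, abs_zero]
    exact max_le (abs_nonneg _) le_rfl
  have hf1 : ∀ s, f s ≤ 1 := fun s => max_le zero_le_one (min_le_left _ _)
  have hf0 : ∀ s, 0 ≤ f s := fun s => le_max_left _ _
  have hfe : ∀ s, f s ≤ Real.exp (-(t * lam / 2)) * Real.exp (t * s) := by
    intro s
    rw [← Real.exp_add]
    rcases le_total (lam / 2) s with hs | hs
    · refine (hf1 s).trans (Real.one_le_exp ?_)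
      nlinarith
    · have : f s = 0 := by
        refine max_eq_left ((min_le_right _ _).trans ?_)
        rw [sub_nonpos, div_mul_eq_mul_div, div_le_one hlam]
        linarith
      rw [this]
      exact (Real.exp_pos _).le
  have main := integral_lipschitz_chain_le (P := P) (t := t) (by positivity : 0 ≤ 2 / lam) hB U 𝓕 𝓖
    hF hG hU hGF hmix hUB k f _ 1 hfL (fun s => by rw [abs_of_nonneg (hf0 s)]; exact hf1 s) hfe
  have hSm : Measurable fun ω => ∑ i ∈ Finset.range k, U i ω :=
    Finset.measurable_sum _ fun i _ => hUm i
  have hms : MeasurableSet {ω | lam ≤ ∑ i ∈ Finset.range k, U i ω} := hSm measurableSet_Ici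
  have hfm : Measurable f := by
    simp only [hf]; fun_prop
  have low : P.real {ω | lam ≤ ∑ i ∈ Finset.range k, U i ω} ≤
      ∫ ω, f (∑ i ∈ Finset.range k, U i ω) ∂P := by
    rw [← setIntegral_one_eq_measureReal, ← integral_indicator hms]
    refine integral_mono ((integrable_const _).indicator hms)
      (Integrable.of_bound (hfm.comp hSm).aestronglyMeasurable 1 (ae_of_all _ fun ω => by
        rw [Real.norm_eq_abs, abs_of_nonneg (hf0 _)]; exact hf1 _)) fun ω => ?_
    simp only [Set.indicator_apply, Set.mem_ofPred_eq]
    split_ifs with hω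
    · have : (1 : ℝ) ≤ 2 / lam * (∑ i ∈ Finset.range k, U i ω) - 1 := by
        have : (2 : ℝ) ≤ 2 / lam * (∑ i ∈ Finset.range k, U i ω) := by
          rw [div_mul_eq_mul_div, le_div_iff₀ hlam]; linarith
        linarith
      exact le_max_of_le_right (le_min le_rfl this)
    · exact hf0 _
  have prod_le : ∏ i ∈ Finset.range k, ∫ ω, Real.exp (t * U i ω) ∂P ≤ Real.exp (t ^ 2 * V) := by
    calc ∏ i ∈ Finset.range k, ∫ ω, Real.exp (t * U i ω) ∂P
        ≤ ∏ i ∈ Finset.range k, Real.exp (t ^ 2 * ∫ ω, U i ω ^ 2 ∂P) :=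
          Finset.prod_le_prod (fun i _ => integral_nonneg fun ω => (Real.exp_pos _).le)
            fun i _ => integral_exp_le (hUm i) (hUB i) ht htB (hmean i)
      _ = Real.exp (t ^ 2 * ∑ i ∈ Finset.range k, ∫ ω, U i ω ^ 2 ∂P) := by
          rw [← Real.exp_sum, Finset.mul_sum]
      _ ≤ _ := Real.exp_le_exp.mpr (mul_le_mul_of_nonneg_left hV (sq_nonneg t))
  calc _ ≤ _ := low
    _ ≤ _ := main
    _ ≤ Real.exp (-(t * lam / 2)) * Real.exp (t ^ 2 * V) + k * (4 * (2 / lam) * B * α) := by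
        gcongr
    _ = _ := by rw [← Real.exp_add]; ring

end Decoupling

/-! ### Block decomposition of a strongly mixing sequence. -/

section Blocks

/-- The σ-algebra generated by the variables `ξ i`, `i ∈ I`. -/
abbrev sigmaOn {Ω E : Type*} [MeasurableSpace E] (ξ : ℕ → Ω → E) (I : Set ℕ) : MeasurableSpace Ω :=
  ⨆ i ∈ I, MeasurableSpace.comap (ξ i) inferInstance

variable {Ω E : Type*} [MeasurableSpace E] {ξ : ℕ → Ω → E}

theorem sigmaOn_mono {I J : Set ℕ} (h : I ⊆ J) : sigmaOn ξ I ≤ sigmaOn ξ J :=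
  biSup_mono h

theorem comap_le_sigmaOn {I : Set ℕ} {i : ℕ} (hi : i ∈ I) :
    MeasurableSpace.comap (ξ i) inferInstance ≤ sigmaOn ξ I :=
  le_biSup (fun i => MeasurableSpace.comap (ξ i) inferInstance) hi

variable [m₀ : MeasurableSpace Ω] {P : Measure Ω}

theorem sigmaOn_le (hξ : ∀ i, 1 ≤ i → Measurable (ξ i)) {I : Set ℕ} (hI : ∀ i ∈ I, 1 ≤ i) :
    sigmaOn ξ I ≤ m₀ :=
  iSup₂_le fun i hi => (hξ i (hI i hi)).comap_le

theorem mixingCoeff_nonneg (j : ℕ) : 0 ≤ mixingCoeff P ξ j :=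
  Real.sSup_nonneg (by rintro r ⟨k, -, A, B, -, -, rfl⟩; exact abs_nonneg _)

variable [IsProbabilityMeasure P]

theorem mixingCoeff_bddAbove (j : ℕ) :
    BddAbove {r : ℝ | ∃ k : ℕ, 1 ≤ k ∧ ∃ A B : Set Ω,
      MeasurableSet[⨆ i ∈ Set.Icc 1 k, MeasurableSpace.comap (ξ i) inferInstance] A ∧
      MeasurableSet[⨆ i ∈ Set.Ici (k + j), MeasurableSpace.comap (ξ i) inferInstance] B ∧
      r = |P.real (A ∩ B) - P.real A * P.real B|} := by
  refine ⟨1, ?_⟩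
  rintro r ⟨k, -, A, B, -, -, rfl⟩
  have h1 : P.real (A ∩ B) ≤ 1 := measureReal_le_one
  have h2 : P.real A ≤ 1 := measureReal_le_one
  have h3 : P.real B ≤ 1 := measureReal_le_one
  have h4 : 0 ≤ P.real (A ∩ B) := measureReal_nonneg
  have h5 : 0 ≤ P.real A := measureReal_nonneg
  have h6 : 0 ≤ P.real B := measureReal_nonneg
  rw [abs_le]
  constructor <;> nlinarith

theorem mixingLE_sigmaOn {I J : Set ℕ} {k s : ℕ} (hI : I ⊆ Set.Icc 1 k) (hJ : J ⊆ Set.Ici (k + s)) :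
    MixingLE P (sigmaOn ξ I) (sigmaOn ξ J) (mixingCoeff P ξ s) := by
  -- `mixingCoeff` only ranges over `k ≥ 1`; for `k = 0` the first σ-algebra is trivial and all
  -- covariances vanish.
  rcases Nat.eq_zero_or_pos k with rfl | hk
  · have hI0 : I = ∅ := by
      ext i
      simp only [Set.mem_empty_iff_false, iff_false]
      intro hi
      have := hI hi
      simp at this
    intro A B hA _
    have h0 : sigmaOn ξ I = ⊥ := by rw [hI0]; simp [sigmaOn]
    rw [h0, MeasurableSpace.measurableSet_bot_iff] at hA
    rcases hA with rfl | rfl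
    · simpa using mixingCoeff_nonneg s
    · simpa using mixingCoeff_nonneg s
  · intro A B hA hB
    exact le_csSup (mixingCoeff_bddAbove s)
      ⟨k, hk, A, B, sigmaOn_mono hI A hA, sigmaOn_mono hJ B hB, rfl⟩

/-- One-sided tail bound for the sum over every second block. -/
theorem measure_sum_blocks_ge_le (hξ : ∀ i, 1 ≤ i → Measurable (ξ i)) {z : ℕ → Ω → ℝ}
    {q o k : ℕ} {B v t lam : ℝ} (hq : 0 < q) (hB : 0 < B) (hlam : 0 < lam) (ht : 0 ≤ t)
    (htB : t * (q * B) ≤ 1)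
    (hz : ∀ j, 1 ≤ j → Measurable[MeasurableSpace.comap (ξ j) inferInstance] (z j))
    (hzB : ∀ j ω, |z j ω| ≤ B) (hmean : ∀ j, ∫ ω, z j ω ∂P = 0)
    (hvar : ∀ T : Finset ℕ, (∀ j ∈ T, 1 ≤ j) → ∫ ω, (∑ j ∈ T, z j ω) ^ 2 ∂P ≤ T.card * v) :
    P.real {ω | lam ≤ ∑ i ∈ Finset.range k,
        ∑ j ∈ Finset.Ioc (2 * i * q + o) (2 * i * q + o + q), z j ω} ≤
      Real.exp (-(t * lam / 2) + t ^ 2 * (k * q * v)) +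
        k * (8 * (q * B) * mixingCoeff P ξ q / lam) := by
  have hqr : (0 : ℝ) < q := by exact_mod_cast hq
  set I : ℕ → Set ℕ := fun i => Set.Ioc (2 * i * q + o) (2 * i * q + o + q) with hI
  -- `J i` is the past up to `q` steps before block `i`. It contains all earlier blocks of the same
  -- family, because consecutive blocks are separated by a gap of length `q`.
  set J : ℕ → Set ℕ := fun i => Set.Icc 1 (2 * i * q + o - q) with hJ
  have hI1 : ∀ i, ∀ j ∈ I i, 1 ≤ j := fun i j hj => by
    have := hj.1
    omega
  have hJ1 : ∀ i, ∀ j ∈ J i, 1 ≤ j := fun i j hj => hj.1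
  have hzm : ∀ j, 1 ≤ j → Measurable (z j) := fun j hj =>
    (hz j hj).mono (hξ j hj).comap_le le_rfl
  have key := measure_sum_ge_le_of_chain (P := P) (α := mixingCoeff P ξ q) (B := q * B) (t := t)
    (lam := lam) (V := k * q * v) (by positivity) hlam ht htB
    (fun i ω => ∑ j ∈ Finset.Ioc (2 * i * q + o) (2 * i * q + o + q), z j ω)
    (fun i => sigmaOn ξ (J i)) (fun i => sigmaOn ξ (I i)) (fun i => sigmaOn_le hξ (hJ1 i))
    (fun i => sigmaOn_le hξ (hI1 i)) ?_ ?_ ?_ ?_ ?_ k ?_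
  · exact key
  · intro i
    refine Finset.measurable_sum _ fun j hj => ?_
    have hj' : j ∈ I i := by simpa [hI] using hj
    exact (hz j (hI1 i j hj')).mono (comap_le_sigmaOn hj') le_rfl
  · intro i j hij
    refine sigmaOn_mono fun l hl => ?_
    have h1 := hl.1
    have h2 := hl.2
    have : (j + 1) * q ≤ i * q := Nat.mul_le_mul_right q hij
    refine ⟨by omega, ?_⟩
    have e1 : 2 * j * q = 2 * (j * q) := by ring
    have e2 : 2 * i * q = 2 * (i * q) := by ring
    have e3 : (j + 1) * q = j * q + q := by ring
    omega
  · intro i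
    -- Otherwise the truncated subtraction makes `J i` empty and its σ-algebra trivial.
    by_cases h : q ≤ 2 * i * q + o
    · refine mixingLE_sigmaOn (k := 2 * i * q + o - q) le_rfl fun l hl => ?_
      have := hl.1
      simp only [Set.mem_Ici]
      omega
    · have : J i = ∅ := by
        simp only [hJ]
        rw [Nat.sub_eq_zero_of_le (by omega)]
        simp
      rw [this]
      have e : (sigmaOn ξ (∅ : Set ℕ)) = ⊥ := by simp [sigmaOn]
      intro A B' hA _
      rw [e, MeasurableSpace.measurableSet_bot_iff] at hA
      rcases hA with rfl | rfl
      · simpa using mixingCoeff_nonneg q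
      · simpa using mixingCoeff_nonneg q
  · intro i ω
    refine (Finset.abs_sum_le_sum_abs _ _).trans ((Finset.sum_le_sum fun j _ => hzB j ω).trans ?_)
    simp
  · intro i
    rw [integral_finsetSum]
    · simp [hmean]
    · intro j hj
      have : 1 ≤ j := hI1 i j (by simpa [hI] using hj)
      exact Integrable.of_bound (hzm j this).aestronglyMeasurable B (ae_of_all _ fun ω => hzB j ω)
  · calc _ ≤ ∑ i ∈ Finset.range k, (q : ℝ) * v := by
          refine Finset.sum_le_sum fun i _ => (hvar _ fun j hj => ?_).trans ?_
          · exact hI1 i j (by simpa [hI] using hj)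
          · simp
      _ = _ := by simp [mul_assoc]

/-- The two families are the even and the odd blocks; within each of them the mixing coefficient at
lag `q` is available. -/
theorem sum_Ioc_eq_sum_blocks (q k : ℕ) (f : ℕ → ℝ) :
    ∑ j ∈ Finset.Ioc 0 (2 * k * q), f j =
      ∑ i ∈ Finset.range k, ∑ j ∈ Finset.Ioc (2 * i * q + 0) (2 * i * q + 0 + q), f j +
      ∑ i ∈ Finset.range k, ∑ j ∈ Finset.Ioc (2 * i * q + q) (2 * i * q + q + q), f j := by
  induction k with
  | zero => simp
  | succ k ih =>
    rw [Finset.sum_range_succ, Finset.sum_range_succ]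
    have e : 2 * (k + 1) * q = 2 * k * q + q + q := by ring
    rw [e, ← Finset.sum_Ioc_consecutive f (Nat.zero_le (2 * k * q)) (by omega : 2 * k * q ≤ 2 * k * q + q + q),
      ← Finset.sum_Ioc_consecutive f (by omega : 2 * k * q ≤ 2 * k * q + q)
        (by omega : 2 * k * q + q ≤ 2 * k * q + q + q), ih]
    simp only [add_zero]
    ring

/-- A Bernstein type inequality for bounded centered variables under strong mixing. -/
theorem measure_abs_sum_ge_le (hξ : ∀ i, 1 ≤ i → Measurable (ξ i)) {z : ℕ → Ω → ℝ}
    {q n : ℕ} {B v t lam : ℝ} (hq : 0 < q) (hqn : q ≤ n) (hB : 0 < B) (hlam : 0 < lam) (ht : 0 ≤ t)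
    (hv : 0 ≤ v) (htB : t * (q * B) ≤ 1)
    (hz : ∀ j, 1 ≤ j → Measurable[MeasurableSpace.comap (ξ j) inferInstance] (z j))
    (hzB : ∀ j ω, |z j ω| ≤ B) (hmean : ∀ j, ∫ ω, z j ω ∂P = 0) (hzn : ∀ j, n < j → z j = 0)
    (hvar : ∀ T : Finset ℕ, (∀ j ∈ T, 1 ≤ j) → ∫ ω, (∑ j ∈ T, z j ω) ^ 2 ∂P ≤ T.card * v) :
    P.real {ω | lam ≤ |∑ j ∈ Finset.Icc 1 n, z j ω|} ≤
      4 * (Real.exp (-(t * lam / 4) + t ^ 2 * (2 * n * v)) +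
        32 * n * B * mixingCoeff P ξ q / lam) := by
  have hqr : (0 : ℝ) < q := by exact_mod_cast hq
  -- Enough pairs of blocks to cover `1, …, n`; the overshoot is harmless since `z j = 0` for `j >
  -- n`, and `q ≤ n` keeps `k q ≤ 2 n`.
  set k := n / (2 * q) + 1 with hk
  have hkn : n ≤ 2 * k * q := by
    have := Nat.div_add_mod n (2 * q)
    have h2 := Nat.mod_lt n (by omega : 0 < 2 * q)
    have e : 2 * k * q = 2 * q * (n / (2 * q)) + 2 * q := by rw [hk]; ring
    omega
  have hkq : (k : ℝ) * q ≤ 2 * n := by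
    have h1 : n / (2 * q) * (2 * q) ≤ n := Nat.div_mul_le_self n (2 * q)
    have e : k * q * 2 = n / (2 * q) * (2 * q) + 2 * q := by rw [hk]; ring
    have : k * q ≤ 2 * n := by omega
    exact_mod_cast this
  set S : ℕ → (ℕ → Ω → ℝ) → Ω → ℝ := fun o y ω => ∑ i ∈ Finset.range k,
    ∑ j ∈ Finset.Ioc (2 * i * q + o) (2 * i * q + o + q), y j ω with hS
  have hα := mixingCoeff_nonneg (P := P) (ξ := ξ) q
  have one : ∀ o, ∀ y : ℕ → Ω → ℝ, (y = z ∨ y = fun j ω => - z j ω) →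
      P.real {ω | lam / 2 ≤ S o y ω} ≤ Real.exp (-(t * lam / 4) + t ^ 2 * (2 * n * v)) +
        32 * n * B * mixingCoeff P ξ q / lam := by
    intro o y hy
    have bound := measure_sum_blocks_ge_le (P := P) hξ (z := y) (q := q) (o := o) (k := k) (B := B)
      (v := v) (t := t) (lam := lam / 2) hq hB (by positivity) ht htB ?_ ?_ ?_ ?_
    · refine bound.trans (add_le_add (Real.exp_le_exp.mpr ?_) ?_)
      · have : t ^ 2 * (k * q * v) ≤ t ^ 2 * (2 * n * v) :=
          mul_le_mul_of_nonneg_left (mul_le_mul_of_nonneg_right hkq hv) (sq_nonneg t)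
        linarith
      · have e : k * (8 * (q * B) * mixingCoeff P ξ q / (lam / 2)) =
            (k * q) * (16 * B * mixingCoeff P ξ q / lam) := by field_simp; ring
        rw [e]
        calc (k * q : ℝ) * (16 * B * mixingCoeff P ξ q / lam)
            ≤ 2 * n * (16 * B * mixingCoeff P ξ q / lam) :=
              mul_le_mul_of_nonneg_right hkq (by positivity)
          _ = _ := by ring
    · rcases hy with rfl | rfl
      · exact hz
      · exact fun j hj => (hz j hj).neg
    · rcases hy with rfl | rfl
      · exact hzB
      · intro j ω; rw [abs_neg]; exact hzB j ω
    · rcases hy with rfl | rfl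
      · exact hmean
      · intro j; rw [integral_neg, hmean, neg_zero]
    · rcases hy with rfl | rfl
      · exact hvar
      · intro T hT
        simpa [Finset.sum_neg_distrib] using hvar T hT
  have hsum : ∀ ω, ∑ j ∈ Finset.Icc 1 n, z j ω = S 0 z ω + S q z ω := by
    intro ω
    simp only [hS]
    rw [← sum_Ioc_eq_sum_blocks q k (fun j => z j ω)]
    refine Finset.sum_subset (fun j hj => ?_) fun j hj hj' => ?_
    · simp only [Finset.mem_Icc, Finset.mem_Ioc] at hj ⊢
      omega
    · simp only [Finset.mem_Icc, Finset.mem_Ioc] at hj hj'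
      rw [hzn j (by omega)]
      rfl
  have hneg : ∀ o ω, S o (fun j ω => - z j ω) ω = - S o z ω := by
    intro o ω
    simp [hS, Finset.sum_neg_distrib]
  -- Two families and two signs: one of four block sums must reach `lam / 2`, whence the factor 4.
  have hsub : {ω | lam ≤ |∑ j ∈ Finset.Icc 1 n, z j ω|} ⊆
      ({ω | lam / 2 ≤ S 0 z ω} ∪ {ω | lam / 2 ≤ S q z ω}) ∪
      ({ω | lam / 2 ≤ S 0 (fun j ω => - z j ω) ω} ∪
        {ω | lam / 2 ≤ S q (fun j ω => - z j ω) ω}) := by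
    intro ω hω
    simp only [Set.mem_ofPred_eq, Set.mem_union, hneg] at hω ⊢
    rw [hsum ω] at hω
    by_contra! hcon
    obtain ⟨⟨c1, c2⟩, c3, c4⟩ := hcon
    rcases le_abs.mp hω with h | h <;> linarith
  refine (measureReal_mono hsub).trans ((measureReal_union_le _ _).trans
    ((add_le_add (measureReal_union_le _ _) (measureReal_union_le _ _)).trans ?_))
  have a1 := one 0 z (Or.inl rfl)
  have a2 := one q z (Or.inl rfl)
  have a3 := one 0 _ (Or.inr rfl)
  have a4 := one q _ (Or.inr rfl)
  linarith

end Blocks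

/-! ### Variance of sums from covariance bounds in size and in lag. -/

section Variance

/-- Each term is at most the telescoping difference `1 / (s + w) - 1 / (s + 1 + w)`. -/
theorem sum_inv_sq_le {w : ℝ} (hw : 0 < w) (N : ℕ) :
    ∑ s ∈ Finset.range N, 1 / ((s + 1 : ℝ) + w) ^ 2 ≤ 1 / w - 1 / (N + w) := by
  induction N with
  | zero => simp
  | succ N ih =>
    rw [Finset.sum_range_succ]
    have h : 1 / ((N + 1 : ℝ) + w) ^ 2 ≤ 1 / (N + w) - 1 / ((N + 1 : ℝ) + w) := by
      rw [div_sub_div _ _ (by positivity) (by positivity), div_le_div_iff₀ (by positivity) (by positivity)]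
      have hN : (0 : ℝ) ≤ N := Nat.cast_nonneg N
      nlinarith [mul_nonneg hN hw.le]
    push_cast
    linarith

/-- On either side of `i` the distance to `i` is injective, so each side contributes at most `G`. -/
theorem sum_dist_le {g : ℕ → ℝ} (hg : ∀ s, 0 ≤ g s) {G : ℝ}
    (hG : ∀ N, ∑ s ∈ Finset.range N, g (s + 1) ≤ G) (T : Finset ℕ) (i : ℕ) :
    ∑ j ∈ T with j ≠ i, g (Nat.dist i j) ≤ 2 * G := by
  have part : ∀ T' : Finset ℕ, (∀ j ∈ T', j ≠ i) → Set.InjOn (fun j => Nat.dist i j - 1) T' →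
      ∑ j ∈ T', g (Nat.dist i j) ≤ G := by
    intro T' hne hinj
    have h1 : ∑ j ∈ T', g (Nat.dist i j) = ∑ s ∈ T'.image (fun j => Nat.dist i j - 1), g (s + 1) := by
      rw [Finset.sum_image hinj]
      refine Finset.sum_congr rfl fun j hj => ?_
      have : 0 < Nat.dist i j := Nat.dist_pos_of_ne (hne j hj).symm
      rw [Nat.sub_add_cancel this]
    rw [h1]
    refine (Finset.sum_le_sum_of_subset_of_nonneg (fun s hs => ?_) fun s _ _ => hg _).trans
      (hG ((T'.image (fun j => Nat.dist i j - 1)).sup id + 1))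
    rw [Finset.mem_range, Nat.lt_succ_iff]
    exact Finset.le_sup (f := id) hs
  have hsplit : ∑ j ∈ T with j ≠ i, g (Nat.dist i j) =
      ∑ j ∈ T with j < i, g (Nat.dist i j) + ∑ j ∈ T with i < j, g (Nat.dist i j) := by
    rw [← Finset.sum_union]
    · refine Finset.sum_congr ?_ fun _ _ => rfl
      ext j
      simp only [Finset.mem_filter, Finset.mem_union]
      constructor
      · rintro ⟨h1, h2⟩
        rcases lt_or_gt_of_ne h2 with h | h
        · exact Or.inl ⟨h1, h⟩
        · exact Or.inr ⟨h1, h⟩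
      · rintro (⟨h1, h2⟩ | ⟨h1, h2⟩)
        · exact ⟨h1, h2.ne⟩
        · exact ⟨h1, h2.ne'⟩
    · rw [Finset.disjoint_left]
      intro j h1 h2
      simp only [Finset.mem_filter] at h1 h2
      omega
  rw [hsplit]
  have a1 := part (T.filter fun j => j < i) (fun j hj => (Finset.mem_filter.mp hj).2.ne) (by
    intro a ha b hb hab
    simp only [Finset.coe_filter, Set.mem_ofPred_eq] at ha hb
    simp only [Nat.dist] at hab
    omega)
  have a2 := part (T.filter fun j => i < j) (fun j hj => (Finset.mem_filter.mp hj).2.ne') (by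
    intro a ha b hb hab
    simp only [Finset.coe_filter, Set.mem_ofPred_eq] at ha hb
    simp only [Nat.dist] at hab
    omega)
  linarith

variable {Ω : Type*} [MeasurableSpace Ω] {P : Measure Ω}

/-- Second moment of a sum whose covariances are bounded in size and decay in the lag. -/
theorem integral_sq_sum_le {z : ℕ → Ω → ℝ} {c x : ℝ} (hc : 0 ≤ c) (hx : 0 < x)
    (hint : ∀ i j, 1 ≤ i → 1 ≤ j → Integrable (fun ω => z i ω * z j ω) P)
    (h2 : ∀ i, 1 ≤ i → ∫ ω, z i ω ^ 2 ∂P ≤ c * x ^ 2)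
    (hsmall : ∀ i j, 1 ≤ i → 1 ≤ j → i ≠ j → |∫ ω, z i ω * z j ω ∂P| ≤ c * x ^ 3)
    (hlag : ∀ i j, 1 ≤ i → 1 ≤ j → i ≠ j →
      |∫ ω, z i ω * z j ω ∂P| ≤ c / (Nat.dist i j : ℝ) ^ 3)
    (T : Finset ℕ) (hT : ∀ j ∈ T, 1 ≤ j) :
    ∫ ω, (∑ j ∈ T, z j ω) ^ 2 ∂P ≤ T.card * (17 * c * x ^ 2) := by
  -- The bounds `c x³` and `c / s³` cross at the lag `s = w`. The function `g` below dominates their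
  -- minimum and sums over lags to at most `8 c x²`; with both sides of `i` and the diagonal this
  -- gives `17 = 2 * 8 + 1`.
  set w := 1 / x with hw
  have hw0 : 0 < w := by positivity
  set g : ℕ → ℝ := fun s => 8 * c * x * (1 / ((s : ℝ) + w) ^ 2) with hg
  have hg0 : ∀ s, 0 ≤ g s := fun s => by simp only [hg]; positivity
  have hG : ∀ N, ∑ s ∈ Finset.range N, g (s + 1) ≤ 8 * c * x ^ 2 := by
    intro N
    simp only [hg]
    rw [← Finset.mul_sum]
    push_cast
    have h1 := sum_inv_sq_le hw0 N
    have h3 : (0 : ℝ) ≤ 1 / (N + w) := by positivity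
    have h4 : 1 / w = x := by rw [hw]; simp
    calc _ ≤ 8 * c * x * x := mul_le_mul_of_nonneg_left (by linarith) (by positivity)
      _ = _ := by ring
  have cov : ∀ i j, 1 ≤ i → 1 ≤ j → j ≠ i → ∫ ω, z i ω * z j ω ∂P ≤ g (Nat.dist i j) := by
    intro i j hi hj hij
    have hs : (0 : ℝ) < Nat.dist i j := by exact_mod_cast Nat.dist_pos_of_ne hij.symm
    set s : ℝ := ((Nat.dist i j : ℕ) : ℝ) with hs'
    have a1 := (le_abs_self _).trans (hsmall i j hi hj hij.symm)
    have a2 := (le_abs_self _).trans (hlag i j hi hj hij.symm)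
    have hxw : x = 1 / w := by rw [hw]; simp
    simp only [hg]
    rcases le_total s w with h | h
    · refine a1.trans ?_
      have : x ^ 2 ≤ 8 * (1 / (s + w) ^ 2) := by
        rw [hxw, ← mul_div_assoc, div_pow, div_le_div_iff₀ (by positivity) (by positivity)]
        nlinarith
      calc c * x ^ 3 = c * x * x ^ 2 := by ring
        _ ≤ c * x * (8 * (1 / (s + w) ^ 2)) := mul_le_mul_of_nonneg_left this (by positivity)
        _ = _ := by ring
    · refine a2.trans ?_
      rw [hxw, show 8 * c * (1 / w) * (1 / (s + w) ^ 2) = c * (8 / (w * (s + w) ^ 2)) by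
        field_simp, div_eq_mul_inv]
      refine mul_le_mul_of_nonneg_left ?_ hc
      rw [← one_div, div_le_div_iff₀ (by positivity) (by positivity)]
      have h5 : (s + w) ^ 2 ≤ (2 * s) ^ 2 := pow_le_pow_left₀ (by positivity) (by linarith) 2
      have h6 : w * (s + w) ^ 2 ≤ s * (2 * s) ^ 2 := mul_le_mul h h5 (by positivity) hs.le
      nlinarith [pow_pos hs 3]
  have expand : ∀ ω, (∑ j ∈ T, z j ω) ^ 2 = ∑ i ∈ T, ∑ j ∈ T, z i ω * z j ω := by
    intro ω
    rw [sq, Finset.sum_mul_sum]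
  simp only [expand]
  rw [integral_finsetSum _ fun i hi => integrable_finsetSum _ fun j hj => hint i j (hT i hi) (hT j hj)]
  have row : ∀ i ∈ T, ∫ ω, ∑ j ∈ T, z i ω * z j ω ∂P ≤ 17 * c * x ^ 2 := by
    intro i hi
    rw [integral_finsetSum _ fun j hj => hint i j (hT i hi) (hT j hj),
      ← Finset.sum_filter_add_sum_filter_not T (fun j => j ≠ i)]
    have b1 : ∑ j ∈ T with j ≠ i, ∫ ω, z i ω * z j ω ∂P ≤ 2 * (8 * c * x ^ 2) := by
      refine (Finset.sum_le_sum fun j hj => ?_).trans (sum_dist_le hg0 hG T i)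
      obtain ⟨hj1, hj2⟩ := Finset.mem_filter.mp hj
      exact cov i j (hT i hi) (hT j hj1) hj2
    have b2 : ∑ j ∈ T with ¬ j ≠ i, ∫ ω, z i ω * z j ω ∂P ≤ c * x ^ 2 := by
      have : T.filter (fun j => ¬ j ≠ i) = {i} := by
        ext j
        simp only [Finset.mem_filter, Finset.mem_singleton, ne_eq, not_not]
        exact ⟨fun h => h.2, fun h => ⟨h ▸ hi, h⟩⟩
      rw [this, Finset.sum_singleton]
      simpa [sq] using h2 i (hT i hi)
    linarith
  calc _ ≤ ∑ i ∈ T, 17 * c * x ^ 2 := Finset.sum_le_sum row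
    _ = _ := by rw [Finset.sum_const, nsmul_eq_mul]

end Variance

/-! ### Variance bounds for bounded variables under arithmetic mixing. -/

section TruncatedVariance

variable {Ω E : Type*} [MeasurableSpace E] {ξ : ℕ → Ω → E} [MeasurableSpace Ω] {P : Measure Ω}

theorem rate_const_nonneg {a Cα : ℝ} (hα : ∀ n : ℕ, 1 ≤ n → mixingCoeff P ξ n ≤ Cα * (n : ℝ) ^ (-a)) :
    0 ≤ Cα := by
  have := hα 1 le_rfl
  simp only [Nat.cast_one, Real.one_rpow, mul_one] at this
  exact (mixingCoeff_nonneg 1).trans this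

variable [IsProbabilityMeasure P]

theorem mixingLE_comap {i j : ℕ} (hi : 1 ≤ i) (hj : 1 ≤ j) :
    MixingLE P (MeasurableSpace.comap (ξ i) inferInstance)
      (MeasurableSpace.comap (ξ j) inferInstance) (mixingCoeff P ξ (Nat.dist i j)) := by
  have key : ∀ i j, 1 ≤ i → i ≤ j → MixingLE P (MeasurableSpace.comap (ξ i) inferInstance)
      (MeasurableSpace.comap (ξ j) inferInstance) (mixingCoeff P ξ (Nat.dist i j)) := by
    intro i j hi hij
    have h := mixingLE_sigmaOn (P := P) (ξ := ξ) (I := {i}) (J := {j}) (k := i) (s := Nat.dist i j)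
      (by simp [hi]) (by simp [Nat.dist]; omega)
    exact h.mono (comap_le_sigmaOn rfl) (comap_le_sigmaOn rfl)
  rcases le_total i j with h | h
  · exact key i j hi h
  · rw [Nat.dist_comm]
    exact (key j i hj h).symm

/-- The variance of sums of bounded variables under arithmetic mixing. -/
theorem exists_variance_bound (hξ : ∀ i, 1 ≤ i → Measurable (ξ i)) {a Cα : ℝ} (ha : 3 < a)
    (hα : ∀ n : ℕ, 1 ≤ n → mixingCoeff P ξ n ≤ Cα * (n : ℝ) ^ (-a)) :
    ∃ k : ℕ, ∀ C : ℝ, 1 ≤ C → ∃ c : ℝ, 0 ≤ c ∧ ∀ (y : ℕ → Ω → ℝ) (x M : ℝ), 0 < x → x ≤ 1 →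
      (∀ j, 1 ≤ j → Measurable[MeasurableSpace.comap (ξ j) inferInstance] (y j)) →
      (∀ j ω, |y j ω| ≤ M) → (∀ j, 1 ≤ j → ∫ ω, |y j ω| ∂P ≤ C * x ^ 2) →
      (∀ j, 1 ≤ j → ∫ ω, y j ω ^ 2 ∂P ≤ C * x ^ 2) →
      (∀ j, 1 ≤ j → ∫ ω, y j ω ^ (2 * k + 2) ∂P ≤ C) →
      (∀ i j, 1 ≤ i → 1 ≤ j → i ≠ j → ∫ ω, |y i ω * y j ω| ∂P ≤ C * x ^ 3) →
      ∀ T : Finset ℕ, (∀ j ∈ T, 1 ≤ j) →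
        ∫ ω, (∑ j ∈ T, (y j ω - ∫ ω', y j ω' ∂P)) ^ 2 ∂P ≤ T.card * (17 * c * x ^ 2) := by
  have hCα := rate_const_nonneg hα
  -- At lag `s` the covariance inequality is used with truncation level `s ^ τ`: the mixing term
  -- becomes `s ^ (2 τ - a) = s ^ (-3)`, and `k τ ≥ 3` makes the moment term at most of the same
  -- order.
  set τ := (a - 3) / 2 with hτ
  have hτ0 : 0 < τ := by rw [hτ]; linarith
  obtain ⟨k, hk⟩ := exists_nat_ge (3 / τ)
  have hkτ : 3 ≤ τ * k := by
    rw [div_le_iff₀ hτ0] at hk; linarith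
  refine ⟨k, fun C hC => ⟨4 * Cα + 4 * C ^ 2 + 2 * C ^ 2, by positivity, ?_⟩⟩
  intro y x M hx hx1 hy hyM hy1 hy2 hyk hyj T hT
  have hC0 : 0 ≤ C := by linarith
  have hym : ∀ j, 1 ≤ j → Measurable (y j) := fun j hj =>
    (hy j hj).mono (hξ j hj).comap_le le_rfl
  have hbdd : ∀ {f : Ω → ℝ} (_ : Measurable f) (c' : ℝ), (∀ ω, |f ω| ≤ c') → Integrable f P :=
    fun hf c' h => Integrable.of_bound hf.aestronglyMeasurable c' (ae_of_all _ h)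
  have hyi : ∀ j, 1 ≤ j → Integrable (y j) P := fun j hj => hbdd (hym j hj) M (hyM j)
  have hpow : ∀ j, 1 ≤ j → ∀ l : ℕ, Integrable (fun ω => y j ω ^ l) P := fun j hj l =>
    hbdd ((hym j hj).pow_const l) (M ^ l) fun ω => by
      rw [abs_pow]; exact pow_le_pow_left₀ (abs_nonneg _) (hyM j ω) l
  have hyy : ∀ i j, 1 ≤ i → 1 ≤ j → Integrable (fun ω => y i ω * y j ω) P := fun i j hi hj =>
    (hyi j hj).bdd_mul (hym i hi).aestronglyMeasurable (ae_of_all _ (hyM i))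
  set e : ℕ → ℝ := fun j => ∫ ω, y j ω ∂P with he
  have hcov : ∀ i j, 1 ≤ i → 1 ≤ j → ∫ ω, (y i ω - e i) * (y j ω - e j) ∂P =
      ∫ ω, y i ω * y j ω ∂P - e i * e j := by
    intro i j hi hj
    have h1 : ∀ ω, (y i ω - e i) * (y j ω - e j) =
        y i ω * y j ω - e j * y i ω - e i * y j ω + e i * e j := fun ω => by ring
    simp only [h1]
    have i1 : Integrable (fun ω => y i ω * y j ω - e j * y i ω) P :=
      (hyy i j hi hj).sub ((hyi i hi).const_mul _)
    have i2 : Integrable (fun ω => y i ω * y j ω - e j * y i ω - e i * y j ω) P :=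
      i1.sub ((hyi j hj).const_mul _)
    rw [integral_add i2 (integrable_const _), integral_sub i1 ((hyi j hj).const_mul _),
      integral_sub (hyy i j hi hj) ((hyi i hi).const_mul _), integral_const_mul, integral_const_mul]
    simp [he]
    ring
  have hx21 : x ^ 2 ≤ 1 := pow_le_one₀ hx.le hx1
  have he1 : ∀ j, 1 ≤ j → |e j| ≤ C * x ^ 2 := fun j hj =>
    abs_integral_le_integral_abs.trans (hy1 j hj)
  refine integral_sq_sum_le (x := x) (by positivity) hx ?_ ?_ ?_ ?_ T hT
  · intro i j hi hj
    have : Integrable (fun ω => y j ω - e j) P := (hyi j hj).sub (integrable_const _)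
    refine this.bdd_mul (c := M + |e i|) ((hym i hi).sub_const _).aestronglyMeasurable
      (ae_of_all _ fun ω => ?_)
    rw [Real.norm_eq_abs]
    exact (abs_sub _ _).trans (by linarith [hyM i ω])
  · intro i hi
    simp only [sq (_ - _)]
    rw [hcov i i hi hi]
    have h1 : ∫ ω, y i ω * y i ω ∂P ≤ C * x ^ 2 := by
      simpa only [sq] using hy2 i hi
    calc _ ≤ ∫ ω, y i ω * y i ω ∂P := by nlinarith [mul_self_nonneg (e i)]
      _ ≤ C * x ^ 2 := h1
      _ ≤ _ := mul_le_mul_of_nonneg_right (by nlinarith) (sq_nonneg x)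
  · intro i j hi hj hij
    rw [hcov i j hi hj]
    have h1 : |∫ ω, y i ω * y j ω ∂P| ≤ C * x ^ 3 :=
      abs_integral_le_integral_abs.trans (hyj i j hi hj hij)
    have h2 : |e i * e j| ≤ C ^ 2 * x ^ 3 := by
      rw [abs_mul]
      calc |e i| * |e j| ≤ (C * x ^ 2) * (C * x ^ 2) :=
            mul_le_mul (he1 i hi) (he1 j hj) (abs_nonneg _) (by positivity)
        _ = C ^ 2 * (x ^ 3 * x) := by ring
        _ ≤ C ^ 2 * (x ^ 3 * 1) := by gcongr
        _ = _ := by ring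
    calc _ ≤ |∫ ω, y i ω * y j ω ∂P| + |e i * e j| := abs_sub _ _
      _ ≤ C * x ^ 3 + C ^ 2 * x ^ 3 := add_le_add h1 h2
      _ = (C + C ^ 2) * x ^ 3 := by ring
      _ ≤ _ := mul_le_mul_of_nonneg_right (by nlinarith) (by positivity)
  · intro i j hi hj hij
    rw [hcov i j hi hj]
    set s : ℕ := Nat.dist i j with hs
    have hs0 : 1 ≤ s := Nat.dist_pos_of_ne hij
    have hsr : (1 : ℝ) ≤ s := by exact_mod_cast hs0
    have hsp : (0 : ℝ) < s := by linarith
    have b := (mixingLE_comap (P := P) (ξ := ξ) hi hj).abs_cov_le_of_moments (C := C)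
      (M := (s : ℝ) ^ τ) (k := k)
      (hξ i hi).comap_le (hξ j hj).comap_le (Real.rpow_pos_of_pos hsp _) hC
      (hy i hi).stronglyMeasurable (hy j hj).stronglyMeasurable (hpow i hi _) (hpow j hj _)
      (hpow i hi _) (hpow j hj _) ((hy2 i hi).trans (by nlinarith))
      ((hy2 j hj).trans (by nlinarith)) (hyk i hi) (hyk j hj)
    refine b.trans ?_
    have hs3 : 0 < (s : ℝ) ^ 3 := by positivity
    have t1 : 4 * ((s : ℝ) ^ τ) ^ 2 * mixingCoeff P ξ s ≤ 4 * Cα / (s : ℝ) ^ 3 := by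
      calc 4 * ((s : ℝ) ^ τ) ^ 2 * mixingCoeff P ξ s
          ≤ 4 * ((s : ℝ) ^ τ) ^ 2 * (Cα * (s : ℝ) ^ (-a)) :=
            mul_le_mul_of_nonneg_left (hα s hs0) (by positivity)
        _ = 4 * Cα * (((s : ℝ) ^ τ) ^ 2 * (s : ℝ) ^ (-a)) := by ring
        _ = 4 * Cα / (s : ℝ) ^ 3 := by
            rw [← Real.rpow_natCast, ← Real.rpow_mul hsp.le, ← Real.rpow_add hsp,
              ← Real.rpow_natCast, div_eq_mul_inv, ← Real.rpow_neg hsp.le]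
            congr 2
            rw [hτ]
            push_cast
            ring
    have t2 : 4 * C ^ 2 * (((s : ℝ) ^ τ) ^ k)⁻¹ ≤ 4 * C ^ 2 / (s : ℝ) ^ 3 := by
      rw [div_eq_mul_inv]
      refine mul_le_mul_of_nonneg_left (inv_anti₀ hs3 ?_) (by positivity)
      rw [← Real.rpow_natCast, ← Real.rpow_natCast, ← Real.rpow_mul hsp.le]
      exact Real.rpow_le_rpow_of_exponent_le hsr (by push_cast; exact hkτ)
    calc _ ≤ 4 * Cα / (s : ℝ) ^ 3 + 4 * C ^ 2 / (s : ℝ) ^ 3 := add_le_add t1 t2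
      _ = (4 * Cα + 4 * C ^ 2) / (s : ℝ) ^ 3 := by ring
      _ ≤ _ := by
        refine div_le_div_of_nonneg_right ?_ hs3.le
        nlinarith [sq_nonneg C]

end TruncatedVariance

/-! ### Truncation of unbounded variables. -/

section Truncation

/-- Truncation at the level `M`. -/
noncomputable def truncAt (M z : ℝ) : ℝ := if |z| ≤ M then z else 0

theorem measurable_truncAt (M : ℝ) : Measurable (truncAt M) :=
  Measurable.ite (measurableSet_le continuous_abs.measurable measurable_const) measurable_id
    measurable_const

theorem abs_truncAt_le {M : ℝ} (hM : 0 ≤ M) (z : ℝ) : |truncAt M z| ≤ M := by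
  unfold truncAt
  split_ifs with h
  · exact h
  · simpa using hM

theorem abs_truncAt_le_abs (M z : ℝ) : |truncAt M z| ≤ |z| := by
  unfold truncAt
  split_ifs
  · exact le_rfl
  · simp

theorem abs_sub_truncAt_le {M : ℝ} (hM : 0 < M) (m : ℕ) (z : ℝ) :
    |z - truncAt M z| ≤ (M ^ m)⁻¹ * |z| ^ (m + 1) := by
  unfold truncAt
  split_ifs with hz
  · simp; positivity
  · rw [sub_zero, inv_mul_eq_div, le_div_iff₀ (pow_pos hM m), pow_succ, mul_comm]
    exact mul_le_mul_of_nonneg_right (pow_le_pow_left₀ hM.le (not_le.mp hz).le m) (abs_nonneg _)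

theorem truncAt_of_le {M z : ℝ} (h : |z| ≤ M) : truncAt M z = z := if_pos h

end Truncation

/-! ### Reduction of tail bounds to truncated sums. -/

section Concentration

variable {Ω E : Type*} [MeasurableSpace E] {ξ : ℕ → Ω → E} [MeasurableSpace Ω] {P : Measure Ω}
  [IsProbabilityMeasure P]

/-- Tail bound for a sum of variables with all moments, at a fixed sample size: the sum is
compared with the sum of the variables truncated at the level `M`. -/
theorem measure_abs_sum_sub_le_trunc {Z : ℕ → Ω → ℝ} {n m : ℕ} {M C lam r : ℝ} (hM : 0 < M)
    (hZ : ∀ j, 1 ≤ j → Measurable (Z j))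
    (h1 : ∀ j ∈ Finset.Icc 1 n, Integrable (Z j) P)
    (hm : ∀ j ∈ Finset.Icc 1 n, Integrable (fun ω => |Z j ω| ^ (m + 1)) P ∧
      ∫ ω, |Z j ω| ^ (m + 1) ∂P ≤ C)
    (hr : n * ((M ^ m)⁻¹ * C) ≤ r) :
    P.real {ω | lam + r ≤ |∑ j ∈ Finset.Icc 1 n, (Z j ω - ∫ ω', Z j ω' ∂P)|} ≤
      P.real {ω | lam ≤ |∑ j ∈ Finset.Icc 1 n,
        (truncAt M (Z j ω) - ∫ ω', truncAt M (Z j ω') ∂P)|} +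
      n * ((M ^ (m + 1))⁻¹ * C) := by
  have hsub : {ω | lam + r ≤ |∑ j ∈ Finset.Icc 1 n, (Z j ω - ∫ ω', Z j ω' ∂P)|} ⊆
      {ω | lam ≤ |∑ j ∈ Finset.Icc 1 n, (truncAt M (Z j ω) - ∫ ω', truncAt M (Z j ω') ∂P)|} ∪
      ⋃ j ∈ Finset.Icc 1 n, {ω | M ^ (m + 1) ≤ |Z j ω| ^ (m + 1)} := by
    intro ω hω
    -- Either some `|Z j|` exceeds `M`, an event handled by Markov's inequality, or every variable
    -- equals its truncation and only the centering changes, by at most `r`.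
    by_cases hcase : ∃ j ∈ Finset.Icc 1 n, M < |Z j ω|
    · right
      obtain ⟨j, hj, hj'⟩ := hcase
      simp only [Set.mem_iUnion]
      exact ⟨j, hj, pow_le_pow_left₀ hM.le hj'.le _⟩
    · left
      push Not at hcase
      have e1 : ∑ j ∈ Finset.Icc 1 n, (Z j ω - ∫ ω', Z j ω' ∂P) =
          ∑ j ∈ Finset.Icc 1 n, (truncAt M (Z j ω) - ∫ ω', truncAt M (Z j ω') ∂P) -
          ∑ j ∈ Finset.Icc 1 n, ∫ ω', (Z j ω' - truncAt M (Z j ω')) ∂P := by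
        rw [← Finset.sum_sub_distrib]
        refine Finset.sum_congr rfl fun j hj => ?_
        rw [truncAt_of_le (hcase j hj), integral_sub (h1 j hj)]
        · ring
        · exact Integrable.of_bound ((measurable_truncAt M).comp
            (hZ j (Finset.mem_Icc.mp hj).1)).aestronglyMeasurable M
            (ae_of_all _ fun ω => abs_truncAt_le hM.le _)
      have e2 : |∑ j ∈ Finset.Icc 1 n, ∫ ω', (Z j ω' - truncAt M (Z j ω')) ∂P| ≤ r := by
        refine (Finset.abs_sum_le_sum_abs _ _).trans (le_trans ?_ hr)
        calc _ ≤ ∑ j ∈ Finset.Icc 1 n, (M ^ m)⁻¹ * C := by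
              refine Finset.sum_le_sum fun j hj => ?_
              calc |∫ ω', (Z j ω' - truncAt M (Z j ω')) ∂P|
                  ≤ ∫ ω', |Z j ω' - truncAt M (Z j ω')| ∂P := abs_integral_le_integral_abs
                _ ≤ ∫ ω', (M ^ m)⁻¹ * |Z j ω'| ^ (m + 1) ∂P :=
                    integral_mono_of_nonneg (ae_of_all _ fun _ => abs_nonneg _)
                      ((hm j hj).1.const_mul _) (ae_of_all _ fun ω => abs_sub_truncAt_le hM m _)
                _ ≤ (M ^ m)⁻¹ * C := by
                    rw [integral_const_mul]
                    exact mul_le_mul_of_nonneg_left (hm j hj).2 (by positivity)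
          _ = _ := by simp
      have hω' : lam + r ≤ |∑ j ∈ Finset.Icc 1 n, (Z j ω - ∫ ω', Z j ω' ∂P)| := hω
      rw [e1] at hω'
      have := abs_sub (∑ j ∈ Finset.Icc 1 n, (truncAt M (Z j ω) - ∫ ω', truncAt M (Z j ω') ∂P))
        (∑ j ∈ Finset.Icc 1 n, ∫ ω', (Z j ω' - truncAt M (Z j ω')) ∂P)
      show lam ≤ _
      linarith
  refine (measureReal_mono hsub).trans ((measureReal_union_le _ _).trans ?_)
  refine add_le_add le_rfl ((measureReal_biUnion_finset_le _ _).trans ?_)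
  calc _ ≤ ∑ j ∈ Finset.Icc 1 n, (M ^ (m + 1))⁻¹ * C := by
        refine Finset.sum_le_sum fun j hj => ?_
        have := mul_meas_ge_le_integral_of_nonneg (μ := P)
          (ae_of_all _ fun ω => pow_nonneg (abs_nonneg (Z j ω)) (m + 1)) (hm j hj).1 (M ^ (m + 1))
        rw [le_inv_mul_iff₀ (by positivity)]
        exact this.trans (hm j hj).2
    _ = _ := by simp

end Concentration

/-! ### Summable tail bounds for triangular arrays. -/

section Concentration

/-- Exponents for the truncation level `n ^ τ` and the block length `n ^ κ`. The equation leaves a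
spare factor `n ^ τ` between the bound `n ^ (κ + τ)` on a block and `√(n φ) ≥ n ^ ((1 - θ) / 2)`; it
absorbs `√(log n)`. The last inequality makes the mixing error summable: at `τ = 0` the exponent is
`1 - (a + 1)(1 - θ) / 2 < -1`, and a small `τ` preserves this. -/
theorem exists_block_exponents {a θ : ℝ} (ha : 3 < a) (hθ0 : 0 ≤ θ)
    (hθ : 2 < (a + 1) * (1 - θ) / 2) :
    ∃ τ κ : ℝ, 0 < τ ∧ 0 < κ ∧ κ ≤ 1 / 2 ∧ κ + 2 * τ = (1 - θ) / 2 ∧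
      1 + τ - κ * a - (1 - θ) / 2 < -1 := by
  have hθ1 : 0 < 1 - θ := by
    by_contra h
    push Not at h
    nlinarith
  set g := (a + 1) * (1 - θ) / 2 - 2 with hg
  have hg0 : 0 < g := by linarith
  have hd : 0 < 2 * (1 + 2 * a) := by linarith
  refine ⟨min (g / (2 * (1 + 2 * a))) ((1 - θ) / 8), (1 - θ) / 2 -
    2 * min (g / (2 * (1 + 2 * a))) ((1 - θ) / 8), lt_min (by positivity) (by linarith), ?_, ?_,
    by ring, ?_⟩
  · have := min_le_right (g / (2 * (1 + 2 * a))) ((1 - θ) / 8)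
    linarith
  · have : 0 < min (g / (2 * (1 + 2 * a))) ((1 - θ) / 8) := lt_min (by positivity) (by linarith)
    linarith
  · set τ := min (g / (2 * (1 + 2 * a))) ((1 - θ) / 8) with hτ
    have h1 : τ * (2 * (1 + 2 * a)) ≤ g := by
      rw [← le_div_iff₀ hd]; exact min_le_left _ _
    nlinarith

theorem eventually_sqrt_log_mul_rpow_le {τ : ℝ} (hτ : 0 < τ) :
    ∀ᶠ n : ℕ in atTop, 4 * Real.sqrt (Real.log n) * (n : ℝ) ^ (-τ) ≤ 1 := by
  have h : ∀ᶠ y : ℝ in atTop, Real.log y ≤ 1 / 16 * y ^ (2 * τ) := by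
    have := (isLittleO_log_rpow_atTop (by linarith : 0 < 2 * τ)).bound
      (by norm_num : (0 : ℝ) < 1 / 16)
    filter_upwards [this, eventually_gt_atTop 1] with y hy hy1
    rw [Real.norm_eq_abs, Real.norm_eq_abs, abs_of_nonneg (Real.log_nonneg hy1.le),
      abs_of_nonneg (Real.rpow_nonneg (by linarith) _)] at hy
    exact hy
  filter_upwards [tendsto_natCast_atTop_atTop.eventually h, eventually_gt_atTop 0] with n hn hn0
  have hnr : (0 : ℝ) < n := by exact_mod_cast hn0
  have h1 : Real.sqrt (Real.log n) ≤ 1 / 4 * (n : ℝ) ^ τ := by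
    rw [show 1 / 4 * (n : ℝ) ^ τ = Real.sqrt ((1 / 4 * (n : ℝ) ^ τ) ^ 2) by
      rw [Real.sqrt_sq (by positivity)]]
    refine Real.sqrt_le_sqrt (hn.trans (le_of_eq ?_))
    rw [mul_pow, ← Real.rpow_natCast, ← Real.rpow_natCast, ← Real.rpow_mul hnr.le]
    norm_num
    ring_nf
  calc 4 * Real.sqrt (Real.log n) * (n : ℝ) ^ (-τ) ≤ 4 * (1 / 4 * (n : ℝ) ^ τ) * (n : ℝ) ^ (-τ) := by
        gcongr
    _ = (n : ℝ) ^ τ * (n : ℝ) ^ (-τ) := by ring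
    _ = 1 := by rw [← Real.rpow_add hnr]; simp

theorem eventually_two_mul_rpow_le {κ : ℝ} (hκ : κ ≤ 1 / 2) :
    ∀ᶠ n : ℕ in atTop, 2 * (n : ℝ) ^ κ ≤ n := by
  filter_upwards [eventually_ge_atTop 4] with n hn
  have hn4 : (4 : ℝ) ≤ n := by exact_mod_cast hn
  have h1 : (n : ℝ) ^ κ ≤ Real.sqrt n := by
    rw [Real.sqrt_eq_rpow]
    exact Real.rpow_le_rpow_of_exponent_le (by linarith) hκ
  have h2 : (2 : ℝ) ≤ Real.sqrt n := by
    rw [show (2 : ℝ) = Real.sqrt (2 ^ 2) by rw [Real.sqrt_sq (by norm_num)]]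
    exact Real.sqrt_le_sqrt (by norm_num; exact hn)
  calc 2 * (n : ℝ) ^ κ ≤ Real.sqrt n * Real.sqrt n := mul_le_mul h2 h1 (by positivity) (by positivity)
    _ = n := Real.mul_self_sqrt (by linarith)

variable {Ω E : Type*} [MeasurableSpace E] {ξ : ℕ → Ω → E} [MeasurableSpace Ω] {P : Measure Ω}
  [IsProbabilityMeasure P]

/-- Complete concentration of sums of a triangular array, whose variables live on events of
probability `φ n`, around their means at the rate `√(n φ(n) log n)`. -/
theorem exists_summable_tail_bound (hξ : ∀ i, 1 ≤ i → Measurable (ξ i)) {a Cα θ : ℝ} (ha : 3 < a)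
    (hα : ∀ n : ℕ, 1 ≤ n → mixingCoeff P ξ n ≤ Cα * (n : ℝ) ^ (-a)) (hθ0 : 0 ≤ θ)
    (hθ : 2 < (a + 1) * (1 - θ) / 2) {φ : ℕ → ℝ} (hφ1 : ∀ n, φ n ≤ 1)
    (hφθ : ∀ᶠ n : ℕ in atTop, (n : ℝ) ^ (-θ) ≤ φ n) {Z : ℕ → ℕ → Ω → ℝ}
    (hZ : ∀ n j, 1 ≤ j → Measurable[MeasurableSpace.comap (ξ j) inferInstance] (Z n j))
    (hmom : ∀ m : ℕ, 1 ≤ m → ∃ C : ℝ, ∀ᶠ n in atTop, ∀ j ∈ Finset.Icc 1 n,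
      Integrable (fun ω => |Z n j ω| ^ m) P ∧ ∫ ω, |Z n j ω| ^ m ∂P ≤ C * φ n)
    (hjoint : ∃ C : ℝ, ∀ᶠ n in atTop, ∀ i ∈ Finset.Icc 1 n, ∀ j ∈ Finset.Icc 1 n, i ≠ j →
      Integrable (fun ω => Z n i ω * Z n j ω) P ∧
        ∫ ω, |Z n i ω * Z n j ω| ∂P ≤ C * Real.sqrt (φ n) ^ 3) :
    ∃ (Λ : ℝ) (p : ℕ → ℝ), 0 < Λ ∧ Summable p ∧ ∀ᶠ n in atTop,
      P.real {ω | Λ * (Real.sqrt (n * φ n) * Real.sqrt (Real.log n)) ≤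
        |∑ j ∈ Finset.Icc 1 n, (Z n j ω - ∫ ω', Z n j ω' ∂P)|} ≤ p n := by
  have hCα := rate_const_nonneg hα
  obtain ⟨τ, κ, hτ, hκ, hκ2, hκτ, hexp⟩ := exists_block_exponents ha hθ0 hθ
  obtain ⟨k, hk⟩ := exists_variance_bound (P := P) hξ ha hα
  -- With `m τ ≥ 3` the level `M = n ^ τ` satisfies `M ^ m ≥ n ^ 3`, so `n` truncation errors cost
  -- at most a multiple of `n ^ (-2)`.
  obtain ⟨m, hm⟩ := exists_nat_ge (3 / τ)
  have hmτ : 3 ≤ τ * m := by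
    rw [div_le_iff₀ hτ] at hm; linarith
  obtain ⟨C1, h1⟩ := hmom 1 le_rfl
  obtain ⟨C2, h2⟩ := hmom 2 (by norm_num)
  obtain ⟨Ck, hk'⟩ := hmom (2 * k + 2) (by omega)
  obtain ⟨Cm, hm'⟩ := hmom (m + 1) (by omega)
  obtain ⟨Cj, hj'⟩ := hjoint
  set C : ℝ := 1 + |C1| + |C2| + |Ck| + |Cm| + |Cj| with hC
  have n1 := abs_nonneg C1
  have n2 := abs_nonneg C2
  have n3 := abs_nonneg Ck
  have n4 := abs_nonneg Cm
  have n5 := abs_nonneg Cj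
  have hC1 : 1 ≤ C := by linarith
  obtain ⟨c, hc, hvar⟩ := hk C hC1
  -- For `t = √(log n) / √(n φ)` the Bernstein exponent is `(-Λ₀ / 4 + 34 c) log n`; this `Λ₀` makes
  -- it exactly `-2 log n`.
  set Λ₀ : ℝ := 4 * (34 * c + 2) with hΛ₀
  have hΛ1 : 1 ≤ Λ₀ := by rw [hΛ₀]; linarith
  set e : ℝ := 1 + τ - κ * a - (1 - θ) / 2 with he
  refine ⟨Λ₀ + C, fun n => 4 * ((n : ℝ) ^ (-2 : ℝ) + 64 * Cα * (n : ℝ) ^ e) + C * (n : ℝ) ^ (-2 : ℝ),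
    by linarith, ?_, ?_⟩
  · have s1 : Summable fun n : ℕ => (n : ℝ) ^ (-2 : ℝ) :=
      Real.summable_nat_rpow.mpr (by norm_num)
    have s2 : Summable fun n : ℕ => (n : ℝ) ^ e := Real.summable_nat_rpow.mpr hexp
    exact ((s1.add (s2.mul_left _)).mul_left _).add (s1.mul_left _)
  filter_upwards [h1, h2, hk', hm', hj', hφθ, eventually_sqrt_log_mul_rpow_le hτ,
    eventually_two_mul_rpow_le hκ2, eventually_ge_atTop 3] with n h1 h2 hk' hm' hj' hφθ hlog h2κ hn3
  have hnr : (3 : ℝ) ≤ n := by exact_mod_cast hn3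
  have hn0 : (0 : ℝ) < n := by linarith
  have hn1 : (1 : ℝ) ≤ n := by linarith
  have hφ0 : 0 < φ n := (Real.rpow_pos_of_pos hn0 _).trans_le hφθ
  set M : ℝ := (n : ℝ) ^ τ with hM
  have hM0 : 0 < M := Real.rpow_pos_of_pos hn0 _
  set x : ℝ := Real.sqrt (φ n) with hx
  have hx0 : 0 < x := Real.sqrt_pos.mpr hφ0
  have hx1 : x ≤ 1 := Real.sqrt_le_one.mpr (hφ1 n)
  have hx2 : x ^ 2 = φ n := Real.sq_sqrt hφ0.le
  have hZm : ∀ j, 1 ≤ j → Measurable (Z n j) := fun j hj =>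
    (hZ n j hj).mono (hξ j hj).comap_le le_rfl
  have hZi : ∀ j ∈ Finset.Icc 1 n, Integrable (Z n j) P := by
    intro j hj
    have := (h1 j hj).1
    simp only [pow_one] at this
    exact (integrable_norm_iff (hZm j (Finset.mem_Icc.mp hj).1).aestronglyMeasurable).mp this
  -- Extension by zero beyond `n`, since the variance bound and the blocks involve all indices `j ≥
  -- 1`.
  set y : ℕ → Ω → ℝ := fun j ω => if 1 ≤ j ∧ j ≤ n then truncAt M (Z n j ω) else 0 with hy
  have hyin : ∀ j ∈ Finset.Icc 1 n, y j = fun ω => truncAt M (Z n j ω) := by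
    intro j hj
    ext ω
    simp only [hy, if_pos (Finset.mem_Icc.mp hj)]
  have hyout : ∀ j, j ∉ Finset.Icc 1 n → y j = fun _ => 0 := by
    intro j hj
    ext ω
    rw [Finset.mem_Icc] at hj
    simp only [hy, if_neg hj]
  have hyM : ∀ j ω, |y j ω| ≤ M := by
    intro j ω
    by_cases hj : j ∈ Finset.Icc 1 n
    · rw [hyin j hj]; exact abs_truncAt_le hM0.le _
    · rw [hyout j hj]; simpa using hM0.le
  have hym : ∀ j, 1 ≤ j → Measurable[MeasurableSpace.comap (ξ j) inferInstance] (y j) := by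
    intro j hj1
    by_cases hj : j ∈ Finset.Icc 1 n
    · rw [hyin j hj]; exact (measurable_truncAt M).comp (hZ n j hj1)
    · rw [hyout j hj]; exact measurable_const
  have hmoment : ∀ (l : ℕ) (C' : ℝ), 0 ≤ C' → ∀ j, (j ∈ Finset.Icc 1 n →
      Integrable (fun ω => |Z n j ω| ^ l) P ∧ ∫ ω, |Z n j ω| ^ l ∂P ≤ C') → l ≠ 0 →
      ∫ ω, |y j ω| ^ l ∂P ≤ C' := by
    intro l C' hC' j hj' hl
    by_cases hj : j ∈ Finset.Icc 1 n
    · refine le_trans (integral_mono_of_nonneg (ae_of_all _ fun _ => by positivity) (hj' hj).1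
        (ae_of_all _ fun ω => ?_)) (hj' hj).2
      rw [hyin j hj]
      exact pow_le_pow_left₀ (abs_nonneg _) (abs_truncAt_le_abs _ _) l
    · rw [hyout j hj]
      simpa [hl] using hC'
  have le_C : ∀ {C' : ℝ}, |C'| ≤ C → ∀ {u v : ℝ}, 0 ≤ v → u ≤ C' * v → u ≤ C * v := by
    intro C' hC' u v hv hu
    exact hu.trans (mul_le_mul_of_nonneg_right ((le_abs_self _).trans hC') hv)
  have var := hvar y x M hx0 hx1 hym hyM ?_ ?_ ?_ ?_
  rotate_left
  · intro j _
    rw [hx2]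
    have := hmoment 1 (C * φ n) (by positivity) j
      (fun hj => ⟨(h1 j hj).1, le_C (by linarith) hφ0.le (h1 j hj).2⟩) one_ne_zero
    simpa only [pow_one] using this
  · intro j _
    rw [hx2]
    have := hmoment 2 (C * φ n) (by positivity) j
      (fun hj => ⟨(h2 j hj).1, le_C (by linarith) hφ0.le (h2 j hj).2⟩) two_ne_zero
    simpa only [sq_abs] using this
  · intro j _
    have := hmoment (2 * k + 2) C (by positivity) j (fun hj => ⟨(hk' j hj).1,
      (le_C (C' := Ck) (by linarith) hφ0.le (hk' j hj).2).trans
        (mul_le_of_le_one_right (by linarith) (hφ1 n))⟩) (by omega)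
    have ev : ∀ u : ℝ, |u| ^ (2 * k + 2) = u ^ (2 * k + 2) := fun u =>
      Even.pow_abs ⟨k + 1, by ring⟩ u
    simpa only [ev] using this
  · intro i j _ _ hij
    by_cases hi : i ∈ Finset.Icc 1 n
    · by_cases hj : j ∈ Finset.Icc 1 n
      · refine le_trans ?_ (le_C (C' := Cj) (by linarith) (by positivity) (hj' i hi j hj hij).2)
        refine integral_mono_of_nonneg (ae_of_all _ fun _ => abs_nonneg _) (hj' i hi j hj hij).1.abs
          (ae_of_all _ fun ω => ?_)
        simp only [hyin i hi, hyin j hj, abs_mul]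
        exact mul_le_mul (abs_truncAt_le_abs _ _) (abs_truncAt_le_abs _ _) (abs_nonneg _)
          (abs_nonneg _)
      · simp only [hyout j hj, mul_zero, abs_zero, integral_zero]
        positivity
    · simp only [hyout i hi, zero_mul, abs_zero, integral_zero]
      positivity
  -- the parameters of the block decomposition
  set q : ℕ := ⌈(n : ℝ) ^ κ⌉₊ with hq
  have hnκ1 : 1 ≤ (n : ℝ) ^ κ := Real.one_le_rpow hn1 hκ.le
  have hq1 : (n : ℝ) ^ κ ≤ q := Nat.le_ceil _
  have hq2 : (q : ℝ) ≤ 2 * (n : ℝ) ^ κ := by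
    have := Nat.ceil_lt_add_one (by positivity : 0 ≤ (n : ℝ) ^ κ)
    linarith
  have hq0 : 0 < q := by
    have : (0 : ℝ) < q := by linarith
    exact_mod_cast this
  have hqn : q ≤ n := by
    have : (q : ℝ) ≤ n := hq2.trans h2κ
    exact_mod_cast this
  set l : ℝ := Real.sqrt (Real.log n) with hl
  have hlog1 : 1 ≤ Real.log n := by
    rw [Real.le_log_iff_exp_le hn0]
    exact (Real.exp_one_lt_d9.le.trans (by norm_num)).trans hnr
  have hl1 : 1 ≤ l := Real.one_le_sqrt.mpr hlog1
  have hl2 : l ^ 2 = Real.log n := Real.sq_sqrt (by linarith)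
  set D : ℝ := Real.sqrt (n * φ n) with hD
  have hD2 : D ^ 2 = n * φ n := Real.sq_sqrt (by positivity)
  have hDge : (n : ℝ) ^ ((1 - θ) / 2) ≤ D := by
    rw [hD]
    refine Real.le_sqrt_of_sq_le ?_
    rw [← Real.rpow_natCast, ← Real.rpow_mul hn0.le]
    calc (n : ℝ) ^ ((1 - θ) / 2 * (2 : ℕ)) = n * (n : ℝ) ^ (-θ) := by
          rw [show (1 - θ) / 2 * (2 : ℕ) = 1 + (-θ) by push_cast; ring, Real.rpow_add hn0,
            Real.rpow_one]
      _ ≤ n * φ n := mul_le_mul_of_nonneg_left hφθ hn0.le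
  have hd0 : 0 < (n : ℝ) ^ ((1 - θ) / 2) := Real.rpow_pos_of_pos hn0 _
  have hd1 : 1 ≤ (n : ℝ) ^ ((1 - θ) / 2) := Real.one_le_rpow hn1 (by linarith)
  have hD0 : 0 < D := hd0.trans_le hDge
  have htB : l / D * (q * (2 * M)) ≤ 1 := by
    rw [div_mul_eq_mul_div, div_le_one hD0]
    calc l * (q * (2 * M)) ≤ l * ((2 * (n : ℝ) ^ κ) * (2 * M)) := by gcongr
      _ = (4 * l * (n : ℝ) ^ (-τ)) * (n : ℝ) ^ ((1 - θ) / 2) := by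
          rw [← hκτ, Real.rpow_add hn0, show 2 * τ = τ + τ by ring, Real.rpow_add hn0, hM,
            Real.rpow_neg hn0.le]
          field_simp
          ring
      _ ≤ 1 * (n : ℝ) ^ ((1 - θ) / 2) := mul_le_mul_of_nonneg_right hlog hd0.le
      _ ≤ D := by rw [one_mul]; exact hDge
  have hyi : ∀ j, Integrable (y j) P := by
    intro j
    by_cases hj : j ∈ Finset.Icc 1 n
    · rw [hyin j hj]
      exact Integrable.of_bound ((measurable_truncAt M).comp
        (hZm j (Finset.mem_Icc.mp hj).1)).aestronglyMeasurable M
          (ae_of_all _ fun ω => abs_truncAt_le hM0.le _)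
    · rw [hyout j hj]; exact integrable_zero _ _ _
  have tail := measure_abs_sum_ge_le (P := P) hξ (z := fun j ω => y j ω - ∫ ω', y j ω' ∂P)
    (q := q) (n := n) (B := 2 * M) (v := 17 * c * x ^ 2) (t := l / D) (lam := Λ₀ * (D * l))
    hq0 hqn (by positivity) (by positivity) (by positivity) (by positivity) htB
    (fun j hj => (hym j hj).sub_const _)
    (fun j ω => (abs_sub _ _).trans (by linarith [hyM j ω, abs_integral_le_of_abs_le (P := P) (hyM j)]))
    (fun j => by rw [integral_sub (hyi j) (integrable_const _)]; simp)
    (fun j hj => by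
      have : j ∉ Finset.Icc 1 n := fun h => by
        have := (Finset.mem_Icc.mp h).2
        omega
      ext ω
      simp [hyout j this])
    var
  -- comparison with the truncated sum
  have hMm : (n : ℝ) ^ (3 : ℝ) ≤ M ^ m := by
    rw [hM, ← Real.rpow_natCast, ← Real.rpow_mul hn0.le]
    exact Real.rpow_le_rpow_of_exponent_le hn1 hmτ
  have hM1 : 1 ≤ M := Real.one_le_rpow hn1 hτ.le
  have hinv : n * ((M ^ m)⁻¹ * C) ≤ C * (n : ℝ) ^ (-2 : ℝ) := by
    have : (M ^ m)⁻¹ ≤ (n : ℝ) ^ (-3 : ℝ) := by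
      rw [Real.rpow_neg hn0.le]
      exact inv_anti₀ (by positivity) hMm
    calc n * ((M ^ m)⁻¹ * C) ≤ n * ((n : ℝ) ^ (-3 : ℝ) * C) := by gcongr
      _ = C * ((n : ℝ) ^ (1 : ℝ) * (n : ℝ) ^ (-3 : ℝ)) := by rw [Real.rpow_one]; ring
      _ = _ := by rw [← Real.rpow_add hn0]; norm_num
  have hpow2 : (n : ℝ) ^ (-2 : ℝ) ≤ 1 := Real.rpow_le_one_of_one_le_of_nonpos hn1 (by norm_num)
  have trunc := measure_abs_sum_sub_le_trunc (P := P) (Z := Z n) (n := n) (m := m) (M := M) (C := C)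
    (lam := Λ₀ * (D * l)) (r := C * (D * l)) hM0 hZm hZi
    (fun j hj => ⟨(hm' j hj).1, (le_C (C' := Cm) (by linarith) hφ0.le (hm' j hj).2).trans
        (mul_le_of_le_one_right (by linarith) (hφ1 n))⟩)
    (hinv.trans (by
      refine mul_le_mul_of_nonneg_left (hpow2.trans ?_) (by linarith)
      exact one_le_mul_of_one_le_of_one_le (hd1.trans hDge) hl1))
  have hset : {ω | Λ₀ * (D * l) ≤ |∑ j ∈ Finset.Icc 1 n,
      (truncAt M (Z n j ω) - ∫ ω', truncAt M (Z n j ω') ∂P)|} =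
      {ω | Λ₀ * (D * l) ≤ |∑ j ∈ Finset.Icc 1 n, (y j ω - ∫ ω', y j ω' ∂P)|} := by
    ext ω
    simp only [Set.mem_ofPred_eq]
    rw [Finset.sum_congr rfl fun j hj => by rw [← hyin j hj]]
    rw [Finset.sum_congr rfl fun j hj => by rw [← congrFun (hyin j hj) ω]]
  rw [hset, ← add_mul] at trunc
  refine trunc.trans (add_le_add (tail.trans ?_) ?_)
  · refine mul_le_mul_of_nonneg_left (add_le_add ?_ ?_) (by norm_num)
    · have e1 : -(l / D * (Λ₀ * (D * l)) / 4) + (l / D) ^ 2 * (2 * n * (17 * c * x ^ 2)) =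
          Real.log n * (-2) := by
        rw [hx2, div_pow, hD2, ← hl2, hΛ₀]
        field_simp
        ring
      rw [e1, Real.rpow_def_of_pos hn0]
    · have hqa : mixingCoeff P ξ q ≤ Cα * (n : ℝ) ^ (-(κ * a)) := by
        refine (hα q hq0).trans (mul_le_mul_of_nonneg_left ?_ hCα)
        rw [← mul_neg, Real.rpow_mul hn0.le]
        exact Real.rpow_le_rpow_of_nonpos (by positivity) hq1 (by linarith)
      have hlam : (n : ℝ) ^ ((1 - θ) / 2) ≤ Λ₀ * (D * l) := by
        calc (n : ℝ) ^ ((1 - θ) / 2) ≤ D := hDge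
          _ ≤ D * l := le_mul_of_one_le_right hD0.le hl1
          _ ≤ Λ₀ * (D * l) := le_mul_of_one_le_left (by positivity) hΛ1
      calc 32 * n * (2 * M) * mixingCoeff P ξ q / (Λ₀ * (D * l))
          ≤ 32 * n * (2 * M) * (Cα * (n : ℝ) ^ (-(κ * a))) / (n : ℝ) ^ ((1 - θ) / 2) := by
            gcongr
        _ = 64 * Cα * ((n : ℝ) ^ (1 : ℝ) * (n : ℝ) ^ τ * (n : ℝ) ^ (-(κ * a)) *
              (n : ℝ) ^ (-((1 - θ) / 2))) := by
            rw [Real.rpow_neg hn0.le ((1 - θ) / 2), Real.rpow_one, hM]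
            field_simp
            ring
        _ = 64 * Cα * (n : ℝ) ^ e := by
            rw [← Real.rpow_add hn0, ← Real.rpow_add hn0, ← Real.rpow_add hn0, he]
            congr 2
  · refine le_trans ?_ hinv
    have : (M ^ (m + 1))⁻¹ ≤ (M ^ m)⁻¹ := inv_anti₀ (by positivity)
      (pow_le_pow_right₀ hM1 (Nat.le_succ m))
    gcongr

end Concentration

/-! ### The kernel: step approximation and the layer-cake formula. -/

section Kernel

/-- By uniform continuity and summation by parts on a grid. The steps are indicators of intervals
starting at 0, so that composing with `dist / h` turns a kernel average into a combination of
averages over concentric balls. -/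
theorem exists_step_approx {K : ℝ → ℝ} (hK : ContinuousOn K (Set.Icc 0 1)) {η : ℝ} (hη : 0 < η) :
    ∃ (N : ℕ) (c t : ℕ → ℝ), (∀ k < N, 0 < t k ∧ t k ≤ 1) ∧ ∀ u ∈ Set.Icc (0 : ℝ) 1,
      |K u - ∑ k ∈ Finset.range N, c k * (if u ≤ t k then 1 else 0)| ≤ η := by
  have huc := isCompact_Icc.uniformContinuousOn_of_continuous hK
  rw [Metric.uniformContinuousOn_iff] at huc
  obtain ⟨δ, hδ, hK'⟩ := huc η hη
  obtain ⟨N, hN⟩ := exists_nat_gt (1 / δ)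
  have hNr : (0 : ℝ) < N := (by positivity : (0 : ℝ) < 1 / δ).trans hN
  have hN0 : 0 < N := by exact_mod_cast hNr
  have hNδ : 1 / (N : ℝ) < δ := by
    rw [div_lt_iff₀ hNr]
    rw [div_lt_iff₀ hδ] at hN
    linarith
  -- The value 0 past the index `N` makes the telescoping sum end in a value of `K` alone.
  set f : ℕ → ℝ := fun j => if j ≤ N then K (j / N) else 0 with hf
  refine ⟨N, fun k => f (k + 1) - f (k + 2), fun k => (k + 1 : ℕ) / N, ?_, ?_⟩
  · intro k hk
    refine ⟨by positivity, ?_⟩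
    rw [div_le_one hNr]
    exact_mod_cast hk
  · intro u hu
    -- The grid cell of `u`; the truncated subtraction puts `u = 0` into cell 0.
    set κ : ℕ := ⌈u * N⌉₊ - 1 with hκ
    have huN : u * N ≤ N := by nlinarith [hu.2]
    have huN0 : 0 ≤ u * N := mul_nonneg hu.1 hNr.le
    have hceil : ⌈u * N⌉₊ ≤ N := Nat.ceil_le.mpr huN
    have hκN : κ + 1 ≤ N := by omega
    have hiff : ∀ k : ℕ, u ≤ (k + 1 : ℕ) / N ↔ κ ≤ k := by
      intro k
      rw [le_div_iff₀ hNr, ← Nat.ceil_le]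
      omega
    have hsum : ∑ k ∈ Finset.range N, (f (k + 1) - f (k + 2)) *
        (if u ≤ (k + 1 : ℕ) / N then (1 : ℝ) else 0) = f (κ + 1) - f (N + 1) := by
      have h1 : ∀ k ∈ Finset.range N, (f (k + 1) - f (k + 2)) *
          (if u ≤ (k + 1 : ℕ) / N then (1 : ℝ) else 0) =
          if κ ≤ k then f (k + 1) - f (k + 2) else 0 := by
        intro k _
        rw [if_congr (hiff k) rfl rfl]
        split_ifs <;> simp
      rw [Finset.sum_congr rfl h1, ← Finset.sum_filter]
      have h2 : (Finset.range N).filter (fun k => κ ≤ k) = Finset.Ico κ N := by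
        ext k
        simp only [Finset.mem_filter, Finset.mem_range, Finset.mem_Ico]
        omega
      rw [h2, Finset.sum_Ico_eq_sub _ (by omega : κ ≤ N),
        Finset.sum_range_sub' (fun k => f (k + 1)), Finset.sum_range_sub' (fun k => f (k + 1))]
      ring
    rw [hsum]
    have hf1 : f (κ + 1) = K ((κ + 1 : ℕ) / N) := by simp only [hf, if_pos hκN]
    have hf2 : f (N + 1) = 0 := by simp [hf]
    rw [hf1, hf2, sub_zero]
    have hmem : ((κ + 1 : ℕ) : ℝ) / N ∈ Set.Icc (0 : ℝ) 1 := by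
      refine ⟨by positivity, ?_⟩
      rw [div_le_one hNr]
      exact_mod_cast hκN
    have hdist : dist u ((κ + 1 : ℕ) / N) < δ := by
      refine lt_of_le_of_lt ?_ hNδ
      have hle : u ≤ (κ + 1 : ℕ) / N := (hiff κ).mpr le_rfl
      rw [Real.dist_eq, abs_of_nonpos (by linarith), neg_sub, sub_le_iff_le_add, ← sub_le_iff_le_add',
        ← sub_div, div_le_iff₀ hNr]
      rcases Nat.eq_zero_or_pos ⌈u * N⌉₊ with h0 | h0
      · have : κ = 0 := by omega
        simp [this, huN0]
      · have h3 : (κ + 1 : ℕ) = ⌈u * N⌉₊ := by omega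
        rw [h3]
        have := Nat.ceil_lt_add_one huN0
        linarith
    have := hK' u hu _ hmem hdist
    rw [Real.dist_eq] at this
    exact this.le

variable {Ω : Type*} [MeasurableSpace Ω] {P : Measure Ω} [IsProbabilityMeasure P]

/-- The layer-cake formula `∫₀^ε P(z ≤ U ≤ ε) G'(z) dz = E[G(U); U ≤ ε]`. -/
theorem integral_tail_mul_unitDeriv {U : Ω → ℝ} (hU : Measurable U) (hU0 : ∀ ω, 0 ≤ U ω)
    {G : ℝ → ℝ} (hG : DifferentiableOn ℝ G (Set.Icc 0 1)) (hG0 : G 0 = 0) {ε : ℝ} (hε0 : 0 < ε)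
    (hε1 : ε < 1)
    (hint : IntervalIntegrable (fun z => P.real {ω | z ≤ U ω ∧ U ω ≤ ε} * unitDeriv G z)
      volume 0 ε) :
    ∫ z in (0 : ℝ)..ε, P.real {ω | z ≤ U ω ∧ U ω ≤ ε} * unitDeriv G z =
      ∫ ω, (if U ω ≤ ε then G (U ω) else 0) ∂P := by
  set μ : Measure ℝ := volume.restrict (Set.Ioc 0 ε) with hμ
  -- As `ε < 1`, the points of `(0, ε]` are interior to `[0, 1]`, and the one-sided derivative may
  -- be replaced by `deriv`, which is measurable.
  have hderiv : ∀ z ∈ Set.Ioc (0 : ℝ) ε, unitDeriv G z = deriv G z := by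
    intro z hz
    exact derivWithin_of_mem_nhds (Icc_mem_nhds hz.1 (hz.2.trans_lt hε1))
  have hms : ∀ z, MeasurableSet {ω | z ≤ U ω ∧ U ω ≤ ε} := fun z =>
    (hU measurableSet_Ici).inter (hU measurableSet_Iic)
  set H : ℝ × Ω → ℝ := fun p => if p.1 ≤ U p.2 ∧ U p.2 ≤ ε then deriv G p.1 else 0 with hH
  have hHm : Measurable H := by
    refine Measurable.ite ?_ ((measurable_deriv G).comp measurable_fst) measurable_const
    exact (measurableSet_le measurable_fst (hU.comp measurable_snd)).inter
      (measurableSet_le (hU.comp measurable_snd) measurable_const)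
  have hHz : ∀ (f : ℝ → ℝ) z, ∫ ω, (if z ≤ U ω ∧ U ω ≤ ε then f z else 0) ∂P =
      P.real {ω | z ≤ U ω ∧ U ω ≤ ε} * f z := by
    intro f z
    have : (fun ω => if z ≤ U ω ∧ U ω ≤ ε then f z else 0) =
        {ω | z ≤ U ω ∧ U ω ≤ ε}.indicator fun _ => f z := by
      ext ω
      simp [Set.indicator_apply]
    rw [this, integral_indicator_const _ (hms z), smul_eq_mul]
  have hf : Integrable (fun z => P.real {ω | z ≤ U ω ∧ U ω ≤ ε} * deriv G z) μ := by
    have h1 := (intervalIntegrable_iff_integrableOn_Ioc_of_le hε0.le).mp hint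
    refine (integrable_congr ?_).mp h1
    filter_upwards [ae_restrict_mem measurableSet_Ioc] with z hz
    rw [hderiv z hz]
  have hHi : Integrable H (μ.prod P) := by
    rw [integrable_prod_iff hHm.aestronglyMeasurable]
    refine ⟨ae_of_all _ fun z => ?_, ?_⟩
    · have : (fun ω => H (z, ω)) = {ω | z ≤ U ω ∧ U ω ≤ ε}.indicator fun _ => deriv G z := by
        ext ω
        simp [hH, Set.indicator_apply]
      rw [this]
      exact (integrable_const _).indicator (hms z)
    · have : (fun z => ∫ ω, ‖H (z, ω)‖ ∂P) =
          fun z => ‖P.real {ω | z ≤ U ω ∧ U ω ≤ ε} * deriv G z‖ := by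
        ext z
        rw [norm_mul, Real.norm_of_nonneg measureReal_nonneg, ← hHz (fun z => ‖deriv G z‖)]
        congr 1
        ext ω
        simp only [hH]
        split_ifs <;> simp
      rw [this]
      exact hf.norm
  have swap := integral_integral_swap (f := fun z ω => H (z, ω)) hHi
  have lhs : ∫ z in (0 : ℝ)..ε, P.real {ω | z ≤ U ω ∧ U ω ≤ ε} * unitDeriv G z =
      ∫ z, ∫ ω, H (z, ω) ∂P ∂μ := by
    rw [intervalIntegral.integral_of_le hε0.le]
    refine setIntegral_congr_fun measurableSet_Ioc fun z hz => ?_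
    simp only [hH]
    rw [hHz (deriv G), hderiv z hz]
  rw [lhs, swap]
  refine integral_congr_ae ?_
  -- The derivative is not assumed integrable. Fubini yields its integrability on `(0, U ω]` for
  -- almost every relevant `ω`, which is what the fundamental theorem of calculus needs.
  have hae : ∀ᵐ ω ∂P, Integrable (fun z => H (z, ω)) μ := hHi.prod_left_ae
  filter_upwards [hae] with ω hω
  split_ifs with hUε
  · have e1 : ∀ z, H (z, ω) = (Set.Iic (U ω)).indicator (deriv G) z := by
      intro z
      simp only [hH, Set.indicator_apply, Set.mem_Iic, hUε, and_true]
    simp only [e1] at hω ⊢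
    rw [integral_indicator measurableSet_Iic, hμ, Measure.restrict_restrict measurableSet_Iic]
    have e2 : Set.Iic (U ω) ∩ Set.Ioc 0 ε = Set.Ioc 0 (U ω) := by
      ext z
      simp only [Set.mem_inter_iff, Set.mem_Iic, Set.mem_Ioc]
      constructor
      · rintro ⟨a, b, c⟩; exact ⟨b, a⟩
      · rintro ⟨a, b⟩; exact ⟨b, a, b.trans hUε⟩
    rw [integrable_indicator_iff measurableSet_Iic, IntegrableOn, hμ,
      Measure.restrict_restrict measurableSet_Iic, e2] at hω
    rw [e2, ← intervalIntegral.integral_of_le (hU0 ω),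
      intervalIntegral.integral_eq_sub_of_hasDerivAt_of_le (hU0 ω)
        (f := G) (hG.continuousOn.mono (Set.Icc_subset_Icc_right (hUε.trans hε1.le)))
        (fun z hz => ?_) ((intervalIntegrable_iff_integrableOn_Ioc_of_le (hU0 ω)).mpr hω), hG0,
      sub_zero]
    exact (hG.differentiableAt (Icc_mem_nhds hz.1
      (hz.2.trans_le (hUε.trans hε1.le)))).hasDerivAt
  · have e1 : ∀ z, H (z, ω) = 0 := by
      intro z
      simp only [hH, hUε, and_false, if_false]
    simp [e1]

theorem kernel_eq_zero {K : ℝ → ℝ} (hK : ∀ u, 0 ≤ K u) (htype : KernelTypeI K ∨ KernelTypeII K)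
    {u : ℝ} (hu : u ∉ Set.Icc (0 : ℝ) 1) : K u = 0 := by
  rcases htype with ⟨c, C, -, -, h⟩ | ⟨-, h, -⟩
  · have := (h u).2
    rw [Set.indicator_of_notMem hu] at this
    exact le_antisymm this (hK u)
  · by_contra hne
    have : u ∈ Function.support K := hne
    rw [h] at this
    exact hu ⟨this.1, this.2.le⟩

theorem measurable_kernel {K : ℝ → ℝ} (hK : ContinuousOn K (Set.Icc 0 1))
    (h0 : ∀ u, u ∉ Set.Icc (0 : ℝ) 1 → K u = 0) : Measurable K := by
  have h1 : Measurable ((Set.Icc (0 : ℝ) 1).piecewise K fun _ => 0) :=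
    hK.measurable_piecewise continuousOn_const measurableSet_Icc
  convert h1 using 1
  ext u
  by_cases hu : u ∈ Set.Icc (0 : ℝ) 1
  · rw [Set.piecewise_eq_of_mem _ _ _ hu]
  · rw [Set.piecewise_eq_of_notMem _ _ _ hu, h0 u hu]

theorem exists_kernel_bound {K : ℝ → ℝ} (hK : ContinuousOn K (Set.Icc 0 1))
    (h0 : ∀ u, u ∉ Set.Icc (0 : ℝ) 1 → K u = 0) : ∃ C : ℝ, 0 < C ∧ ∀ u, |K u| ≤ C := by
  obtain ⟨C, hC⟩ := isCompact_Icc.exists_bound_of_continuousOn hK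
  refine ⟨|C| + 1, by positivity, fun u => ?_⟩
  by_cases hu : u ∈ Set.Icc (0 : ℝ) 1
  · exact (hC u hu).trans ((le_abs_self C).trans (by linarith))
  · rw [h0 u hu, abs_zero]; positivity

end Kernel

/-! ### Deterministic inequalities for sums and ratios. -/

section Sums

/-- If the products of distant terms are small, then all but a few terms are small. -/
theorem sum_le_of_distant_mul_le {b : ℕ → ℝ} {n L : ℕ} {s M : ℝ} (hs : 0 ≤ s) (hM : 0 ≤ M)
    (hbM : ∀ i ∈ Finset.Icc 1 n, b i ≤ M)
    (h : ∀ i ∈ Finset.Icc 1 n, ∀ j ∈ Finset.Icc 1 n, L < Nat.dist i j → b i * b j ≤ s ^ 2) :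
    ∑ i ∈ Finset.Icc 1 n, b i ≤ n * s + (2 * L + 1) * M := by
  by_cases hall : ∀ i ∈ Finset.Icc 1 n, b i ≤ s
  · calc ∑ i ∈ Finset.Icc 1 n, b i ≤ ∑ i ∈ Finset.Icc 1 n, s := Finset.sum_le_sum hall
      _ = n * s := by simp
      _ ≤ _ := by
        have : 0 ≤ (2 * L + 1) * M := by positivity
        linarith
  · push Not at hall
    -- One term above `s` forces every term at distance more than `L` from it to be at most `s`;
    -- only `2 L + 1` indices remain uncontrolled.
    obtain ⟨i₀, hi₀, hlarge⟩ := hall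
    have hle : ∀ j ∈ Finset.Icc 1 n, b j ≤ s + if j ∈ Finset.Icc (i₀ - L) (i₀ + L) then M else 0 := by
      intro j hj
      split_ifs with hnear
      · linarith [hbM j hj]
      · rw [add_zero]
        by_contra hcon
        push Not at hcon
        have := h i₀ hi₀ j hj (by
          simp only [Finset.mem_Icc] at hnear
          simp only [Nat.dist]
          omega)
        nlinarith
    calc ∑ i ∈ Finset.Icc 1 n, b i
        ≤ ∑ j ∈ Finset.Icc 1 n, (s + if j ∈ Finset.Icc (i₀ - L) (i₀ + L) then M else 0) :=
          Finset.sum_le_sum hle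
      _ = n * s + ∑ j ∈ Finset.Icc 1 n, if j ∈ Finset.Icc (i₀ - L) (i₀ + L) then M else 0 := by
          rw [Finset.sum_add_distrib]; simp
      _ ≤ _ := by
          refine add_le_add le_rfl ?_
          rw [← Finset.sum_filter, Finset.sum_const, nsmul_eq_mul]
          refine mul_le_mul_of_nonneg_right ?_ hM
          have h1 : ((Finset.Icc 1 n).filter fun j => j ∈ Finset.Icc (i₀ - L) (i₀ + L)).card ≤
              (Finset.Icc (i₀ - L) (i₀ + L)).card :=
            Finset.card_le_card fun j hj => (Finset.mem_filter.mp hj).2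
          rw [Nat.card_Icc] at h1
          have h2 : ((Finset.Icc 1 n).filter fun j => j ∈ Finset.Icc (i₀ - L) (i₀ + L)).card ≤
              2 * L + 1 := by omega
          exact_mod_cast h2

theorem abs_mul_sub_mul_le {p q p' q' C L r : ℝ} (hL : 0 ≤ L) (hr0 : 0 ≤ r) (hr1 : r ≤ 1)
    (hp' : |p'| ≤ C) (hq' : |q'| ≤ C) (hp : |p - p'| ≤ L * r) (hq : |q - q'| ≤ L * r) :
    |p * q - p' * q'| ≤ (2 * C * L + L ^ 2) * r := by
  have hC : 0 ≤ C := (abs_nonneg _).trans hp'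
  have e1 : p * q - p' * q' = (p - p') * q' + p' * (q - q') + (p - p') * (q - q') := by ring
  have hLr : 0 ≤ L * r := mul_nonneg hL hr0
  have i1 : |(p - p') * q'| ≤ L * r * C := by
    rw [abs_mul]; exact mul_le_mul hp hq' (abs_nonneg _) hLr
  have i2 : |p' * (q - q')| ≤ C * (L * r) := by
    rw [abs_mul]; exact mul_le_mul hp' hq (abs_nonneg _) hC
  have i3 : |(p - p') * (q - q')| ≤ L * r * (L * r) := by
    rw [abs_mul]; exact mul_le_mul hp hq (abs_nonneg _) hLr
  have i4 : L * r * (L * r) ≤ L ^ 2 * r := by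
    calc L * r * (L * r) = L ^ 2 * r * r := by ring
      _ ≤ L ^ 2 * r * 1 := mul_le_mul_of_nonneg_left hr1 (by positivity)
      _ = L ^ 2 * r := mul_one _
  rw [e1]
  refine (abs_add_le _ _).trans ((add_le_add (abs_add_le _ _) le_rfl).trans ?_)
  linarith

/-- Stability of the ratio that defines the local linear estimator. -/
theorem abs_ratio_sub_ratio_le {a b e u v a' b' e' u' v' C L d r : ℝ} (hL : 0 ≤ L)
    (hd : 0 < d) (hr0 : 0 ≤ r) (hr1 : r ≤ 1) (ha' : |a'| ≤ C) (hb' : |b'| ≤ C) (he' : |e'| ≤ C)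
    (hu' : |u'| ≤ C) (hv' : |v'| ≤ C) (ha : |a - a'| ≤ L * r) (hb : |b - b'| ≤ L * r)
    (he : |e - e'| ≤ L * r) (hu : |u - u'| ≤ L * r) (hv : |v - v'| ≤ L * r)
    (hdet : d ≤ a' * b' - e' ^ 2) (hr : 2 * (2 * C * L + L ^ 2) * r ≤ d / 2) :
    0 < a * b - e ^ 2 ∧
    |(a * u - e * v) / (a * b - e ^ 2) - (a' * u' - e' * v') / (a' * b' - e' ^ 2)| ≤
      2 * (2 * C * L + L ^ 2) * (2 / d + 4 * C ^ 2 / d ^ 2) * r := by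
  have hC : 0 ≤ C := (abs_nonneg _).trans ha'
  set A := 2 * C * L + L ^ 2 with hA
  have hA0 : 0 ≤ A := by positivity
  have hn : |(a * u - e * v) - (a' * u' - e' * v')| ≤ 2 * A * r := by
    have j1 := abs_mul_sub_mul_le hL hr0 hr1 ha' hu' ha hu
    have j2 := abs_mul_sub_mul_le hL hr0 hr1 he' hv' he hv
    rw [show (a * u - e * v) - (a' * u' - e' * v') = (a * u - a' * u') - (e * v - e' * v') by ring]
    refine (abs_sub _ _).trans ((add_le_add j1 j2).trans (le_of_eq ?_))
    rw [hA]; ring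
  have hdd : |(a * b - e ^ 2) - (a' * b' - e' ^ 2)| ≤ 2 * A * r := by
    have j1 := abs_mul_sub_mul_le hL hr0 hr1 ha' hb' ha hb
    have j2 := abs_mul_sub_mul_le hL hr0 hr1 he' he' he he
    rw [show (a * b - e ^ 2) - (a' * b' - e' ^ 2) = (a * b - a' * b') - (e * e - e' * e') by ring]
    refine (abs_sub _ _).trans ((add_le_add j1 j2).trans (le_of_eq ?_))
    rw [hA]; ring
  have hn0 : |a' * u' - e' * v'| ≤ 2 * C ^ 2 := by
    have j1 : |a' * u'| ≤ C * C := by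
      rw [abs_mul]; exact mul_le_mul ha' hu' (abs_nonneg _) hC
    have j2 : |e' * v'| ≤ C * C := by
      rw [abs_mul]; exact mul_le_mul he' hv' (abs_nonneg _) hC
    refine (abs_sub _ _).trans ((add_le_add j1 j2).trans (le_of_eq ?_))
    ring
  clear_value A
  generalize a * u - e * v = n₁ at *
  generalize a' * u' - e' * v' = n₀ at *
  generalize a * b - e ^ 2 = d₁ at *
  generalize a' * b' - e' ^ 2 = d₀ at *
  -- The smallness condition on `r` serves to keep the perturbed denominator above `d / 2`.
  have hd₁' : d / 2 ≤ d₁ := by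
    have := (abs_le.mp hdd).1
    linarith
  have hd₁0 : 0 < d₁ := by linarith
  have hd₀0 : 0 < d₀ := by linarith
  refine ⟨hd₁0, ?_⟩
  have e2 : n₁ / d₁ - n₀ / d₀ = (n₁ - n₀) / d₁ - n₀ * (d₁ - d₀) / (d₁ * d₀) := by
    field_simp
    ring
  have hAr : 0 ≤ 2 * A * r := by positivity
  have k1 : |(n₁ - n₀) / d₁| ≤ 2 * A * r * (2 / d) := by
    rw [abs_div, abs_of_pos hd₁0, div_le_iff₀ hd₁0]
    refine hn.trans ?_
    have : 1 ≤ 2 / d * d₁ := by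
      rw [div_mul_eq_mul_div, le_div_iff₀ hd]; linarith
    nlinarith
  have k2 : |n₀ * (d₁ - d₀) / (d₁ * d₀)| ≤ 2 * A * r * (4 * C ^ 2 / d ^ 2) := by
    rw [abs_div, abs_of_pos (mul_pos hd₁0 hd₀0), div_le_iff₀ (mul_pos hd₁0 hd₀0), abs_mul]
    have m1 : |n₀| * |d₁ - d₀| ≤ 2 * C ^ 2 * (2 * A * r) :=
      mul_le_mul hn0 hdd (abs_nonneg _) (by positivity)
    have m2 : d ^ 2 / 2 ≤ d₁ * d₀ := by
      have := mul_le_mul hd₁' hdet hd.le hd₁0.le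
      nlinarith
    refine m1.trans ?_
    calc 2 * C ^ 2 * (2 * A * r) = 2 * A * r * (4 * C ^ 2 / d ^ 2) * (d ^ 2 / 2) := by
          field_simp
          ring
      _ ≤ _ := mul_le_mul_of_nonneg_left m2 (by positivity)
  rw [e2]
  refine (abs_sub _ _).trans ?_
  calc _ ≤ 2 * A * r * (2 / d) + 2 * A * r * (4 * C ^ 2 / d ^ 2) := add_le_add k1 k2
    _ = _ := by ring

end Sums

/-! ### Normalized kernel weights. -/

section LocalWeights

variable {Ω F : Type*} [PseudoMetricSpace F] {Y : ℕ → Ω → ℝ} {X : ℕ → Ω → F} {β : F → F → ℝ}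
  {K : ℝ → ℝ} {x : F}

/-- The event that `X i` lies in the closed ball of radius `r` around `x`. -/
def near (X : ℕ → Ω → F) (x : F) (i : ℕ) (r : ℝ) : Set Ω := {ω | dist (X i ω) x ≤ r}

/-- The normalized kernel weight `(β(X j, x) / r) ^ l * K(d(X j, x) / r)`. -/
noncomputable def localTerm (X : ℕ → Ω → F) (β : F → F → ℝ) (K : ℝ → ℝ) (x : F) (r : ℝ) (l j : ℕ)
    (ω : Ω) : ℝ :=
  (β (X j ω) x / r) ^ l * K (dist (X j ω) x / r)

variable [MeasurableSpace F]

theorem measurable_local (hβ : Measurable fun u => β u x) (hK : Measurable K) [BorelSpace F]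
    (r : ℝ) (l : ℕ) : Measurable fun u => (β u x / r) ^ l * K (dist u x / r) :=
  ((hβ.div_const r).pow_const l).mul
    (hK.comp ((continuous_id.dist continuous_const).measurable.div_const r))

theorem measurable_localTerm (hβ : Measurable fun u => β u x) (hK : Measurable K) [BorelSpace F]
    (r : ℝ) (l j : ℕ) :
    Measurable[MeasurableSpace.comap (fun ω => (Y j ω, X j ω)) inferInstance]
      (localTerm X β K x r l j) :=
  (measurable_local hβ hK r l).comp (measurable_snd.comp (comap_measurable _))

/-- The weights are bounded and vanish off the ball. -/
theorem exists_localTerm_bound (hβ : LocatingFunction β x) (hK : ContinuousOn K (Set.Icc 0 1))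
    (h0 : ∀ u, u ∉ Set.Icc (0 : ℝ) 1 → K u = 0) : ∃ B : ℝ, 1 ≤ B ∧ ∀ (r : ℝ) (l j : ℕ) (ω : Ω),
      0 < r → l ≤ 2 → |localTerm X β K x r l j ω| ≤ (near X x j r).indicator (fun _ => B) ω := by
  obtain ⟨CK, hCK, hKb⟩ := exists_kernel_bound hK h0
  obtain ⟨c, C, hc, hcC, hβb⟩ := hβ.comparable
  refine ⟨1 + (1 + C) ^ 2 * CK, by
    have : 0 ≤ (1 + C) ^ 2 * CK := by positivity
    linarith, fun r l j ω hr hl => ?_⟩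
  by_cases hω : ω ∈ near X x j r
  · rw [Set.indicator_of_mem hω, localTerm, abs_mul, abs_pow]
    -- The bound `C` is enlarged to `1 + C ≥ 1` so that the square dominates every power `l ≤ 2`.
    have h1 : |β (X j ω) x / r| ≤ 1 + C := by
      rw [abs_div, abs_of_pos hr, div_le_iff₀ hr]
      have h2 := (hβb (X j ω)).2
      have h3 : dist (X j ω) x ≤ r := hω
      nlinarith
    have h4 : |β (X j ω) x / r| ^ l ≤ (1 + C) ^ 2 :=
      (pow_le_pow_left₀ (abs_nonneg _) h1 l).trans (pow_le_pow_right₀ (by linarith) hl)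
    have := mul_le_mul h4 (hKb (dist (X j ω) x / r)) (abs_nonneg _) (by positivity)
    linarith
  · rw [Set.indicator_of_notMem hω, localTerm, h0, mul_zero, abs_zero]
    rintro ⟨-, h2⟩
    exact hω (by rwa [div_le_one hr] at h2)

end LocalWeights

/-! ### Small-ball probabilities. -/

section SmallBallProbabilities

variable {Ω F : Type*} [MeasurableSpace Ω] [PseudoMetricSpace F] {P : Measure Ω} {X : ℕ → Ω → F}
  {x : F}

theorem ballProb_eq (i : ℕ) (r : ℝ) : ballProb P X x i 0 r = P.real (near X x i r) := by
  unfold ballProb near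
  congr 1
  ext ω
  simp [dist_comm]

theorem jointBallProb_eq (i j : ℕ) (r : ℝ) :
    jointBallProb P X x i j 0 r 0 r = P.real (near X x i r ∩ near X x j r) := by
  unfold jointBallProb near
  congr 1
  ext ω
  simp [dist_comm]

theorem ballProb_le_maxBallProb {n i : ℕ} (hi : i ∈ Finset.Icc 1 n) (r : ℝ) :
    ballProb P X x i 0 r ≤ maxBallProb P X x n r :=
  le_csSup ((Set.finite_Icc 1 n).image _).bddAbove ⟨i, by simpa using hi, rfl⟩

theorem maxBallProb_nonneg (n : ℕ) (r : ℝ) : 0 ≤ maxBallProb P X x n r :=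
  Real.sSup_nonneg (by rintro _ ⟨i, -, rfl⟩; exact measureReal_nonneg)

theorem maxBallProb_le_one [IsProbabilityMeasure P] (n : ℕ) (r : ℝ) :
    maxBallProb P X x n r ≤ 1 :=
  Real.sSup_le (by rintro _ ⟨i, -, rfl⟩; exact measureReal_le_one) zero_le_one

theorem maxBallProb_le_mul {n : ℕ} {r C : ℝ} {i : ℕ} (hi : i ∈ Finset.Icc 1 n)
    (hC : ∀ s ∈ Finset.Icc 1 n, ballProb P X x s 0 r ≤ C * ballProb P X x i 0 r) :
    maxBallProb P X x n r ≤ C * ballProb P X x i 0 r := by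
  refine csSup_le ⟨_, ⟨i, by simpa using hi, rfl⟩⟩ ?_
  rintro _ ⟨s, hs, rfl⟩
  exact hC s (by simpa using hs)

/-- As `p₁ > 1/4`, the exponent exceeds `3/4` on a product that is at most `f² ≤ 1`, which leaves `f
^ (3/2)`. This is the short-lag input of the variance bound. -/
theorem JointBallBounds.exists_joint_bound [IsProbabilityMeasure P] {h : ℕ → ℝ}
    {p₁ p₂ : ℕ → ℕ → ℕ → ℝ}
    (hjoint : JointBallBounds P X x h p₁ p₂) :
    ∃ C : ℝ, 0 < C ∧ ∀ᶠ n in atTop, ∀ i ∈ Finset.Icc 1 n, ∀ j ∈ Finset.Icc 1 n, i ≠ j →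
      P.real (near X x i (h n) ∩ near X x j (h n)) ≤
        C * Real.sqrt (maxBallProb P X x n (h n)) ^ 3 := by
  obtain ⟨c, C, hc, hC, hev⟩ := hjoint
  refine ⟨C, hC, ?_⟩
  filter_upwards [hev] with n hn i hi j hj hij
  obtain ⟨hp, -, -, -, -, hle⟩ := hn i hi j hj hij
  rw [jointBallProb_eq] at hle
  refine hle.trans (mul_le_mul_of_nonneg_left ?_ hC.le)
  set f := maxBallProb P X x n (h n) with hf
  have f0 : 0 ≤ f := maxBallProb_nonneg _ _
  have f1 : f ≤ 1 := maxBallProb_le_one _ _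
  have b1 : ballProb P X x i 0 (h n) * ballProb P X x j 0 (h n) ≤ f ^ 2 := by
    rw [sq]
    exact mul_le_mul (ballProb_le_maxBallProb hi _) (ballProb_le_maxBallProb hj _)
      measureReal_nonneg f0
  have b0 : 0 ≤ ballProb P X x i 0 (h n) * ballProb P X x j 0 (h n) :=
    mul_nonneg measureReal_nonneg measureReal_nonneg
  calc (ballProb P X x i 0 (h n) * ballProb P X x j 0 (h n)) ^ (1 / 2 + p₁ n i j)
      ≤ (f ^ 2) ^ (1 / 2 + p₁ n i j) := Real.rpow_le_rpow b0 b1 (by linarith)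
    _ ≤ (f ^ 2) ^ (3 / 4 : ℝ) := by
        rcases f0.eq_or_lt with hz | hz
        · rw [← hz]
          simp only [ne_eq, OfNat.ofNat_ne_zero, not_false_eq_true, zero_pow]
          rw [Real.zero_rpow (by linarith), Real.zero_rpow (by norm_num)]
        · exact Real.rpow_le_rpow_of_exponent_ge (by positivity) (pow_le_one₀ f0 f1) (by linarith)
    _ = Real.sqrt f ^ 3 := by
        rw [Real.sqrt_eq_rpow, ← Real.rpow_natCast, ← Real.rpow_natCast, ← Real.rpow_mul f0,
          ← Real.rpow_mul f0]
        norm_num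

end SmallBallProbabilities

/-! ### Mixing exponents and conditional moments in the regression model. -/

section Model

variable {Ω F : Type*} [MeasurableSpace Ω] [PseudoMetricSpace F] [MeasurableSpace F]
  {P : Measure Ω} {X : ℕ → Ω → F} {Y : ℕ → Ω → ℝ} {φ : ℝ → ℝ} {m : F → ℝ} {β : F → F → ℝ}
  {K : ℝ → ℝ} {h : ℕ → ℝ} {x : F}

theorem measurableSet_near [BorelSpace F] {i : ℕ} (hX : Measurable (X i)) (r : ℝ) :
    MeasurableSet (near X x i r) :=
  hX (Metric.isClosed_closedBall (x := x) (ε := r)).measurableSet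

/-- The parameters of the mixing condition in the form used for the tail bounds. -/
theorem ArithmeticMixing.exists_exponents [IsProbabilityMeasure P]
    (hmix : ArithmeticMixing P X Y x h) :
    ∃ a Cα θ : ℝ, 3 < a ∧
      (∀ n : ℕ, 1 ≤ n → mixingCoeff P (fun i ω => (Y i ω, X i ω)) n ≤ Cα * (n : ℝ) ^ (-a)) ∧
      0 ≤ θ ∧ 2 < (a + 1) * (1 - θ) / 2 ∧ 2 * θ < 1 ∧
      ∀ᶠ n : ℕ in atTop, (n : ℝ) ^ (-θ) ≤ maxBallProb P X x n (h n) := by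
  obtain ⟨a, δ, C, Δ, hδ, ha, hα, hΔ, hΔ', hφ⟩ := hmix
  have hΔ1 := hΔ'.trans_le (min_le_left _ _)
  have hΔ2 := hΔ'.trans_le (min_le_right _ _)
  have ha1 : 0 < a + 1 := by linarith
  -- The logarithmic factor is at least 1, so a root of the assumption gives `f ≥ n ^ (-θ)`. With `a
  -- + 1 = 4 + δ`, the quantity `(a + 1)(1 - θ) / 2` is `2 + δ / 2 - Δ / 4`, above 2 because `Δ <
  -- δ`; and `Δ < a + 1` gives `2 θ < 1`.
  refine ⟨a, C, Δ / (2 * (a + 1)), by linarith, hα, by positivity, ?_, ?_, ?_⟩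
  · have : (a + 1) * (1 - Δ / (2 * (a + 1))) / 2 = (a + 1) / 2 - Δ / 4 := by
      field_simp
      ring
    rw [this]
    linarith
  · rw [show 2 * (Δ / (2 * (a + 1))) = Δ / (a + 1) by field_simp, div_lt_one ha1]
    exact hΔ1
  · filter_upwards [hφ, eventually_ge_atTop 3] with n hn hn3
    have hnr : (3 : ℝ) ≤ n := by exact_mod_cast hn3
    have hn0 : (0 : ℝ) < n := by linarith
    have hlog1 : 1 ≤ Real.log n := by
      rw [Real.le_log_iff_exp_le hn0]
      exact (Real.exp_one_lt_d9.le.trans (by norm_num)).trans hnr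
    have h1 : 1 ≤ Real.log n ^ (3 * (a + 1)) := Real.one_le_rpow hlog1 (by linarith)
    have h2 : (n : ℝ) ^ (-Δ) ≤ maxBallProb P X x n (h n) ^ (2 * (a + 1)) :=
      (le_mul_of_one_le_left (Real.rpow_nonneg hn0.le _) h1).trans hn
    have h3 := Real.rpow_le_rpow (Real.rpow_nonneg hn0.le _) h2
      (by positivity : 0 ≤ 1 / (2 * (a + 1)))
    rw [← Real.rpow_mul hn0.le, ← Real.rpow_mul (maxBallProb_nonneg _ _)] at h3
    rw [mul_one_div_cancel (by positivity), Real.rpow_one] at h3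
    convert h3 using 2
    ring

/-- Moments of the response on the ball. -/
theorem exists_moment_bound [IsProbabilityMeasure P] [BorelSpace F]
    (hmodel : RegressionModel P X Y φ m)
    {γ : ℕ → ℕ → F → ℝ} (hmom : ConditionalMoments P X Y φ x h γ) (k : ℕ) (hk : 1 ≤ k) :
    ∃ C : ℝ, ∀ᶠ n in atTop, ∀ j ∈ Finset.Icc 1 n,
      IntegrableOn (fun ω => |φ (Y j ω)| ^ k) (near X x j (h n)) P ∧
      ∫ ω in near X x j (h n), |φ (Y j ω)| ^ k ∂P ≤ C * maxBallProb P X x n (h n) := by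
  have hmeas : ∀ j, 1 ≤ j → ∀ k : ℕ, Measurable fun ω => |φ (Y j ω)| ^ k := fun j hj k =>
    (hmodel.measurable_φ.comp (hmodel.measurable_Y j hj)).abs.pow_const k
  obtain ⟨c, C, hc, hC, -, hγ, -⟩ := hmom.bounds
  have main : ∀ k : ℕ, 2 ≤ k → ∀ᶠ n in atTop, ∀ j ∈ Finset.Icc 1 n,
      IntegrableOn (fun ω => |φ (Y j ω)| ^ k) (near X x j (h n)) P ∧
      ∫ ω in near X x j (h n), |φ (Y j ω)| ^ k ∂P ≤ (C + 1) * maxBallProb P X x n (h n) := by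
    intro k hk
    filter_upwards [hmom.continuity k (by omega) 1 one_pos] with n hn j hj
    have hj1 := (Finset.mem_Icc.mp hj).1
    obtain ⟨hγm, hγ0, hγi⟩ := hmom.version k j (by omega) hj1
    have e := hγi (Metric.closedBall x (h n)) Metric.isClosed_closedBall.measurableSet
    have hset : X j ⁻¹' Metric.closedBall x (h n) = near X x j (h n) := rfl
    rw [hset] at e
    have hms := measurableSet_near (x := x) (hmodel.measurable_X j hj1) (h n)
    have hle : ∫⁻ ω in near X x j (h n), ENNReal.ofReal (|φ (Y j ω)| ^ k) ∂P ≤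
        ENNReal.ofReal (C + 1) * P (near X x j (h n)) := by
      rw [e, ← setLIntegral_const]
      refine setLIntegral_mono measurable_const fun ω hω => ENNReal.ofReal_le_ofReal ?_
      have h1 := (abs_le.mp (hn j hj (X j ω) hω)).2
      have h2 := hγ k j hk hj1
      linarith
    have hfin : ∫⁻ ω in near X x j (h n), ENNReal.ofReal (|φ (Y j ω)| ^ k) ∂P < ⊤ :=
      hle.trans_lt (ENNReal.mul_lt_top ENNReal.ofReal_lt_top (measure_lt_top _ _))
    have hint : IntegrableOn (fun ω => |φ (Y j ω)| ^ k) (near X x j (h n)) P := by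
      refine ⟨(hmeas j hj1 k).aestronglyMeasurable, ?_⟩
      rw [hasFiniteIntegral_iff_ofReal (ae_of_all _ fun _ => by positivity)]
      exact hfin
    refine ⟨hint, ?_⟩
    rw [integral_eq_lintegral_of_nonneg_ae (ae_of_all _ fun _ => by positivity)
      hint.aestronglyMeasurable]
    calc _ ≤ (ENNReal.ofReal (C + 1) * P (near X x j (h n))).toReal :=
          ENNReal.toReal_mono (ENNReal.mul_lt_top ENNReal.ofReal_lt_top (measure_lt_top _ _)).ne hle
      _ = (C + 1) * ballProb P X x j 0 (h n) := by
          rw [ENNReal.toReal_mul, ENNReal.toReal_ofReal (by linarith), ballProb_eq]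
          rfl
      _ ≤ _ := mul_le_mul_of_nonneg_left (ballProb_le_maxBallProb hj _) (by linarith)
  -- The upper bounds on `γ k i x` are given for `k ≥ 2` only; the first moment follows from `|y| ≤
  -- 1 + y²`.
  rcases Nat.lt_or_ge 1 k with hk2 | hk1
  · exact ⟨C + 1, main k hk2⟩
  · obtain rfl : k = 1 := by omega
    refine ⟨1 + (C + 1), ?_⟩
    filter_upwards [main 2 le_rfl] with n hn j hj
    obtain ⟨i2, b2⟩ := hn j hj
    have hj1 := (Finset.mem_Icc.mp hj).1
    have hle : ∀ y : ℝ, |y| ^ 1 ≤ 1 + |y| ^ 2 := fun y => by nlinarith [sq_nonneg (|y| - 1)]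
    have hi : IntegrableOn (fun ω => 1 + |φ (Y j ω)| ^ 2) (near X x j (h n)) P :=
      (integrable_const _).add i2
    have hi1 : IntegrableOn (fun ω => |φ (Y j ω)| ^ 1) (near X x j (h n)) P := by
      refine Integrable.mono' hi (hmeas j hj1 1).aestronglyMeasurable (ae_of_all _ fun ω => ?_)
      rw [Real.norm_of_nonneg (by positivity)]
      exact hle _
    refine ⟨hi1, (integral_mono hi1 hi fun ω => hle _).trans ?_⟩
    rw [integral_add (integrable_const _) i2, setIntegral_const, smul_eq_mul, mul_one, ← ballProb_eq]
    have := ballProb_le_maxBallProb (P := P) (X := X) (x := x) hj (h n)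
    linarith

/-- Joint moments of the responses. -/
theorem exists_joint_moment_bound [IsProbabilityMeasure P] [BorelSpace F]
    (hmodel : RegressionModel P X Y φ m)
    {γ : ℕ → ℕ → F → ℝ} (hmom : ConditionalMoments P X Y φ x h γ) {p₁ p₂ : ℕ → ℕ → ℕ → ℝ}
    (hjoint : JointBallBounds P X x h p₁ p₂) :
    ∃ C : ℝ, ∀ᶠ n in atTop, ∀ i ∈ Finset.Icc 1 n, ∀ j ∈ Finset.Icc 1 n, i ≠ j →
      IntegrableOn (fun ω => φ (Y i ω) * φ (Y j ω)) (near X x i (h n) ∩ near X x j (h n)) P ∧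
      ∫ ω in near X x i (h n) ∩ near X x j (h n), |φ (Y i ω) * φ (Y j ω)| ∂P ≤
        C * Real.sqrt (maxBallProb P X x n (h n)) ^ 3 := by
  obtain ⟨-, C, -, hC, -, -, hb⟩ := hmom.bounds
  obtain ⟨C', hC', hev⟩ := hjoint.exists_joint_bound
  refine ⟨C * C', ?_⟩
  filter_upwards [hev] with n hn i hi j hj hij
  have hi1 := (Finset.mem_Icc.mp hi).1
  have hj1 := (Finset.mem_Icc.mp hj).1
  obtain ⟨hint, hcond⟩ := hb i j hi1 hj1 hij
  refine ⟨hint.integrableOn, ?_⟩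
  have hXX : Measurable fun ω => (X i ω, X j ω) :=
    (hmodel.measurable_X i hi1).prodMk (hmodel.measurable_X j hj1)
  set S := near X x i (h n) ∩ near X x j (h n) with hS
  have hSm : MeasurableSet[MeasurableSpace.comap (fun ω => (X i ω, X j ω)) inferInstance] S :=
    ⟨Metric.closedBall x (h n) ×ˢ Metric.closedBall x (h n),
      Metric.isClosed_closedBall.measurableSet.prod Metric.isClosed_closedBall.measurableSet, rfl⟩
  rw [← setIntegral_condExp hXX.comap_le hint.abs hSm]
  calc _ ≤ ∫ ω in S, C ∂P :=
        integral_mono_ae integrable_condExp.integrableOn integrableOn_const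
          (ae_restrict_of_ae hcond)
    _ = C * P.real S := by rw [setIntegral_const, smul_eq_mul, mul_comm]
    _ ≤ C * (C' * Real.sqrt (maxBallProb P X x n (h n)) ^ 3) :=
        mul_le_mul_of_nonneg_left (hn i hi j hj hij) hC.le
    _ = _ := by ring

end Model

/-! ### Concentration, lower bounds and bias of the weighted sums. -/

section WeightedSums

/-- Moments of the product of a variable that is bounded and supported on `S` with `W`. -/
theorem integrable_mul_of_indicator_bound {Ω : Type*} [MeasurableSpace Ω] {P : Measure Ω}
    {f W : Ω → ℝ} {S : Set Ω} {B : ℝ} {k : ℕ} (hk : k ≠ 0)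
    (hS : MeasurableSet S) (hf : Measurable f) (hW : Measurable W)
    (hb : ∀ ω, |f ω| ≤ S.indicator (fun _ => B) ω)
    (hWi : IntegrableOn (fun ω => |W ω| ^ k) S P) :
    Integrable (fun ω => |f ω * W ω| ^ k) P ∧
      ∫ ω, |f ω * W ω| ^ k ∂P ≤ B ^ k * ∫ ω in S, |W ω| ^ k ∂P := by
  have hle : ∀ ω, |f ω * W ω| ^ k ≤ B ^ k * S.indicator (fun ω => |W ω| ^ k) ω := by
    intro ω
    have h1 := hb ω
    by_cases hω : ω ∈ S
    · rw [Set.indicator_of_mem hω] at h1 ⊢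
      rw [abs_mul, mul_pow]
      exact mul_le_mul_of_nonneg_right (pow_le_pow_left₀ (abs_nonneg _) h1 k) (by positivity)
    · rw [Set.indicator_of_notMem hω] at h1 ⊢
      rw [abs_mul, le_antisymm h1 (abs_nonneg _)]
      simp [hk]
  have hi : Integrable (fun ω => B ^ k * S.indicator (fun ω => |W ω| ^ k) ω) P :=
    ((integrable_indicator_iff hS).mpr hWi).const_mul _
  have hi' : Integrable (fun ω => |f ω * W ω| ^ k) P :=
    hi.mono' ((hf.mul hW).abs.pow_const k).aestronglyMeasurable (ae_of_all _ fun ω => by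
      rw [Real.norm_of_nonneg (by positivity)]; exact hle ω)
  refine ⟨hi', (integral_mono hi' hi hle).trans (le_of_eq ?_)⟩
  rw [integral_const_mul, integral_indicator hS]

variable {Ω F : Type*} [MeasurableSpace Ω] [PseudoMetricSpace F] [MeasurableSpace F] [BorelSpace F]
  {P : Measure Ω} [IsProbabilityMeasure P] {X : ℕ → Ω → F} {Y : ℕ → Ω → ℝ} {φ : ℝ → ℝ} {m : F → ℝ}
  {β : F → F → ℝ} {K : ℝ → ℝ} {h : ℕ → ℝ} {x : F}

/-- Complete concentration of the sums that make up the estimator. -/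
theorem exists_tail_bound_localTerm (hX : ∀ i, 1 ≤ i → Measurable (X i))
    (hY : ∀ i, 1 ≤ i → Measurable (Y i)) (hh : ∀ n, 0 < h n) (hβ : LocatingFunction β x)
    (hK : ContinuousOn K (Set.Icc 0 1)) (h0 : ∀ u, u ∉ Set.Icc (0 : ℝ) 1 → K u = 0)
    (hmix : ArithmeticMixing P X Y x h) {W : ℕ → Ω → ℝ}
    (hW : ∀ j, 1 ≤ j →
      Measurable[MeasurableSpace.comap (fun ω => (Y j ω, X j ω)) inferInstance] (W j))
    (hWmom : ∀ k : ℕ, 1 ≤ k → ∃ C : ℝ, ∀ᶠ n in atTop, ∀ j ∈ Finset.Icc 1 n,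
      IntegrableOn (fun ω => |W j ω| ^ k) (near X x j (h n)) P ∧
      ∫ ω in near X x j (h n), |W j ω| ^ k ∂P ≤ C * maxBallProb P X x n (h n))
    (hWjoint : ∃ C : ℝ, ∀ᶠ n in atTop, ∀ i ∈ Finset.Icc 1 n, ∀ j ∈ Finset.Icc 1 n, i ≠ j →
      IntegrableOn (fun ω => W i ω * W j ω) (near X x i (h n) ∩ near X x j (h n)) P ∧
      ∫ ω in near X x i (h n) ∩ near X x j (h n), |W i ω * W j ω| ∂P ≤
        C * Real.sqrt (maxBallProb P X x n (h n)) ^ 3) (l : ℕ) (hl : l ≤ 2) :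
    ∃ (Λ : ℝ) (p : ℕ → ℝ), 0 < Λ ∧ Summable p ∧ ∀ᶠ n in atTop,
      P.real {ω | Λ * (Real.sqrt (n * maxBallProb P X x n (h n)) * Real.sqrt (Real.log n)) ≤
        |∑ j ∈ Finset.Icc 1 n, (localTerm X β K x (h n) l j ω * W j ω -
          ∫ ω', localTerm X β K x (h n) l j ω' * W j ω' ∂P)|} ≤ p n := by
  obtain ⟨a, Cα, θ, ha, hα, hθ0, hθ, -, hφ⟩ := hmix.exists_exponents
  obtain ⟨B, hB, hb⟩ := exists_localTerm_bound (X := X) hβ hK h0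
  have hKm := measurable_kernel hK h0
  have hξ : ∀ i, 1 ≤ i → Measurable (fun ω => (Y i ω, X i ω)) := fun i hi =>
    (hY i hi).prodMk (hX i hi)
  have hLm : ∀ n j, 1 ≤ j → Measurable (localTerm X β K x (h n) l j) := fun n j hj =>
    (measurable_localTerm (Y := Y) hβ.measurable hKm (h n) l j).mono (hξ j hj).comap_le le_rfl
  have hWm : ∀ j, 1 ≤ j → Measurable (W j) := fun j hj =>
    (hW j hj).mono (hξ j hj).comap_le le_rfl
  refine exists_summable_tail_bound (P := P) (ξ := fun i ω => (Y i ω, X i ω))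
    (φ := fun n => maxBallProb P X x n (h n))
    (Z := fun n j ω => localTerm X β K x (h n) l j ω * W j ω) hξ ha hα hθ0 hθ
    (fun n => maxBallProb_le_one _ _) hφ
    (fun n j hj => (measurable_localTerm (Y := Y) hβ.measurable hKm (h n) l j).mul (hW j hj)) ?_ ?_
  · intro k hk
    obtain ⟨C, hC⟩ := hWmom k hk
    refine ⟨B ^ k * C, ?_⟩
    filter_upwards [hC] with n hn j hj
    have hj1 := (Finset.mem_Icc.mp hj).1
    obtain ⟨i1, i2⟩ := integrable_mul_of_indicator_bound (P := P) (f := localTerm X β K x (h n) l j)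
      (W := W j) (B := B) (by omega : k ≠ 0) (measurableSet_near (hX j hj1) (h n)) (hLm n j hj1)
      (hWm j hj1) (fun ω => hb (h n) l j ω (hh n) hl) (hn j hj).1
    refine ⟨i1, i2.trans ?_⟩
    rw [mul_assoc]
    exact mul_le_mul_of_nonneg_left (hn j hj).2 (by positivity)
  · obtain ⟨C, hC⟩ := hWjoint
    refine ⟨B ^ 2 * C, ?_⟩
    filter_upwards [hC] with n hn i hi j hj hij
    have hi1 := (Finset.mem_Icc.mp hi).1
    have hj1 := (Finset.mem_Icc.mp hj).1
    obtain ⟨w1, w2⟩ := hn i hi j hj hij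
    have hbb : ∀ ω, |localTerm X β K x (h n) l i ω * localTerm X β K x (h n) l j ω| ≤
        (near X x i (h n) ∩ near X x j (h n)).indicator (fun _ => B ^ 2) ω := by
      intro ω
      have b1 := hb (h n) l i ω (hh n) hl
      have b2 := hb (h n) l j ω (hh n) hl
      rw [abs_mul]
      by_cases hωi : ω ∈ near X x i (h n)
      · by_cases hωj : ω ∈ near X x j (h n)
        · rw [Set.indicator_of_mem (Set.mem_inter hωi hωj)]
          rw [Set.indicator_of_mem hωi] at b1
          rw [Set.indicator_of_mem hωj] at b2
          rw [sq]
          exact mul_le_mul b1 b2 (abs_nonneg _) (by linarith)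
        · rw [Set.indicator_of_notMem fun h => hωj h.2]
          rw [Set.indicator_of_notMem hωj] at b2
          rw [le_antisymm b2 (abs_nonneg _), mul_zero]
      · rw [Set.indicator_of_notMem fun h => hωi h.1]
        rw [Set.indicator_of_notMem hωi] at b1
        rw [le_antisymm b1 (abs_nonneg _), zero_mul]
    have hSm := (measurableSet_near (x := x) (hX i hi1) (h n)).inter
      (measurableSet_near (x := x) (hX j hj1) (h n))
    obtain ⟨i1, i2⟩ := integrable_mul_of_indicator_bound (P := P)
      (f := fun ω => localTerm X β K x (h n) l i ω * localTerm X β K x (h n) l j ω)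
      (W := fun ω => W i ω * W j ω) (k := 1) one_ne_zero hSm ((hLm n i hi1).mul (hLm n j hj1))
      ((hWm i hi1).mul (hWm j hj1)) hbb (by simp only [pow_one]; exact w1.abs)
    have e : ∀ ω, localTerm X β K x (h n) l i ω * W i ω * (localTerm X β K x (h n) l j ω * W j ω) =
        localTerm X β K x (h n) l i ω * localTerm X β K x (h n) l j ω * (W i ω * W j ω) :=
      fun ω => by ring
    simp only [pow_one] at i1 i2
    simp only [e]
    refine ⟨(integrable_norm_iff (((hLm n i hi1).mul (hLm n j hj1)).mul
      ((hWm i hi1).mul (hWm j hj1))).aestronglyMeasurable).mp i1, i2.trans ?_⟩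
    rw [mul_assoc]
    exact mul_le_mul_of_nonneg_left w2 (by positivity)

/-- The means of the weights are bounded below by small-ball probabilities. -/
theorem exists_mean_lower_bound (hX : ∀ i, 1 ≤ i → Measurable (X i)) (hh : ∀ n, 0 < h n)
    (hpos : PositiveBalls P X x) (hβ : LocatingFunction β x) (hK : KernelAssumption P X x h K)
    (hlocal : LocalKernelCondition P X x h K) (hcomp : ComparableBalls P X x h) :
    ∃ c : ℝ, 0 < c ∧ ∀ᶠ n in atTop, ∀ i ∈ Finset.Icc 1 n,
      c * maxBallProb P X x n (h n) ≤ ∫ ω, localTerm X β K x (h n) 0 i ω ∂P ∧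
      c * maxBallProb P X x n (h n) ≤ ∫ ω, localTerm X β K x (h n) 2 i ω ∂P := by
  have hKc := hK.differentiable.continuousOn
  have h0 := fun u => kernel_eq_zero (u := u) hK.nonneg hK.type
  have hKm := measurable_kernel hKc h0
  obtain ⟨B, hB, hb⟩ := exists_localTerm_bound (X := X) hβ hKc h0
  obtain ⟨c₃, C₃, hc₃, -, hβb⟩ := hβ.comparable
  obtain ⟨c, ε, hc, hε0, hε1, hev⟩ := hlocal
  obtain ⟨D, hD⟩ := hcomp
  -- Both weights dominate a multiple of `U² K(U)` on `{U ≤ ε}`: by `U ≤ 1` for `l = 0` and by `|β|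
  -- ≥ c₃ dist` for `l = 2`. The factor `|D| + 1` passes from the ball of `X i` to the largest one.
  refine ⟨min 1 (c₃ ^ 2) * c / (|D| + 1), by positivity, ?_⟩
  filter_upwards [hev, hD] with n hn hDn i hi
  have hi1 := (Finset.mem_Icc.mp hi).1
  set r := h n with hr
  have hr0 : 0 < r := hh n
  have hball : 0 < ballProb P X x i 0 r := hpos r hr0 i hi1
  have hmax : maxBallProb P X x n r ≤ (|D| + 1) * ballProb P X x i 0 r := by
    refine (maxBallProb_le_mul hi fun s hs => hDn s hs i hi).trans ?_
    exact mul_le_mul_of_nonneg_right ((le_abs_self D).trans (by linarith)) hball.le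
  set U : Ω → ℝ := fun ω => dist (X i ω) x / r with hU
  have hUm : Measurable U :=
    ((continuous_id.dist continuous_const).measurable.comp (hX i hi1)).div_const r
  have hU0 : ∀ ω, 0 ≤ U ω := fun ω => by positivity
  set G : ℝ → ℝ := fun t => t ^ 2 * K t with hG
  have hGd : DifferentiableOn ℝ G (Set.Icc 0 1) :=
    (differentiableOn_pow 2).mul hK.differentiable
  have hset : ∀ z, ballProb P X x i (z * r) (ε * r) = P.real {ω | z ≤ U ω ∧ U ω ≤ ε} := by
    intro z
    unfold ballProb
    congr 1
    ext ω
    simp only [Set.mem_ofPred_eq, hU, dist_comm x]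
    rw [le_div_iff₀ hr0, div_le_iff₀ hr0]
  have hcn := hn i hi 2 (by simp)
  simp only [hset] at hcn
  have hint : IntervalIntegrable (fun z => P.real {ω | z ≤ U ω ∧ U ω ≤ ε} * unitDeriv G z)
      volume 0 ε := by
    -- A non-integrable integrand would have integral 0 by convention, contradicting the positive
    -- lower bound; so the assumption itself supplies integrability.
    by_contra hcon
    rw [intervalIntegral.integral_undef hcon, mul_zero] at hcn
    linarith
  rw [integral_tail_mul_unitDeriv hUm hU0 hGd (by simp [hG]) hε0 hε1 hint] at hcn
  set I := ∫ ω, (if U ω ≤ ε then G (U ω) else 0) ∂P with hI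
  have hI1 : c * ballProb P X x i 0 r ≤ I := by
    rw [inv_mul_eq_div, lt_div_iff₀ hball] at hcn
    exact hcn.le
  have hLi : ∀ l ≤ 2, Integrable (localTerm X β K x r l i) P := by
    intro l hl
    refine Integrable.of_bound ((measurable_local hβ.measurable hKm r l).comp
      (hX i hi1)).aestronglyMeasurable B (ae_of_all _ fun ω => (hb r l i ω hr0 hl).trans ?_)
    exact Set.indicator_le_self' (fun _ _ => by linarith) ω
  have hGi : Integrable (fun ω => if U ω ≤ ε then G (U ω) else 0) P := by
    by_contra hcon
    rw [hI, integral_undef hcon] at hI1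
    nlinarith
  have key : ∀ l, (l = 0 ∨ l = 2) → min 1 (c₃ ^ 2) * I ≤ ∫ ω, localTerm X β K x r l i ω ∂P := by
    intro l hl
    rw [hI, ← integral_const_mul]
    refine integral_mono (hGi.const_mul _) (hLi l (by omega)) fun ω => ?_
    simp only
    have hK0 := hK.nonneg (U ω)
    have hmin0 : 0 ≤ min 1 (c₃ ^ 2) := by positivity
    rcases hl with rfl | rfl
    · have e : localTerm X β K x r 0 i ω = K (U ω) := by simp [localTerm, hU]
      rw [e]
      split_ifs with hle
      · have h1 : U ω ^ 2 ≤ 1 := pow_le_one₀ (hU0 ω) (hle.trans hε1.le)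
        calc min 1 (c₃ ^ 2) * G (U ω) ≤ 1 * (1 * K (U ω)) :=
              mul_le_mul (min_le_left _ _) (mul_le_mul_of_nonneg_right h1 hK0)
                (by positivity) zero_le_one
          _ = K (U ω) := by ring
      · simpa using hK0
    · have e : localTerm X β K x r 2 i ω = (β (X i ω) x / r) ^ 2 * K (U ω) := rfl
      rw [e]
      split_ifs with hle
      · have h1 : c₃ ^ 2 * U ω ^ 2 ≤ (β (X i ω) x / r) ^ 2 := by
          have h2 := (hβb (X i ω)).1
          rw [← mul_pow, ← sq_abs (β (X i ω) x / r), abs_div, abs_of_pos hr0]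
          refine pow_le_pow_left₀ (mul_nonneg hc₃.le (hU0 ω)) ?_ 2
          rw [hU, ← mul_div_assoc]
          exact div_le_div_of_nonneg_right h2 hr0.le
        calc min 1 (c₃ ^ 2) * G (U ω) ≤ c₃ ^ 2 * G (U ω) :=
              mul_le_mul_of_nonneg_right (min_le_right _ _) (by positivity)
          _ = c₃ ^ 2 * U ω ^ 2 * K (U ω) := by rw [hG]; ring
          _ ≤ _ := mul_le_mul_of_nonneg_right h1 hK0
      · rw [mul_zero]; positivity
  have final : min 1 (c₃ ^ 2) * c / (|D| + 1) * maxBallProb P X x n r ≤ min 1 (c₃ ^ 2) * I := by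
    calc _ ≤ min 1 (c₃ ^ 2) * c / (|D| + 1) * ((|D| + 1) * ballProb P X x i 0 r) :=
          mul_le_mul_of_nonneg_left hmax (by positivity)
      _ = min 1 (c₃ ^ 2) * (c * ballProb P X x i 0 r) := by field_simp
      _ ≤ _ := mul_le_mul_of_nonneg_left hI1 (by positivity)
  exact ⟨final.trans (key 0 (Or.inl rfl)), final.trans (key 2 (Or.inr rfl))⟩

/-- The bias of the weighted sums: the errors are centered given the covariates. -/
theorem exists_bias_bound (hmodel : RegressionModel P X Y φ m) (hh : ∀ n, 0 < h n) {b : ℝ}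
    (hholder : HolderNear m x h b) (hβ : LocatingFunction β x)
    (hK : ContinuousOn K (Set.Icc 0 1)) (h0 : ∀ u, u ∉ Set.Icc (0 : ℝ) 1 → K u = 0) :
    ∃ C : ℝ, ∀ᶠ n in atTop, ∀ j ∈ Finset.Icc 1 n, ∀ l ≤ 2,
      Integrable (fun ω => localTerm X β K x (h n) l j ω * φ (Y j ω)) P →
      |∫ ω, localTerm X β K x (h n) l j ω * φ (Y j ω) ∂P -
        m x * ∫ ω, localTerm X β K x (h n) l j ω ∂P| ≤
          C * (h n ^ b * maxBallProb P X x n (h n)) := by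
  obtain ⟨hb0, C, hC, hev⟩ := hholder
  obtain ⟨B, hB, hb⟩ := exists_localTerm_bound (X := X) hβ hK h0
  have hKm := measurable_kernel hK h0
  refine ⟨B * C, ?_⟩
  filter_upwards [hev] with n hn j hj l hl hint
  have hj1 := (Finset.mem_Icc.mp hj).1
  have hXj := hmodel.measurable_X j hj1
  set r := h n with hr
  have hr0 : 0 < r := hh n
  set f : Ω → ℝ := localTerm X β K x r l j with hf
  have hfX : StronglyMeasurable[MeasurableSpace.comap (X j) inferInstance] f :=
    ((measurable_local hβ.measurable hKm r l).comp (comap_measurable (X j))).stronglyMeasurable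
  have hfm : Measurable f := (measurable_local hβ.measurable hKm r l).comp hXj
  have hfB : ∀ ω, |f ω| ≤ B := fun ω =>
    (hb r l j ω hr0 hl).trans (Set.indicator_le_self' (fun _ _ => by linarith) ω)
  have hfi : Integrable f P := Integrable.of_bound hfm.aestronglyMeasurable B (ae_of_all _ hfB)
  have herr := hmodel.integrable_error j hj1
  have hfe : Integrable (fun ω => f ω * (φ (Y j ω) - m (X j ω))) P :=
    herr.bdd_mul hfm.aestronglyMeasurable (ae_of_all _ hfB)
  have hzero : ∫ ω, f ω * (φ (Y j ω) - m (X j ω)) ∂P = 0 := by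
    rw [← integral_condExp hXj.comap_le]
    have h1 := condExp_mul_of_stronglyMeasurable_left hfX hfe herr
    have h2 := hmodel.condExp_error j hj1
    rw [integral_congr_ae (g := fun _ => (0 : ℝ)), integral_zero]
    filter_upwards [h1, h2] with ω h1 h2
    have h3 : (f * fun ω => φ (Y j ω) - m (X j ω)) = fun ω => f ω * (φ (Y j ω) - m (X j ω)) := rfl
    rw [h3] at h1
    rw [h1, Pi.mul_apply, h2]
    simp
  have e1 : ∫ ω, f ω * φ (Y j ω) ∂P - m x * ∫ ω, f ω ∂P = ∫ ω, f ω * (m (X j ω) - m x) ∂P := by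
    have h4 : ∀ ω, f ω * (m (X j ω) - m x) =
        f ω * φ (Y j ω) - m x * f ω - f ω * (φ (Y j ω) - m (X j ω)) := fun ω => by ring
    simp only [h4]
    rw [integral_sub (by exact hint.sub (hfi.const_mul _)) hfe, hzero, sub_zero,
      integral_sub hint (hfi.const_mul _), integral_const_mul]
  rw [e1]
  have hnear := measurableSet_near (x := x) hXj r
  calc |∫ ω, f ω * (m (X j ω) - m x) ∂P| ≤ ∫ ω, |f ω * (m (X j ω) - m x)| ∂P :=
        abs_integral_le_integral_abs
    _ ≤ ∫ ω, (near X x j r).indicator (fun _ => B * (C * r ^ b)) ω ∂P := by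
        refine integral_mono_of_nonneg (ae_of_all _ fun _ => abs_nonneg _)
          ((integrable_const _).indicator hnear) (ae_of_all _ fun ω => ?_)
        have h5 := hb r l j ω hr0 hl
        simp only
        rw [abs_mul]
        by_cases hω : ω ∈ near X x j r
        · rw [Set.indicator_of_mem hω] at h5 ⊢
          refine mul_le_mul h5 ?_ (abs_nonneg _) (by linarith)
          refine (hn (X j ω) hω x (Metric.mem_closedBall_self hr0.le)).trans ?_
          exact mul_le_mul_of_nonneg_left (Real.rpow_le_rpow dist_nonneg hω hb0.le) hC.le
        · rw [Set.indicator_of_notMem hω] at h5 ⊢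
          rw [hf, le_antisymm h5 (abs_nonneg _), zero_mul]
    _ = B * C * (r ^ b * ballProb P X x j 0 r) := by
        rw [integral_indicator_const _ hnear, ballProb_eq, smul_eq_mul]; ring
    _ ≤ _ := by
        have := ballProb_le_maxBallProb (P := P) (X := X) (x := x) hj r
        have h6 : 0 ≤ r ^ b := Real.rpow_nonneg hr0.le _
        gcongr

end WeightedSums

/-! ### Negligibility of the first-order weights. -/

section FirstOrder

theorem eventually_mul_rpow_le {C ε s t : ℝ} (hε : 0 < ε) (hst : s < t) :
    ∀ᶠ n : ℕ in atTop, C * (n : ℝ) ^ s ≤ ε * (n : ℝ) ^ t := by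
  have h1 : Tendsto (fun n : ℕ => C * (n : ℝ) ^ (-(t - s))) atTop (𝓝 (C * 0)) :=
    ((tendsto_rpow_neg_atTop (sub_pos.mpr hst)).comp tendsto_natCast_atTop_atTop).const_mul C
  rw [mul_zero] at h1
  filter_upwards [h1.eventually_le_const hε, eventually_gt_atTop 0] with n hn hn0
  have hnr : (0 : ℝ) < n := by exact_mod_cast hn0
  calc C * (n : ℝ) ^ s = C * (n : ℝ) ^ (-(t - s)) * (n : ℝ) ^ t := by
        rw [mul_assoc, ← Real.rpow_add hnr]; congr 2; ring
    _ ≤ ε * (n : ℝ) ^ t := mul_le_mul_of_nonneg_right hn (Real.rpow_nonneg hnr.le _)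

variable {Ω F : Type*} [MeasurableSpace Ω] [PseudoMetricSpace F] [MeasurableSpace F] [BorelSpace F]
  {P : Measure Ω} [IsProbabilityMeasure P] {X : ℕ → Ω → F} {Y : ℕ → Ω → ℝ}
  {β : F → F → ℝ} {K : ℝ → ℝ} {h : ℕ → ℝ} {x : F}

/-- The local means of `β` at distant indices have a small product. -/
theorem abs_localMean_mul_le {i j : ℕ} {r C ε f α : ℝ} (hr : 0 < r) (hC : 0 ≤ C) (hε : 0 ≤ ε)
    (hXi : Measurable (X i)) (hXj : Measurable (X j)) (hβm : Measurable fun u => β u x)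
    (hβ : ∀ u, |β u x| ≤ C * dist u x)
    (hmix : MixingLE P (MeasurableSpace.comap (X i) inferInstance)
      (MeasurableSpace.comap (X j) inferInstance) α)
    (hlocal : |r ^ 2 * ∫ q in Metric.closedBall x r ×ˢ Metric.closedBall x r, β q.1 x * β q.2 x
          ∂(P.map fun ω => (X i ω, X j ω))| ≤
        ε * ∫ q in Metric.closedBall x r ×ˢ Metric.closedBall x r, β q.1 x ^ 2 * β q.2 x ^ 2
          ∂(P.map fun ω => (X i ω, X j ω)))
    (hi : P.real (near X x i r) ≤ f) (hj : P.real (near X x j r) ≤ f) (hα : α ≤ ε * f ^ 2)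
    (hε1 : ε ≤ 1) :
    |∫ ω in near X x i r, β (X i ω) x ∂P| * |∫ ω in near X x j r, β (X j ω) x ∂P| ≤
      ε * (2 * C ^ 4 + 4 * C ^ 2) * (r * f) ^ 2 := by
  have hf0 : 0 ≤ f := measureReal_nonneg.trans hi
  have hball : MeasurableSet (Metric.closedBall x r) := Metric.isClosed_closedBall.measurableSet
  have hXX : Measurable fun ω => (X i ω, X j ω) := hXi.prodMk hXj
  have hSi := measurableSet_near (x := x) hXi r
  have hSj := measurableSet_near (x := x) hXj r
  set g : F → ℝ := (Metric.closedBall x r).indicator fun u => β u x with hg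
  have hgm : Measurable g := hβm.indicator hball
  have hgb : ∀ u, |g u| ≤ C * r := by
    intro u
    by_cases hu : u ∈ Metric.closedBall x r
    · rw [hg, Set.indicator_of_mem hu]
      exact (hβ u).trans (mul_le_mul_of_nonneg_left hu hC)
    · rw [hg, Set.indicator_of_notMem hu, abs_zero]
      positivity
  have hmean : ∀ {k : ℕ}, Measurable (X k) →
      ∫ ω in near X x k r, β (X k ω) x ∂P = ∫ ω, g (X k ω) ∂P := by
    intro k hk
    rw [← integral_indicator (measurableSet_near hk r)]
    rfl
  have cov := hmix.abs_cov_le hXi.comap_le hXj.comap_le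
    (hgm.comp (comap_measurable (X i))).stronglyMeasurable (fun ω => hgb (X i ω))
    (hgm.comp (comap_measurable (X j))).stronglyMeasurable (fun ω => hgb (X j ω))
  have hset : (fun ω => (X i ω, X j ω)) ⁻¹' (Metric.closedBall x r ×ˢ Metric.closedBall x r) =
      near X x i r ∩ near X x j r := rfl
  have hS := hSi.inter hSj
  have map1 : ∫ q in Metric.closedBall x r ×ˢ Metric.closedBall x r, β q.1 x * β q.2 x
      ∂(P.map fun ω => (X i ω, X j ω)) = ∫ ω, g (X i ω) * g (X j ω) ∂P := by
    have hm : Measurable fun q : F × F => β q.1 x * β q.2 x :=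
      (hβm.comp measurable_fst).mul (hβm.comp measurable_snd)
    rw [setIntegral_map (hball.prod hball) hm.aestronglyMeasurable hXX.aemeasurable, hset,
      ← integral_indicator hS]
    refine integral_congr_ae (ae_of_all _ fun ω => ?_)
    simp only [hg]
    by_cases h1 : ω ∈ near X x i r
    · by_cases h2 : ω ∈ near X x j r
      · rw [Set.indicator_of_mem (Set.mem_inter h1 h2),
          Set.indicator_of_mem (show X i ω ∈ Metric.closedBall x r from h1),
          Set.indicator_of_mem (show X j ω ∈ Metric.closedBall x r from h2)]
      · rw [Set.indicator_of_notMem fun h => h2 h.2,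
          Set.indicator_of_notMem (show X j ω ∉ Metric.closedBall x r from h2), mul_zero]
    · rw [Set.indicator_of_notMem fun h => h1 h.1,
        Set.indicator_of_notMem (show X i ω ∉ Metric.closedBall x r from h1), zero_mul]
  -- For distant indices mixing improves the joint probability from order `f ^ (3/2)` to order `f²`,
  -- which is needed here.
  have hjoint : P.real (near X x i r ∩ near X x j r) ≤ 2 * f ^ 2 := by
    have h1 := (abs_le.mp (hmix (near X x i r) (near X x j r) ⟨_, hball, rfl⟩ ⟨_, hball, rfl⟩)).2
    have h2 : P.real (near X x i r) * P.real (near X x j r) ≤ f * f :=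
      mul_le_mul hi hj measureReal_nonneg hf0
    have h3 : ε * f ^ 2 ≤ 1 * f ^ 2 := mul_le_mul_of_nonneg_right hε1 (sq_nonneg f)
    linarith
  have map2 : ∫ q in Metric.closedBall x r ×ˢ Metric.closedBall x r, β q.1 x ^ 2 * β q.2 x ^ 2
      ∂(P.map fun ω => (X i ω, X j ω)) ≤ (C * r) ^ 4 * (2 * f ^ 2) := by
    have hm : Measurable fun q : F × F => β q.1 x ^ 2 * β q.2 x ^ 2 :=
      ((hβm.comp measurable_fst).pow_const 2).mul ((hβm.comp measurable_snd).pow_const 2)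
    rw [setIntegral_map (hball.prod hball) hm.aestronglyMeasurable hXX.aemeasurable, hset]
    calc _ ≤ ∫ ω in near X x i r ∩ near X x j r, (C * r) ^ 4 ∂P := by
          refine integral_mono_of_nonneg (ae_of_all _ fun _ => by positivity) (integrable_const _) ?_
          filter_upwards [ae_restrict_mem hS] with ω hω
          have bound : ∀ k, ω ∈ near X x k r → β (X k ω) x ^ 2 ≤ (C * r) ^ 2 := fun k hk => by
            rw [← sq_abs]
            exact pow_le_pow_left₀ (abs_nonneg _)
              ((hβ _).trans (mul_le_mul_of_nonneg_left hk hC)) 2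
          calc β (X i ω) x ^ 2 * β (X j ω) x ^ 2 ≤ (C * r) ^ 2 * (C * r) ^ 2 :=
                mul_le_mul (bound i hω.1) (bound j hω.2) (sq_nonneg _) (sq_nonneg _)
            _ = (C * r) ^ 4 := by ring
      _ = (C * r) ^ 4 * P.real (near X x i r ∩ near X x j r) := by
          rw [setIntegral_const, smul_eq_mul, mul_comm]
      _ ≤ _ := mul_le_mul_of_nonneg_left hjoint (by positivity)
  have prod_small : |∫ ω, g (X i ω) * g (X j ω) ∂P| ≤ ε * (2 * C ^ 4) * (r * f) ^ 2 := by
    rw [map1, abs_mul, abs_of_pos (by positivity : 0 < r ^ 2)] at hlocal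
    have h4 := hlocal.trans (mul_le_mul_of_nonneg_left map2 hε)
    have h5 : r ^ 2 * |∫ ω, g (X i ω) * g (X j ω) ∂P| ≤
        r ^ 2 * (ε * (2 * C ^ 4) * (r * f) ^ 2) := by
      refine h4.trans (le_of_eq ?_)
      ring
    exact le_of_mul_le_mul_left h5 (by positivity)
  rw [← abs_mul, hmean hXi, hmean hXj]
  have h6 : 4 * (C * r) * (C * r) * α ≤ ε * (4 * C ^ 2) * (r * f) ^ 2 := by
    calc 4 * (C * r) * (C * r) * α ≤ 4 * (C * r) * (C * r) * (ε * f ^ 2) :=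
          mul_le_mul_of_nonneg_left hα (by positivity)
      _ = _ := by ring
  -- The product of the means is the mean of the product, small by the condition on `β`, minus a
  -- covariance, small by mixing.
  have h7 : (∫ ω, g (X i ω) ∂P) * ∫ ω, g (X j ω) ∂P =
      ∫ ω, g (X i ω) * g (X j ω) ∂P -
        (∫ ω, g (X i ω) * g (X j ω) ∂P - (∫ ω, g (X i ω) ∂P) * ∫ ω, g (X j ω) ∂P) := by ring
  rw [h7]
  refine (abs_sub _ _).trans ?_
  have cov' := cov
  simp only [Function.comp_def] at cov'
  linarith

/-- The local means of `β` are negligible on average, uniformly over the radii. -/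
theorem eventually_sum_abs_localMean_le (hX : ∀ i, 1 ≤ i → Measurable (X i))
    (hY : ∀ i, 1 ≤ i → Measurable (Y i)) (hh : ∀ n, 0 < h n)
    (hβ : LocatingFunction β x) (hlocal : LocalBetaCondition P X x h β)
    (hmix : ArithmeticMixing P X Y x h) {ε : ℝ} (hε : 0 < ε) :
    ∀ᶠ n in atTop, ∀ r, 0 < r → r ≤ h n →
      ∑ i ∈ Finset.Icc 1 n, |∫ ω in near X x i r, β (X i ω) x ∂P| ≤
        ε * (n * (h n * maxBallProb P X x n (h n))) := by
  obtain ⟨a, Cα, θ, ha, hα, hθ0, -, hθ1, hφ⟩ := hmix.exists_exponents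
  obtain ⟨c, C, hc, hcC, hβb⟩ := hβ.comparable
  have hC : 0 < C := hc.trans_le hcC
  have hCα := rate_const_nonneg hα
  set ε' : ℝ := min 1 ((ε / 2) ^ 2 / (2 * C ^ 4 + 4 * C ^ 2)) with hε'
  have hε'0 : 0 < ε' := by positivity
  have hε'1 : ε' ≤ 1 := min_le_left _ _
  have hε'2 : ε' * (2 * C ^ 4 + 4 * C ^ 2) ≤ (ε / 2) ^ 2 := by
    rw [← le_div_iff₀ (by positivity)]
    exact min_le_right _ _
  have hξ : ∀ i, 1 ≤ i → Measurable (fun ω => (Y i ω, X i ω)) := fun i hi =>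
    (hY i hi).prodMk (hX i hi)
  -- At distance more than `√n` the mixing coefficient is at most `Cα n ^ (-a / 2)`, negligible
  -- against `f² ≥ n ^ (-2 θ)` because `2 θ < 1 < a / 2`.
  have e1 := eventually_mul_rpow_le (C := Cα) (s := -(a / 2)) (t := -(2 * θ)) hε'0 (by linarith)
  have e2 := eventually_mul_rpow_le (C := 5 * C) (s := 1 / 2) (t := 1) (by positivity : 0 < ε / 2)
    (by norm_num)
  filter_upwards [hlocal ε' hε'0, hφ, e1, e2, eventually_ge_atTop 1] with n hn hφn e1 e2 hn1 r hr hrh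
  have hnr : (1 : ℝ) ≤ n := by exact_mod_cast hn1
  have hn0 : (0 : ℝ) < n := by linarith
  set f := maxBallProb P X x n (h n) with hf
  have hf0 : 0 ≤ f := maxBallProb_nonneg _ _
  have hnearf : ∀ i ∈ Finset.Icc 1 n, P.real (near X x i r) ≤ f := fun i hi => by
    refine le_trans (measureReal_mono fun ω hω => ?_)
      ((ballProb_eq (P := P) (X := X) (x := x) i (h n)).symm.le.trans
        (ballProb_le_maxBallProb hi (h n)))
    exact le_trans hω hrh
  -- Indices within `√n` of a large term are given up: there are at most `2 L + 1 ≤ 5 √n = o(n)` of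
  -- them.
  set L := ⌈(n : ℝ) ^ (1 / 2 : ℝ)⌉₊ with hL
  have hsqrt1 : 1 ≤ (n : ℝ) ^ (1 / 2 : ℝ) := Real.one_le_rpow hnr (by norm_num)
  have hLle : (L : ℝ) ≤ (n : ℝ) ^ (1 / 2 : ℝ) + 1 := (Nat.ceil_lt_add_one (by positivity)).le
  have hfsq : (n : ℝ) ^ (-(2 * θ)) ≤ f ^ 2 := by
    rw [show -(2 * θ) = -θ * (2 : ℕ) by push_cast; ring, Real.rpow_mul hn0.le, Real.rpow_natCast]
    exact pow_le_pow_left₀ (by positivity) hφn 2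
  have hrf : r * f ≤ h n * f := mul_le_mul_of_nonneg_right hrh hf0
  have hrf0 : 0 ≤ r * f := mul_nonneg hr.le hf0
  have main := sum_le_of_distant_mul_le (b := fun i => |∫ ω in near X x i r, β (X i ω) x ∂P|)
    (n := n) (L := L) (s := ε / 2 * (h n * f)) (M := C * (h n * f))
    (by have := hh n; positivity) (by have := hh n; positivity) ?_ ?_
  · refine main.trans ?_
    have h2L : (2 * (L : ℝ) + 1) * C ≤ ε / 2 * n := by
      rw [Real.rpow_one] at e2
      refine le_trans ?_ e2
      nlinarith
    have := mul_le_mul_of_nonneg_right h2L (hrf0.trans hrf)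
    linarith
  · intro i hi
    have hi1 := (Finset.mem_Icc.mp hi).1
    calc |∫ ω in near X x i r, β (X i ω) x ∂P| ≤ ∫ ω in near X x i r, |β (X i ω) x| ∂P :=
          abs_integral_le_integral_abs
      _ ≤ ∫ ω in near X x i r, C * r ∂P := by
          refine integral_mono_of_nonneg (ae_of_all _ fun _ => abs_nonneg _) (integrable_const _) ?_
          filter_upwards [ae_restrict_mem (measurableSet_near (x := x) (hX i hi1) r)] with ω hω
          exact (hβb _).2.trans (mul_le_mul_of_nonneg_left hω hC.le)
      _ = C * (r * P.real (near X x i r)) := by rw [setIntegral_const, smul_eq_mul]; ring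
      _ ≤ C * (r * f) := by gcongr; exact hnearf i hi
      _ ≤ _ := mul_le_mul_of_nonneg_left hrf hC.le
  · intro i hi j hj hij
    have hi1 := (Finset.mem_Icc.mp hi).1
    have hj1 := (Finset.mem_Icc.mp hj).1
    have hdist : 0 < Nat.dist i j := by omega
    have hne : i ≠ j := by
      rintro rfl
      rw [Nat.dist_self] at hdist
      omega
    have hmix' : MixingLE P (MeasurableSpace.comap (X i) inferInstance)
        (MeasurableSpace.comap (X j) inferInstance)
        (mixingCoeff P (fun i ω => (Y i ω, X i ω)) (Nat.dist i j)) := by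
      have hcomap : ∀ k, MeasurableSpace.comap (X k) inferInstance ≤
          MeasurableSpace.comap (fun ω => (Y k ω, X k ω)) inferInstance := fun k =>
        (measurable_snd.comp (comap_measurable (fun ω => (Y k ω, X k ω)))).comap_le
      exact (mixingLE_comap (P := P) (ξ := fun i ω => (Y i ω, X i ω)) hi1 hj1).mono (hcomap i)
        (hcomap j)
    have hdn : (n : ℝ) ^ (1 / 2 : ℝ) ≤ Nat.dist i j :=
      (Nat.le_ceil _).trans (by exact_mod_cast hij.le)
    have hαd : mixingCoeff P (fun i ω => (Y i ω, X i ω)) (Nat.dist i j) ≤ ε' * f ^ 2 := by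
      calc _ ≤ Cα * (Nat.dist i j : ℝ) ^ (-a) := hα _ hdist
        _ ≤ Cα * ((n : ℝ) ^ (1 / 2 : ℝ)) ^ (-a) :=
            mul_le_mul_of_nonneg_left
              (Real.rpow_le_rpow_of_nonpos (by positivity) hdn (by linarith)) hCα
        _ = Cα * (n : ℝ) ^ (-(a / 2)) := by rw [← Real.rpow_mul hn0.le]; congr 2; ring
        _ ≤ ε' * (n : ℝ) ^ (-(2 * θ)) := e1
        _ ≤ ε' * f ^ 2 := mul_le_mul_of_nonneg_left hfsq hε'0.le
    refine (abs_localMean_mul_le hr hC.le hε'0.le (hX i hi1) (hX j hj1) hβ.measurable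
      (fun u => (hβb u).2) hmix' (hn r hr hrh i hi j hj hne) (hnearf i hi) (hnearf j hj) hαd
      hε'1).trans ?_
    calc _ ≤ (ε / 2) ^ 2 * (r * f) ^ 2 := mul_le_mul_of_nonneg_right hε'2 (sq_nonneg _)
      _ ≤ (ε / 2) ^ 2 * (h n * f) ^ 2 := by gcongr
      _ = _ := by ring

/-- The mean of the first-order weights is negligible. -/
theorem eventually_abs_sum_mean_le (hX : ∀ i, 1 ≤ i → Measurable (X i))
    (hY : ∀ i, 1 ≤ i → Measurable (Y i)) (hh : ∀ n, 0 < h n)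
    (hβ : LocatingFunction β x) (hK : ContinuousOn K (Set.Icc 0 1))
    (h0 : ∀ u, u ∉ Set.Icc (0 : ℝ) 1 → K u = 0) (hlocal : LocalBetaCondition P X x h β)
    (hmix : ArithmeticMixing P X Y x h) {η : ℝ} (hη : 0 < η) :
    ∀ᶠ n in atTop, |∑ i ∈ Finset.Icc 1 n, ∫ ω, localTerm X β K x (h n) 1 i ω ∂P| ≤
      η * (n * maxBallProb P X x n (h n)) := by
  obtain ⟨c₃, C, hc₃, hcC, hβb⟩ := hβ.comparable
  have hC : 0 < C := hc₃.trans_le hcC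
  obtain ⟨B, hB, hb⟩ := exists_localTerm_bound (X := X) hβ hK h0
  have hKm := measurable_kernel hK h0
  -- Since `|β / r| ≤ C` on the ball, accuracy `η / (2 C)` costs `η / 2` per unit of ball
  -- probability. The other `η / 2` is spent on finitely many radii `t k * r`, weighted by `S = ∑ |c
  -- k|`.
  obtain ⟨N, c, t, ht, happrox⟩ := exists_step_approx hK (by positivity : 0 < η / (2 * C))
  set S := ∑ k ∈ Finset.range N, |c k| with hS
  have hS0 : 0 ≤ S := Finset.sum_nonneg fun _ _ => abs_nonneg _
  filter_upwards [eventually_sum_abs_localMean_le (P := P) hX hY hh hβ hlocal hmix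
    (by positivity : 0 < η / (2 * (S + 1)))] with n hn
  set r := h n with hr
  have hr0 : 0 < r := hh n
  set f := maxBallProb P X x n r with hf
  have hf0 : 0 ≤ f := maxBallProb_nonneg _ _
  set μ : ℕ → ℕ → ℝ := fun k i => ∫ ω in near X x i (t k * r), β (X i ω) x ∂P with hμ
  have approx : ∀ i ∈ Finset.Icc 1 n, |∫ ω, localTerm X β K x r 1 i ω ∂P -
      ∑ k ∈ Finset.range N, c k * (μ k i / r)| ≤ η / 2 * f := by
    intro i hi
    have hi1 := (Finset.mem_Icc.mp hi).1
    have hXi := hX i hi1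
    have hβX : Measurable fun ω => β (X i ω) x := hβ.measurable.comp hXi
    have hLi : Integrable (localTerm X β K x r 1 i) P := by
      refine Integrable.of_bound ((measurable_local hβ.measurable hKm r 1).comp
        hXi).aestronglyMeasurable B (ae_of_all _ fun ω => (hb r 1 i ω hr0 (by norm_num)).trans ?_)
      exact Set.indicator_le_self' (fun _ _ => by linarith) ω
    have hgi : ∀ k ∈ Finset.range N, Integrable (fun ω => c k *
        ((near X x i (t k * r)).indicator (fun ω => β (X i ω) x) ω / r)) P := by
      intro k hk
      refine (Integrable.div_const ?_ r).const_mul _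
      refine Integrable.of_bound (hβX.indicator
        (measurableSet_near hXi _)).aestronglyMeasurable (C * r) (ae_of_all _ fun ω => ?_)
      by_cases hω : ω ∈ near X x i (t k * r)
      · rw [Set.indicator_of_mem hω]
        refine (hβb _).2.trans (mul_le_mul_of_nonneg_left (le_trans hω ?_) hC.le)
        exact mul_le_of_le_one_left hr0.le (ht k (Finset.mem_range.mp hk)).2
      · rw [Set.indicator_of_notMem hω, norm_zero]; positivity
    have hsum : ∑ k ∈ Finset.range N, c k * (μ k i / r) = ∫ ω, ∑ k ∈ Finset.range N, c k *
        ((near X x i (t k * r)).indicator (fun ω => β (X i ω) x) ω / r) ∂P := by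
      rw [integral_finsetSum _ hgi]
      refine Finset.sum_congr rfl fun k _ => ?_
      rw [integral_const_mul, integral_div, integral_indicator (measurableSet_near hXi _)]
    rw [hsum, ← integral_sub hLi (integrable_finsetSum _ hgi)]
    have hpt : ∀ ω, |localTerm X β K x r 1 i ω - ∑ k ∈ Finset.range N, c k *
        ((near X x i (t k * r)).indicator (fun ω => β (X i ω) x) ω / r)| ≤
        (near X x i r).indicator (fun _ => η / 2) ω := by
      intro ω
      set u := dist (X i ω) x / r with hu
      have hu0 : 0 ≤ u := by positivity
      have e1 : ∀ k, (near X x i (t k * r)).indicator (fun ω => β (X i ω) x) ω =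
          β (X i ω) x * if u ≤ t k then 1 else 0 := by
        intro k
        have : ω ∈ near X x i (t k * r) ↔ u ≤ t k := by
          rw [hu, div_le_iff₀ hr0]; rfl
        by_cases hk : u ≤ t k
        · rw [Set.indicator_of_mem (this.mpr hk), if_pos hk, mul_one]
        · rw [Set.indicator_of_notMem (fun h => hk (this.mp h)), if_neg hk, mul_zero]
      have e2 : localTerm X β K x r 1 i ω - ∑ k ∈ Finset.range N, c k *
          ((near X x i (t k * r)).indicator (fun ω => β (X i ω) x) ω / r) =
          β (X i ω) x / r * (K u - ∑ k ∈ Finset.range N, c k * if u ≤ t k then 1 else 0) := by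
        rw [mul_sub, Finset.mul_sum, localTerm, pow_one]
        congr 1
        refine Finset.sum_congr rfl fun k _ => ?_
        rw [e1]
        ring
      rw [e2]
      by_cases hω : ω ∈ near X x i r
      · have hu1 : u ≤ 1 := by
          rw [hu, div_le_one hr0]; exact hω
        rw [Set.indicator_of_mem hω, abs_mul]
        have h1 : |β (X i ω) x / r| ≤ C := by
          rw [abs_div, abs_of_pos hr0, div_le_iff₀ hr0]
          exact (hβb _).2.trans (mul_le_mul_of_nonneg_left hω hC.le)
        calc _ ≤ C * (η / (2 * C)) := mul_le_mul h1 (happrox u ⟨hu0, hu1⟩) (abs_nonneg _) hC.le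
          _ = η / 2 := by field_simp
      · have hu1 : 1 < u := by
          rw [hu, one_lt_div hr0]; exact not_le.mp hω
        rw [Set.indicator_of_notMem hω, h0 u fun h => (h.2.trans_lt hu1).false,
          Finset.sum_eq_zero, sub_zero, mul_zero, abs_zero]
        intro k hk
        rw [if_neg (not_le.mpr ((ht k (Finset.mem_range.mp hk)).2.trans_lt hu1)), mul_zero]
    have hnear := measurableSet_near (x := x) hXi r
    calc _ ≤ ∫ ω, (near X x i r).indicator (fun _ => η / 2) ω ∂P :=
          abs_integral_le_integral_abs.trans (integral_mono_of_nonneg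
            (ae_of_all _ fun _ => abs_nonneg _) ((integrable_const _).indicator hnear)
            (ae_of_all _ hpt))
      _ = η / 2 * ballProb P X x i 0 r := by
          rw [integral_indicator_const _ hnear, ballProb_eq, smul_eq_mul, mul_comm]
      _ ≤ η / 2 * f := mul_le_mul_of_nonneg_left (ballProb_le_maxBallProb hi r) (by positivity)
  have h1 : |∑ i ∈ Finset.Icc 1 n, ∫ ω, localTerm X β K x r 1 i ω ∂P -
      ∑ i ∈ Finset.Icc 1 n, ∑ k ∈ Finset.range N, c k * (μ k i / r)| ≤ η / 2 * (n * f) := by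
    rw [← Finset.sum_sub_distrib]
    refine (Finset.abs_sum_le_sum_abs _ _).trans ((Finset.sum_le_sum approx).trans (le_of_eq ?_))
    simp
    ring
  have h2 : |∑ i ∈ Finset.Icc 1 n, ∑ k ∈ Finset.range N, c k * (μ k i / r)| ≤ η / 2 * (n * f) := by
    rw [Finset.sum_comm]
    calc _ ≤ ∑ k ∈ Finset.range N, |c k| * (η / (2 * (S + 1)) * (n * f)) := by
          refine (Finset.abs_sum_le_sum_abs _ _).trans (Finset.sum_le_sum fun k hk => ?_)
          rw [← Finset.mul_sum, abs_mul]
          refine mul_le_mul_of_nonneg_left ?_ (abs_nonneg _)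
          obtain ⟨ht0, ht1⟩ := ht k (Finset.mem_range.mp hk)
          have := hn (t k * r) (mul_pos ht0 hr0) (mul_le_of_le_one_left hr0.le ht1)
          rw [← Finset.sum_div, abs_div, abs_of_pos hr0, div_le_iff₀ hr0]
          refine (Finset.abs_sum_le_sum_abs _ _).trans (this.trans (le_of_eq ?_))
          ring
      _ = S / (S + 1) * (η / 2 * (n * f)) := by
          rw [← Finset.sum_mul, ← hS]
          field_simp
      _ ≤ 1 * (η / 2 * (n * f)) := by
          refine mul_le_mul_of_nonneg_right ?_ (by positivity)
          rw [div_le_one (by linarith)]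
          linarith
      _ = _ := one_mul _
  calc |∑ i ∈ Finset.Icc 1 n, ∫ ω, localTerm X β K x r 1 i ω ∂P|
      = |(∑ i ∈ Finset.Icc 1 n, ∫ ω, localTerm X β K x r 1 i ω ∂P -
        ∑ i ∈ Finset.Icc 1 n, ∑ k ∈ Finset.range N, c k * (μ k i / r)) +
        ∑ i ∈ Finset.Icc 1 n, ∑ k ∈ Finset.range N, c k * (μ k i / r)| := by congr 1; ring
    _ ≤ η / 2 * (n * f) + η / 2 * (n * f) := (abs_add_le _ _).trans (add_le_add h1 h2)
    _ = _ := by ring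

end FirstOrder

/-! ### Assembly: the estimator as a ratio of sums, and the rate. -/

section Assembly

theorem tsum_lt_top_of_eventually_le {g : ℕ → ENNReal} {p : ℕ → ℝ} (hg : ∀ n, g n ≤ 1)
    (hp : Summable p) (h : ∀ᶠ n in atTop, g n ≤ ENNReal.ofReal (p n)) : ∑' n, g n < ⊤ := by
  obtain ⟨N, hN⟩ := eventually_atTop.mp h
  have hle : ∀ n, g n ≤ ENNReal.ofReal |p n| + if n < N then 1 else 0 := by
    intro n
    split_ifs with hn
    · exact (hg n).trans le_add_self
    · rw [add_zero]
      exact (hN n (not_lt.mp hn)).trans (ENNReal.ofReal_le_ofReal (le_abs_self _))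
  refine (ENNReal.tsum_le_tsum hle).trans_lt ?_
  rw [ENNReal.tsum_add, tsum_eq_sum (s := Finset.range N) (f := fun n => if n < N then _ else _)
    fun n hn => if_neg (by simpa using hn)]
  refine ENNReal.add_lt_top.mpr ⟨hp.abs.tsum_ofReal_lt_top, ?_⟩
  refine ENNReal.sum_lt_top.mpr fun n _ => ?_
  split_ifs <;> simp

theorem ratio_div_eq {N : ℝ} (hN : N ≠ 0) (A B E U V : ℝ) :
    (A / N * (U / N) - E / N * (V / N)) / (A / N * (B / N) - (E / N) ^ 2) =
      (A * U - E * V) / (A * B - E ^ 2) := by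
  have h1 : A / N * (U / N) - E / N * (V / N) = (A * U - E * V) / N ^ 2 := by field_simp
  have h2 : A / N * (B / N) - (E / N) ^ 2 = (A * B - E ^ 2) / N ^ 2 := by field_simp
  rw [h1, h2, div_div_div_cancel_right₀ (pow_ne_zero 2 hN)]

/-- With `c = m x`, the recentred quantities `U - c B` and `V - c E` carry only the bias at the
level of means, so the numerator exhibits the size of the error. -/
theorem ratio_sub_eq {A B E U V c : ℝ} (h : A * B - E ^ 2 ≠ 0) :
    (A * U - E * V) / (A * B - E ^ 2) - c =
      (A * (U - c * B) - E * (V - c * E)) / (A * B - E ^ 2) := by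
  rw [div_sub' h]
  congr 1
  ring

/-- The cross term takes away at most a quarter of `c² N²`. -/
theorem three_quarters_mul_sq_le {a b e c N : ℝ} (hc : 0 ≤ c) (hN : 0 ≤ N) (ha : c * N ≤ a)
    (hb : c * N ≤ b) (he : |e| ≤ c / 2 * N) : 3 / 4 * c ^ 2 * N ^ 2 ≤ a * b - e ^ 2 := by
  have h1 : c * N * (c * N) ≤ a * b := mul_le_mul ha hb (by positivity) (le_trans (by positivity) ha)
  have h2 : e ^ 2 ≤ (c / 2 * N) ^ 2 := sq_le_sq' (neg_le_of_abs_le he) (le_of_abs_le he)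
  nlinarith

/-- Meant for `D` of order `h ^ b`: the factor `D` of the recentred sums passes to the ratio, which
bounds the deterministic term. -/
theorem abs_ratio_le {a b e u v C D d N : ℝ} (hN : 0 < N) (hd : 0 < d) (ha : |a| ≤ C * N)
    (he : |e| ≤ C * N) (hu : |u| ≤ D * N) (hv : |v| ≤ D * N) (hdet : d * N ^ 2 ≤ a * b - e ^ 2) :
    |(a * u - e * v) / (a * b - e ^ 2)| ≤ 2 * C * D / d := by
  have hCN : 0 ≤ C * N := (abs_nonneg _).trans ha
  have hDN : 0 ≤ D * N := (abs_nonneg _).trans hu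
  have h1 : |a * u - e * v| ≤ 2 * C * D * N ^ 2 := by
    refine (abs_sub _ _).trans ?_
    rw [abs_mul, abs_mul]
    have h2 := mul_le_mul ha hu (abs_nonneg _) hCN
    have h3 := mul_le_mul he hv (abs_nonneg _) hCN
    nlinarith
  have h0 : 0 < d * N ^ 2 := by positivity
  rw [abs_div, abs_of_pos (h0.trans_le hdet)]
  calc |a * u - e * v| / (a * b - e ^ 2) ≤ 2 * C * D * N ^ 2 / (d * N ^ 2) :=
        div_le_div₀ ((abs_nonneg _).trans h1) h1 h0 hdet
    _ = 2 * C * D / d := by field_simp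

/-- The error of the ratio of sums, relative to the ratio of means. -/
theorem abs_ratio_sub_sub_ratio_le {A B E U V a b e u v c C Λ d r N : ℝ} (hN : 0 < N) (hd : 0 < d)
    (hΛ : 0 ≤ Λ) (hr0 : 0 ≤ r) (hr1 : r ≤ 1) (ha' : |a| ≤ C * N) (hb' : |b| ≤ C * N)
    (he' : |e| ≤ C * N) (hu' : |u - c * b| ≤ C * N) (hv' : |v - c * e| ≤ C * N)
    (ha : |A - a| ≤ Λ * (N * r)) (hb : |B - b| ≤ Λ * (N * r)) (he : |E - e| ≤ Λ * (N * r))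
    (hu : |U - u| ≤ Λ * (N * r)) (hv : |V - v| ≤ Λ * (N * r)) (hdet : d * N ^ 2 ≤ a * b - e ^ 2)
    (hr : 2 * (2 * C * (Λ * (1 + |c|)) + (Λ * (1 + |c|)) ^ 2) * r ≤ d / 2) :
    |(A * U - E * V) / (A * B - E ^ 2) - c -
        (a * (u - c * b) - e * (v - c * e)) / (a * b - e ^ 2)| ≤
      2 * (2 * C * (Λ * (1 + |c|)) + (Λ * (1 + |c|)) ^ 2) * (2 / d + 4 * C ^ 2 / d ^ 2) * r := by
  have hN' := hN.ne'
  have bound : ∀ {z : ℝ}, |z| ≤ C * N → |z / N| ≤ C := fun {z} hz => by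
    rw [abs_div, abs_of_pos hN]
    exact (div_le_iff₀ hN).mpr hz
  have diff : ∀ {z z' : ℝ}, |z - z'| ≤ Λ * (1 + |c|) * (N * r) →
      |z / N - z' / N| ≤ Λ * (1 + |c|) * r := fun {z z'} hz => by
    rw [← sub_div, abs_div, abs_of_pos hN, div_le_iff₀ hN]
    exact hz.trans (le_of_eq (by ring))
  have hNr : 0 ≤ Λ * (N * r) := by positivity
  have hcNr := mul_nonneg (abs_nonneg c) hNr
  have weaken : ∀ {z : ℝ}, |z| ≤ Λ * (N * r) → |z| ≤ Λ * (1 + |c|) * (N * r) := fun {z} hz => by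
    nlinarith
  -- Recentring by `c` multiplies the deviations by `1 + |c|`.
  have comb : ∀ {z z' y y' : ℝ}, |z - z'| ≤ Λ * (N * r) → |y - y'| ≤ Λ * (N * r) →
      |(z - c * y) - (z' - c * y')| ≤ Λ * (1 + |c|) * (N * r) := fun {z z' y y'} hz hy => by
    rw [show (z - c * y) - (z' - c * y') = (z - z') - c * (y - y') by ring]
    refine (abs_sub _ _).trans ?_
    rw [abs_mul]
    have := mul_le_mul_of_nonneg_left hy (abs_nonneg c)
    nlinarith
  have hdet' : d ≤ a / N * (b / N) - (e / N) ^ 2 := by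
    rw [show a / N * (b / N) - (e / N) ^ 2 = (a * b - e ^ 2) / N ^ 2 by field_simp]
    exact (le_div_iff₀ (by positivity)).mpr hdet
  obtain ⟨h1, h2⟩ := abs_ratio_sub_ratio_le (by positivity) hd hr0 hr1 (bound ha') (bound hb')
    (bound he') (bound hu') (bound hv') (diff (weaken ha)) (diff (weaken hb)) (diff (weaken he))
    (diff (comb hu hb)) (diff (comb hv he)) hdet' hr
  have h3 : A * B - E ^ 2 ≠ 0 := by
    intro h
    rw [show A / N * (B / N) - (E / N) ^ 2 = (A * B - E ^ 2) / N ^ 2 by field_simp, h,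
      zero_div] at h1
    exact lt_irrefl _ h1
  rw [ratio_div_eq hN', ratio_div_eq hN'] at h2
  rwa [ratio_sub_eq h3]

/-- The estimator in terms of sums over a single index. -/
theorem estimator_eq {Ω F : Type*} [PseudoMetricSpace F] (X : ℕ → Ω → F) (Y : ℕ → Ω → ℝ) (φ : ℝ → ℝ)
    (β : F → F → ℝ) (K : ℝ → ℝ) (x : F) {r : ℝ} (hr : r ≠ 0) (n : ℕ) (ω : Ω) :
    estimator X Y φ β K x r n ω =
      ((∑ i ∈ Finset.Icc 1 n, localTerm X β K x r 2 i ω) *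
          (∑ j ∈ Finset.Icc 1 n, localTerm X β K x r 0 j ω * φ (Y j ω)) -
        (∑ i ∈ Finset.Icc 1 n, localTerm X β K x r 1 i ω) *
          (∑ j ∈ Finset.Icc 1 n, localTerm X β K x r 1 j ω * φ (Y j ω))) /
      ((∑ i ∈ Finset.Icc 1 n, localTerm X β K x r 2 i ω) *
          (∑ j ∈ Finset.Icc 1 n, localTerm X β K x r 0 j ω) -
        (∑ i ∈ Finset.Icc 1 n, localTerm X β K x r 1 i ω) ^ 2) := by
  -- `β_i (β_i - β_j) K_i K_j` is a difference of two products of a function of `i` and a function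
  -- of `j`, so the double sums factor.
  have hw : ∀ i j, weight X β K x r i j ω = r ^ 2 *
      (localTerm X β K x r 2 i ω * localTerm X β K x r 0 j ω -
        localTerm X β K x r 1 i ω * localTerm X β K x r 1 j ω) := by
    intro i j
    unfold weight localTerm
    field_simp
  have hden : ∑ i ∈ Finset.Icc 1 n, ∑ j ∈ Finset.Icc 1 n, weight X β K x r i j ω = r ^ 2 *
      ((∑ i ∈ Finset.Icc 1 n, localTerm X β K x r 2 i ω) *
          (∑ j ∈ Finset.Icc 1 n, localTerm X β K x r 0 j ω) -
        (∑ i ∈ Finset.Icc 1 n, localTerm X β K x r 1 i ω) ^ 2) := by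
    rw [sq (∑ i ∈ Finset.Icc 1 n, localTerm X β K x r 1 i ω), Finset.sum_mul_sum,
      Finset.sum_mul_sum, ← Finset.sum_sub_distrib, Finset.mul_sum]
    refine Finset.sum_congr rfl fun i _ => ?_
    rw [← Finset.sum_sub_distrib, Finset.mul_sum]
    exact Finset.sum_congr rfl fun j _ => hw i j
  have hnum : ∑ i ∈ Finset.Icc 1 n, ∑ j ∈ Finset.Icc 1 n, weight X β K x r i j ω * φ (Y j ω) =
      r ^ 2 * ((∑ i ∈ Finset.Icc 1 n, localTerm X β K x r 2 i ω) *
          (∑ j ∈ Finset.Icc 1 n, localTerm X β K x r 0 j ω * φ (Y j ω)) -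
        (∑ i ∈ Finset.Icc 1 n, localTerm X β K x r 1 i ω) *
          (∑ j ∈ Finset.Icc 1 n, localTerm X β K x r 1 j ω * φ (Y j ω))) := by
    rw [Finset.sum_mul_sum, Finset.sum_mul_sum, ← Finset.sum_sub_distrib, Finset.mul_sum]
    refine Finset.sum_congr rfl fun i _ => ?_
    rw [← Finset.sum_sub_distrib, Finset.mul_sum]
    refine Finset.sum_congr rfl fun j _ => ?_
    rw [hw]
    ring
  rw [estimator, hnum, hden, mul_div_mul_left _ _ (pow_ne_zero 2 hr)]

/-- The rate `√(log n / (n φ))` is at most the rate with the exponent `q ≥ 1` on `φ`. -/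
theorem sqrt_log_div_le {n f l q : ℝ} (hn : 0 < n) (hf0 : 0 < f) (hf1 : f ≤ 1) (hl : 0 ≤ l)
    (hq : 1 ≤ q) : Real.sqrt l / Real.sqrt (n * f) ≤ Real.sqrt (l / (n * f ^ q)) := by
  rw [← Real.sqrt_div hl]
  refine Real.sqrt_le_sqrt ?_
  have h1 : f ^ q ≤ f := by
    calc f ^ q ≤ f ^ (1 : ℝ) := Real.rpow_le_rpow_of_exponent_ge hf0 hf1 hq
      _ = f := Real.rpow_one f
  have h2 : 0 < f ^ q := Real.rpow_pos_of_pos hf0 q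
  gcongr

/-- Two indices are needed for the set to be nonempty, and the bound `3/4` makes it bounded above,
without which `sSup` would take its default value. -/
theorem half_le_maxExponent {p : ℕ → ℕ → ℝ} {n : ℕ} (hn : 2 ≤ n)
    (hp : ∀ i ∈ Finset.Icc 1 n, ∀ j ∈ Finset.Icc 1 n, i ≠ j → 1 / 2 ≤ p i j ∧ p i j < 3 / 4) :
    1 / 2 ≤ maxExponent p n := by
  have h1 : 1 ∈ Finset.Icc 1 n := Finset.mem_Icc.mpr ⟨le_rfl, by omega⟩
  have h2 : 2 ∈ Finset.Icc 1 n := Finset.mem_Icc.mpr ⟨by norm_num, hn⟩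
  refine (hp 1 h1 2 h2 (by norm_num)).1.trans (le_csSup ⟨3 / 4, ?_⟩ ⟨1, h1, 2, h2, by norm_num, rfl⟩)
  rintro _ ⟨i, hi, j, hj, hij, rfl⟩
  exact (hp i hi j hj hij).2.le

/-- `√(n f)` is at least `n ^ ((1 - θ) / 2)`: half of this power absorbs `√(log n)`, the other half
tends to infinity. -/
theorem eventually_sqrt_log_div_sqrt_le {θ δ : ℝ} (hθ : 2 * θ < 1) (hδ : 0 < δ) {f : ℕ → ℝ}
    (hf : ∀ᶠ n : ℕ in atTop, (n : ℝ) ^ (-θ) ≤ f n) :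
    ∀ᶠ n : ℕ in atTop, Real.sqrt (Real.log n) / Real.sqrt (n * f n) ≤ δ := by
  have hτ : 0 < (1 - θ) / 4 := by linarith
  filter_upwards [hf, eventually_sqrt_log_mul_rpow_le hτ,
    eventually_mul_rpow_le (C := 1) (s := -((1 - θ) / 4)) (t := 0) hδ (by linarith),
    eventually_gt_atTop 0] with n hfn h1 h2 hn
  have hn0 : (0 : ℝ) < n := by exact_mod_cast hn
  rw [Real.rpow_zero, one_mul, mul_one] at h2
  have hd : (n : ℝ) ^ ((1 - θ) / 2) ≤ Real.sqrt (n * f n) := by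
    refine Real.le_sqrt_of_sq_le ?_
    rw [← Real.rpow_natCast, ← Real.rpow_mul hn0.le]
    calc (n : ℝ) ^ ((1 - θ) / 2 * (2 : ℕ)) = n * (n : ℝ) ^ (-θ) := by
          rw [show (1 - θ) / 2 * (2 : ℕ) = 1 + (-θ) by push_cast; ring, Real.rpow_add hn0,
            Real.rpow_one]
      _ ≤ n * f n := mul_le_mul_of_nonneg_left hfn hn0.le
  have hd0 : 0 < (n : ℝ) ^ ((1 - θ) / 2) := Real.rpow_pos_of_pos hn0 _
  have hp0 : 0 < (n : ℝ) ^ (-((1 - θ) / 4)) := Real.rpow_pos_of_pos hn0 _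
  have hs0 := Real.sqrt_nonneg (Real.log n)
  calc Real.sqrt (Real.log n) / Real.sqrt (n * f n)
      ≤ Real.sqrt (Real.log n) / (n : ℝ) ^ ((1 - θ) / 2) := by gcongr
    _ = Real.sqrt (Real.log n) * (n : ℝ) ^ (-((1 - θ) / 4)) * (n : ℝ) ^ (-((1 - θ) / 4)) := by
        rw [mul_assoc, ← Real.rpow_add hn0, div_eq_mul_inv, ← Real.rpow_neg hn0.le]
        congr 2
        ring
    _ ≤ 1 * (n : ℝ) ^ (-((1 - θ) / 4)) := by
        refine mul_le_mul_of_nonneg_right ?_ hp0.le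
        have := mul_nonneg hs0 hp0.le
        linarith
    _ ≤ δ := by rw [one_mul]; exact h2

end Assembly

end LocalLinear

/-! ### The main theorem. -/

theorem theorem1 {Ω F : Type*} [MeasurableSpace Ω] [PseudoMetricSpace F] [MeasurableSpace F]
    [BorelSpace F] (P : Measure Ω) [IsProbabilityMeasure P]
    (X : ℕ → Ω → F) (Y : ℕ → Ω → ℝ) (φ : ℝ → ℝ) (m : F → ℝ) (β : F → F → ℝ) (K : ℝ → ℝ)
    (h : ℕ → ℝ) (x : F) (b : ℝ) (γ : ℕ → ℕ → F → ℝ) (p₁ p₂ : ℕ → ℕ → ℕ → ℝ)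
    (h_model : RegressionModel P X Y φ m)
    (h_bandwidth : Bandwidth h)
    (h_positive : PositiveBalls P X x)
    (h_holder : HolderNear m x h b)
    (h_beta : LocatingFunction β x)
    (h_moments : ConditionalMoments P X Y φ x h γ)
    (h_kernel : KernelAssumption P X x h K)
    (h_local_kernel : LocalKernelCondition P X x h K)
    (h_local_beta : LocalBetaCondition P X x h β)
    (h_comparable : ComparableBalls P X x h)
    (h_mixing : ArithmeticMixing P X Y x h)
    (h_joint : JointBallBounds P X x h p₁ p₂)
    (h_joint_kernel : JointKernelCondition P X x h K) :
    ∃ R : ℕ → ℝ, R =O[atTop] (fun n => h n ^ b) ∧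
      IsBigOAco P (fun n ω => estimator X Y φ β K x (h n) n ω - m x - R n)
        (fun n => Real.sqrt (Real.log n /
          (n * maxBallProb P X x n (h n) ^ (4 * maxExponent (p₂ n) n - 1)))) := by
  have hX := h_model.measurable_X
  have hY := h_model.measurable_Y
  have hh := h_bandwidth.pos
  have hK := h_kernel.differentiable.continuousOn
  have h0 := fun u => kernel_eq_zero (u := u) h_kernel.nonneg h_kernel.type
  have hKm := measurable_kernel hK h0
  obtain ⟨a, Cα, θ, -, -, hθ0, -, hθ1, hφθ⟩ := h_mixing.exists_exponents
  obtain ⟨B, hB, hBb⟩ := exists_localTerm_bound (X := X) h_beta hK h0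
  obtain ⟨Cj, hCj, hjointb⟩ := h_joint.exists_joint_bound
  obtain ⟨c, hc, hlow⟩ := exists_mean_lower_bound (β := β) hX hh h_positive h_beta h_kernel
    h_local_kernel h_comparable
  obtain ⟨Cb, hbias⟩ := exists_bias_bound h_model hh h_holder h_beta hK h0
  have hfirst := eventually_abs_sum_mean_le hX hY hh h_beta hK h0 h_local_beta h_mixing
    (by positivity : 0 < c / 2)
  obtain ⟨_, _, -, -, hpe⟩ := id h_joint
  set S : ℕ → ℕ → Ω → ℝ := fun l n ω => ∑ j ∈ Finset.Icc 1 n, localTerm X β K x (h n) l j ω with hS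
  set s : ℕ → ℕ → ℝ := fun l n =>
    ∑ j ∈ Finset.Icc 1 n, ∫ ω, localTerm X β K x (h n) l j ω ∂P with hs
  set Q : ℕ → ℕ → Ω → ℝ := fun l n ω =>
    ∑ j ∈ Finset.Icc 1 n, localTerm X β K x (h n) l j ω * φ (Y j ω) with hQ
  set q : ℕ → ℕ → ℝ := fun l n =>
    ∑ j ∈ Finset.Icc 1 n, ∫ ω, localTerm X β K x (h n) l j ω * φ (Y j ω) ∂P with hq
  set f : ℕ → ℝ := fun n => maxBallProb P X x n (h n) with hf
  have tailS : ∀ l ≤ 2, ∃ (Λ : ℝ) (p : ℕ → ℝ), 0 < Λ ∧ Summable p ∧ ∀ᶠ n in atTop,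
      P.real {ω | Λ * (Real.sqrt (n * f n) * Real.sqrt (Real.log n)) ≤ |S l n ω - s l n|} ≤ p n := by
    intro l hl
    have := exists_tail_bound_localTerm (P := P) (Y := Y) (K := K) (W := fun _ _ => 1) hX hY hh h_beta
      hK h0 h_mixing (fun j _ => measurable_const) ?_ ?_ l hl
    · simpa only [mul_one, Finset.sum_sub_distrib] using this
    · refine fun k _ => ⟨1, Eventually.of_forall fun n j hj => ⟨integrable_const _, ?_⟩⟩
      simp only [abs_one, one_pow, setIntegral_const, smul_eq_mul, mul_one, one_mul]
      rw [← ballProb_eq]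
      exact ballProb_le_maxBallProb hj _
    · refine ⟨Cj, ?_⟩
      filter_upwards [hjointb] with n hn i hi j hj hij
      refine ⟨integrable_const _, ?_⟩
      simpa using hn i hi j hj hij
  have tailQ : ∀ l ≤ 2, ∃ (Λ : ℝ) (p : ℕ → ℝ), 0 < Λ ∧ Summable p ∧ ∀ᶠ n in atTop,
      P.real {ω | Λ * (Real.sqrt (n * f n) * Real.sqrt (Real.log n)) ≤ |Q l n ω - q l n|} ≤ p n := by
    intro l hl
    have := exists_tail_bound_localTerm (P := P) (Y := Y) (K := K) (W := fun j ω => φ (Y j ω)) hX hY hh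
      h_beta hK h0 h_mixing
      (fun j _ => h_model.measurable_φ.comp (measurable_fst.comp (comap_measurable _)))
      (fun k hk => exists_moment_bound h_model h_moments k hk)
      (exists_joint_moment_bound h_model h_moments h_joint) l hl
    simpa only [Finset.sum_sub_distrib] using this
  obtain ⟨Λ₀, t₀, hΛ₀, ht₀, hS₀⟩ := tailS 0 (by norm_num)
  obtain ⟨Λ₁, t₁, hΛ₁, ht₁, hS₁⟩ := tailS 1 (by norm_num)
  obtain ⟨Λ₂, t₂, hΛ₂, ht₂, hS₂⟩ := tailS 2 le_rfl
  obtain ⟨Λ₃, t₃, hΛ₃, ht₃, hQ₀⟩ := tailQ 0 (by norm_num)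
  obtain ⟨Λ₄, t₄, hΛ₄, ht₄, hQ₁⟩ := tailQ 1 (by norm_num)
  -- A common deviation constant for all five sums; each single constant is at most `Λ`.
  set Λ := Λ₀ + Λ₁ + Λ₂ + Λ₃ + Λ₄ with hΛ
  have hfpos : ∀ᶠ n in atTop, 0 < f n := by
    filter_upwards [hφθ, eventually_gt_atTop 0] with n hn hn0
    exact (Real.rpow_pos_of_pos (by exact_mod_cast hn0) _).trans_le hn
  have hf1 : ∀ n, f n ≤ 1 := fun n => maxBallProb_le_one n _
  have hsB : ∀ n, ∀ l ≤ 2, |s l n| ≤ B * (n * f n) := by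
    intro n l hl
    have hterm : ∀ j ∈ Finset.Icc 1 n, |∫ ω, localTerm X β K x (h n) l j ω ∂P| ≤ B * f n := by
      intro j hj
      have hnear := measurableSet_near (x := x) (hX j (Finset.mem_Icc.mp hj).1) (h n)
      calc |∫ ω, localTerm X β K x (h n) l j ω ∂P| ≤ ∫ ω, |localTerm X β K x (h n) l j ω| ∂P :=
            abs_integral_le_integral_abs
        _ ≤ ∫ ω, (near X x j (h n)).indicator (fun _ => B) ω ∂P :=
            integral_mono_of_nonneg (ae_of_all _ fun _ => abs_nonneg _)
              ((integrable_const _).indicator hnear) (ae_of_all _ fun ω => hBb _ l j ω (hh n) hl)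
        _ = B * ballProb P X x j 0 (h n) := by
            rw [integral_indicator_const _ hnear, ballProb_eq, smul_eq_mul, mul_comm]
        _ ≤ B * f n := mul_le_mul_of_nonneg_left (ballProb_le_maxBallProb hj _) (by linarith)
    refine (Finset.abs_sum_le_sum_abs _ _).trans ((Finset.sum_le_sum hterm).trans (le_of_eq ?_))
    rw [Finset.sum_const, Nat.card_Icc, nsmul_eq_mul, Nat.add_sub_cancel]
    ring
  obtain ⟨C₁, hC₁⟩ := exists_moment_bound h_model h_moments 1 le_rfl
  have hqb : ∀ᶠ n in atTop, ∀ l ≤ 2, |q l n - m x * s l n| ≤ |Cb| * h n ^ b * (n * f n) := by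
    filter_upwards [hbias, hC₁] with n hn hn1 l hl
    have hterm : ∀ j ∈ Finset.Icc 1 n, |∫ ω, localTerm X β K x (h n) l j ω * φ (Y j ω) ∂P -
        m x * ∫ ω, localTerm X β K x (h n) l j ω ∂P| ≤ |Cb| * h n ^ b * f n := by
      intro j hj
      have hj1 := (Finset.mem_Icc.mp hj).1
      have hfm : Measurable (localTerm X β K x (h n) l j) :=
        (measurable_local h_beta.measurable hKm (h n) l).comp (hX j hj1)
      have hWm : Measurable fun ω => φ (Y j ω) := h_model.measurable_φ.comp (hY j hj1)
      have hi := (integrable_mul_of_indicator_bound one_ne_zero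
        (measurableSet_near (x := x) (hX j hj1) (h n)) hfm hWm
        (fun ω => hBb _ l j ω (hh n) hl) (hn1 j hj).1).1
      simp only [pow_one] at hi
      refine (hn j hj l hl ((integrable_norm_iff (hfm.mul hWm).aestronglyMeasurable).mp hi)).trans ?_
      rw [← mul_assoc]
      have h6 : 0 ≤ h n ^ b := Real.rpow_nonneg (hh n).le _
      have h7 : 0 ≤ f n := maxBallProb_nonneg n _
      gcongr
      exact le_abs_self _
    rw [Finset.mul_sum, ← Finset.sum_sub_distrib]
    refine (Finset.abs_sum_le_sum_abs _ _).trans ((Finset.sum_le_sum hterm).trans (le_of_eq ?_))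
    rw [Finset.sum_const, Nat.card_Icc, nsmul_eq_mul, Nat.add_sub_cancel]
    ring
  have hdet : ∀ᶠ n in atTop, 3 / 4 * c ^ 2 * (n * f n) ^ 2 ≤ s 2 n * s 0 n - s 1 n ^ 2 := by
    filter_upwards [hlow, hfirst] with n hn hn1
    have h7 : 0 ≤ f n := maxBallProb_nonneg n _
    have hsum : c * (n * f n) = ∑ _j ∈ Finset.Icc 1 n, c * f n := by
      rw [Finset.sum_const, Nat.card_Icc, nsmul_eq_mul, Nat.add_sub_cancel]
      ring
    refine three_quarters_mul_sq_le hc.le (by positivity) ?_ ?_ hn1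
    · rw [hsum]
      exact Finset.sum_le_sum fun j hj => (hn j hj).2
    · rw [hsum]
      exact Finset.sum_le_sum fun j hj => (hn j hj).1
  have hd : 0 < 3 / 4 * c ^ 2 := by positivity
  -- The ratio of means minus `m x`, written in the recentred form of `ratio_sub_eq`.
  refine ⟨fun n => (s 2 n * (q 0 n - m x * s 0 n) - s 1 n * (q 1 n - m x * s 1 n)) /
    (s 2 n * s 0 n - s 1 n ^ 2), ?_, ?_⟩
  · refine IsBigO.of_bound (2 * B * |Cb| / (3 / 4 * c ^ 2)) ?_
    filter_upwards [hqb, hdet, hfpos, eventually_gt_atTop 0] with n hn1 hn2 hn3 hn0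
    have hN : 0 < n * f n := mul_pos (by exact_mod_cast hn0) hn3
    rw [Real.norm_eq_abs, Real.norm_of_nonneg (Real.rpow_nonneg (hh n).le _)]
    refine (abs_ratio_le hN hd (hsB n 2 le_rfl) (hsB n 1 (by norm_num)) (hn1 0 (by norm_num))
      (hn1 1 (by norm_num)) hn2).trans (le_of_eq ?_)
    ring
  · have hhb : ∀ᶠ n in atTop, h n ^ b ≤ 1 := by
      filter_upwards [h_bandwidth.tendsto_zero.eventually_le_const one_pos] with n hn
      exact Real.rpow_le_one (hh n).le hn h_holder.1.le
    set C := B + |Cb| with hC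
    have hΛ0 : 0 < Λ := by positivity
    have hC0 : 0 < C := by positivity
    set L := 2 * (2 * C * (Λ * (1 + |m x|)) + (Λ * (1 + |m x|)) ^ 2) with hL
    have hL0 : 0 < L := by positivity
    set d := 3 / 4 * c ^ 2 with hd_def
    set A := L * (2 / d + 4 * C ^ 2 / d ^ 2) with hA
    have hA0 : 0 < A := by positivity
    refine ⟨A, hA0, tsum_lt_top_of_eventually_le (fun n => prob_le_one)
      ((((ht₀.add ht₁).add ht₂).add ht₃).add ht₄) ?_⟩
    filter_upwards [hS₀, hS₁, hS₂, hQ₀, hQ₁, hqb, hdet, hfpos, hhb, hpe, eventually_ge_atTop 2,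
      eventually_sqrt_log_div_sqrt_le hθ1 one_pos hφθ,
      eventually_sqrt_log_div_sqrt_le hθ1 (by positivity : 0 < d / 2 / L) hφθ]
      with n hS₀ hS₁ hS₂ hQ₀ hQ₁ hqb hdet hfn hhb hpe hn2 hr1 hrL
    have hn0 : (0 : ℝ) < n := by exact_mod_cast (by omega : 0 < n)
    have hlog : 0 ≤ Real.log n := Real.log_natCast_nonneg n
    have hN : 0 < n * f n := mul_pos hn0 hfn
    set T := Real.sqrt (n * f n) * Real.sqrt (Real.log n) with hT
    have hT0 : 0 ≤ T := by positivity
    -- The deviation `√(n f log n)` is the scale `N = n f` of the means times the relative error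
    -- `√(log n) / √(n f)`, which is the form used in the stability bound.
    have hTr : T = n * f n * (Real.sqrt (Real.log n) / Real.sqrt (n * f n)) := by
      have h8 : 0 < Real.sqrt (n * f n) := Real.sqrt_pos.mpr hN
      rw [hT, mul_div_assoc', eq_div_iff h8.ne', mul_right_comm, Real.mul_self_sqrt hN.le]
    have hrate := sqrt_log_div_le (q := 4 * maxExponent (p₂ n) n - 1) hn0 hfn (hf1 n) hlog
      (by linarith [half_le_maxExponent hn2 fun i hi j hj hij =>
        ⟨(hpe i hi j hj hij).2.2.1, (hpe i hi j hj hij).2.2.2.1⟩])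
    -- Off the five deviation events the stability of the ratio bounds the error by `A` times the
    -- relative error, hence by `A` times the stated rate.
    have hsub : {ω | A < |(estimator X Y φ β K x (h n) n ω - m x -
        (s 2 n * (q 0 n - m x * s 0 n) - s 1 n * (q 1 n - m x * s 1 n)) /
          (s 2 n * s 0 n - s 1 n ^ 2)) /
        Real.sqrt (Real.log n / (n * f n ^ (4 * maxExponent (p₂ n) n - 1)))|} ⊆
        {ω | Λ₀ * T ≤ |S 0 n ω - s 0 n|} ∪ {ω | Λ₁ * T ≤ |S 1 n ω - s 1 n|} ∪
        {ω | Λ₂ * T ≤ |S 2 n ω - s 2 n|} ∪ {ω | Λ₃ * T ≤ |Q 0 n ω - q 0 n|} ∪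
        {ω | Λ₄ * T ≤ |Q 1 n ω - q 1 n|} := by
      intro ω hω
      by_contra hbad
      simp only [Set.mem_union, Set.mem_ofPred_eq, not_or, not_le] at hbad
      obtain ⟨⟨⟨⟨b₀, b₁⟩, b₂⟩, b₃⟩, b₄⟩ := hbad
      have up : ∀ {Λ' z : ℝ}, Λ' ≤ Λ → z < Λ' * T →
          z ≤ Λ * (n * f n * (Real.sqrt (Real.log n) / Real.sqrt (n * f n))) :=
        fun hΛ' hz => by
          rw [← hTr]
          exact hz.le.trans (mul_le_mul_of_nonneg_right hΛ' hT0)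
      have hsC : ∀ l ≤ 2, |s l n| ≤ C * (n * f n) := fun l hl =>
        (hsB n l hl).trans (mul_le_mul_of_nonneg_right
          (by rw [hC]; linarith [abs_nonneg Cb]) hN.le)
      have hqC : ∀ l ≤ 2, |q l n - m x * s l n| ≤ C * (n * f n) := fun l hl =>
        (hqb l hl).trans (mul_le_mul_of_nonneg_right
          (by rw [hC]; linarith [mul_le_of_le_one_right (abs_nonneg Cb) hhb]) hN.le)
      have key := abs_ratio_sub_sub_ratio_le hN hd hΛ0.le (by positivity) hr1 (hsC 2 le_rfl)
        (hsC 0 (by norm_num)) (hsC 1 (by norm_num)) (hqC 0 (by norm_num)) (hqC 1 (by norm_num))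
        (up (by rw [hΛ]; linarith) b₂) (up (by rw [hΛ]; linarith) b₀)
        (up (by rw [hΛ]; linarith) b₁) (up (by rw [hΛ]; linarith) b₃)
        (up (by rw [hΛ]; linarith) b₄) hdet
        (by rw [le_div_iff₀ hL0] at hrL; rw [mul_comm]; exact hrL)
      rw [← estimator_eq X Y φ β K x (hh n).ne' n ω] at key
      refine (show ¬ A < _ from not_lt.mpr ?_) hω
      rw [abs_div, abs_of_nonneg (Real.sqrt_nonneg _)]
      exact div_le_of_le_mul₀ (Real.sqrt_nonneg _) hA0.le
        (key.trans (mul_le_mul_of_nonneg_left hrate hA0.le))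
    refine (measure_mono hsub).trans ?_
    rw [← ofReal_measureReal (measure_ne_top P _)]
    refine ENNReal.ofReal_le_ofReal ?_
    refine (measureReal_union_le _ _).trans (add_le_add ?_ hQ₁)
    refine (measureReal_union_le _ _).trans (add_le_add ?_ hQ₀)
    refine (measureReal_union_le _ _).trans (add_le_add ?_ hS₂)
    exact (measureReal_union_le _ _).trans (add_le_add hS₀ hS₁)
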